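/- Let $k$ be an algebraically closed field of characteristic $0$. Let $G$ be an affine algebraic supergroup over $k$ with Lie superalgebra $\mathfrak g=\mathfrak g_{\bar 0}\oplus\mathfrak g_{\bar 1}$ and even part $G_0$, let $\theta$ be an involution of $G$, and let $K\subseteq G$ be a closed subgroup with $(G^\theta)^0\subseteq K\subseteq G^\theta$. Write $\mathfrak g=\mathfrak k\oplus\mathfrak p$ for the decomposition into the $(+1)$- and $(-1)$-eigenspaces of $\theta$, so that $\mathfrak k=\operatorname{Lie}K$, and put $\mathfrak k'=\mathfrak k_{\bar 0}\oplus\mathfrak p_{\bar 1}$. Let $K'\subseteq G$ be the closed subgroup with $K'_0=K_0$ and $\operatorname{Lie}K'=\mathfrak k'$. Assume that the homogeneous spaces $G/K$ and $G_0/K_0$ are affine. For an affine supervariety $X$ and a point $x$ with maximal ideal $\mathfrak m_x\subset k[X]$, let $\operatorname{Dist}(X,x)$ be the space of linear functionals on $k[X]$ that vanish on some power of $\mathfrak m_x$. The group $K_0$ and the Lie superalgebra $\mathfrak g$ act on $\operatorname{Dist}(G/K,eK)$ by left translations, as $K_0$ and $\mathfrak g_{\bar 0}$ do on $\operatorname{Dist}(G_0/K_0,eK_0)$.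 A $K'$-module is given by compatible actions of $K_0$ and of $\mathfrak k'$. For a $K_0$-module $V$ let $\operatorname{Ind}_{\mathfrak k_{\bar 0}}^{\mathfrak k'}V=U\mathfrak k'\otimes_{U\mathfrak k_{\bar 0}}V$, with $h\in K_0$ acting by $h(u\otimes v)=\operatorname{Ad}(h)u\otimes hv$. 1. There is an isomorphism of $K'$-modules $$\Phi:\operatorname{Ind}_{\mathfrak k_{\bar 0}}^{\mathfrak k'}\operatorname{Dist}(G_0/K_0,eK_0)\;\xrightarrow{\ \sim\ }\;\operatorname{Dist}(G/K,eK),$$ given by $\Phi(u\otimes\psi)=u\cdot i_*\psi$, where $i_*$ is the pushforward along $i:G_0/K_0\to G/K$. 2. The map $u\otimes[w]\mapsto[uw]$ is an isomorphism of $K'$-modules $$\operatorname{Ind}_{\mathfrak k_{\bar 0}}^{\mathfrak k'}\bigl(U\mathfrak g_{\bar 0}/(U\mathfrak g_{\bar 0}\,\mathfrak k_{\bar 0})\bigr)\;\xrightarrow{\ \sim\ }\;U\mathfrak g/(U\mathfrak g\,\mathfrak k),$$ where $K_0$ acts on both quotients by the adjoint action and $\mathfrak k_{\bar 0}$, $\mathfrak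 k'$ act by left multiplication. 3. Suppose that $\Lambda^{\mathrm{top}}\mathfrak p_{\bar 1}$ is a trivial $K_0$-module (for instance with $K'$ quasireductive, which is not needed). Then there is an element $v\in U\mathfrak k'$ whose image in $U\mathfrak k'/(U\mathfrak k'\,\mathfrak k_{\bar 0})$ is nonzero and $K'$-invariant, and for every such $v$ the map $z\mapsto\Phi(v\otimes z)$ is a linear isomorphism $$\operatorname{Dist}(G_0/K_0,eK_0)^{K_0}\;\xrightarrow{\ \sim\ }\;\operatorname{Dist}(G/K,eK)^{K'}.$$ -/

import Mathlib

open scoped TensorProduct DirectSum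
open Coalgebra

set_option maxSynthPendingDepth 3

noncomputable section

/-- The Koszul sign `(-1)^{ij}`. -/
def koszulSign (k : Type*) [Field k] (i j : ZMod 2) : k := if i = 1 ∧ j = 1 then -1 else 1

theorem zmod2_cases (i : ZMod 2) : i = 0 ∨ i = 1 := by decide +revert

section koszulSign

variable (k : Type*) [Field k]

@[simp] theorem koszulSign_zero_left (j : ZMod 2) : koszulSign k 0 j = 1 := by simp [koszulSign]

@[simp] theorem koszulSign_zero_right (i : ZMod 2) : koszulSign k i 0 = 1 := by simp [koszulSign]

@[simp] theorem koszulSign_one_one : koszulSign k 1 1 = -1 := by simp [koszulSign]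

theorem superJacobi_aux {R : Type*} [Ring R] [Algebra k R] (X Y Z : R) (i j l : ZMod 2) :
    koszulSign k i (j + l) • (X * (koszulSign k j l • (Y * Z) - Z * Y)) -
      (koszulSign k j l • (Y * Z) - Z * Y) * X =
    (koszulSign k (i + j) l • ((koszulSign k i j • (X * Y) - Y * X) * Z) -
      Z * (koszulSign k i j • (X * Y) - Y * X)) +
    koszulSign k i j • (koszulSign k j (i + l) • (Y * (koszulSign k i l • (X * Z) - Z * X)) -
      (koszulSign k i l • (X * Z) - Z * X) * Y) := by
  have h2 : (1 + 1 : ZMod 2) = 0 := by decide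
  rcases zmod2_cases i with rfl | rfl <;> rcases zmod2_cases j with rfl | rfl <;>
    rcases zmod2_cases l with rfl | rfl <;>
    simp only [h2, add_zero, zero_add, koszulSign_zero_left, koszulSign_zero_right,
      koszulSign_one_one, one_smul, neg_smul] <;> noncomm_ring

end koszulSign

/-- The parity operator `a ↦ (-1)^{|a|} a` of a superalgebra. -/
def superParity {k A : Type*} [Field k] [Ring A] [Algebra k A] (gr : ZMod 2 → Submodule k A)
    [GradedAlgebra gr] : A →ₗ[k] A :=
  LinearMap.id - (2 : k) • GradedAlgebra.proj gr 1

/-- An affine algebraic supergroup over `k`, given by its coordinate ring `k[G]`, a finitely generated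
supercommutative Hopf superalgebra. -/
structure Supergroup (k : Type*) [Field k] where
  /-- the algebra `k[G]` -/
  Fun : Type*
  [ring : Ring Fun]
  [algebra : Algebra k Fun]
  /-- even and odd functions -/
  gr : ZMod 2 → Submodule k Fun
  [graded : GradedAlgebra gr]
  supercomm : ∀ {i j : ZMod 2} {a b : Fun}, a ∈ gr i → b ∈ gr j →
    a * b = koszulSign k i j • (b * a)
  finiteType : Algebra.FiniteType k Fun
  /-- the even part `G₀` is reduced -/
  reduced : ∀ (a : Fun) (n : ℕ), a ^ n ∈ Ideal.span (gr 1 : Set Fun) →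
    a ∈ Ideal.span (gr 1 : Set Fun)
  [coalgebra : Coalgebra k Fun]
  counit_one : counit (R := k) (1 : Fun) = 1
  counit_mul : ∀ a b : Fun, counit (R := k) (a * b) = counit (R := k) a * counit (R := k) b
  counit_parity : ∀ a : Fun, counit (R := k) (superParity gr a) = counit (R := k) a
  comul_one : comul (R := k) (1 : Fun) = 1 ⊗ₜ 1
  comul_mul : ∀ a b : Fun, GradedTensorProduct.of k gr gr (comul (a * b)) =
    GradedTensorProduct.of k gr gr (comul a) * GradedTensorProduct.of k gr gr (comul b)
  comul_parity : ∀ a : Fun, comul (R := k) (superParity gr a) =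
    TensorProduct.map (superParity gr) (superParity gr) (comul a)
  /-- the inversion, a morphism of supervarieties -/
  antipode : Fun →ₐ[k] Fun
  antipode_parity : ∀ a : Fun, antipode (superParity gr a) = superParity gr (antipode a)
  mul_antipode_left : ∀ a : Fun, LinearMap.mul' k Fun (antipode.toLinearMap.rTensor Fun (comul a)) =
    algebraMap k Fun (counit a)
  mul_antipode_right : ∀ a : Fun, LinearMap.mul' k Fun (antipode.toLinearMap.lTensor Fun (comul a)) =
    algebraMap k Fun (counit a)

attribute [instance] Supergroup.ring Supergroup.algebra Supergroup.graded Supergroup.coalgebra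

namespace Supergroup

variable {k : Type*} [Field k] (G : Supergroup k)

/-- The projection of a function to its odd part. -/
def oddProj : G.Fun →ₗ[k] G.Fun := GradedAlgebra.proj G.gr 1

/-- The parity operator on functions -/
def parity : G.Fun →ₗ[k] G.Fun := superParity G.gr

theorem parity_apply (a : G.Fun) : G.parity a = a - (2 : k) • G.oddProj a := rfl

theorem oddProj_of_even {a : G.Fun} (ha : a ∈ G.gr 0) : G.oddProj a = 0 := by
  rw [oddProj, GradedAlgebra.proj_apply, DirectSum.decompose_of_mem_ne G.gr ha (by decide)]

theorem oddProj_of_odd {a : G.Fun} (ha : a ∈ G.gr 1) : G.oddProj a = a := by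
  rw [oddProj, GradedAlgebra.proj_apply, DirectSum.decompose_of_mem_same G.gr ha]

theorem oddProj_mem (a : G.Fun) : G.oddProj a ∈ G.gr 1 := by
  rw [oddProj, GradedAlgebra.proj_apply]; exact SetLike.coe_mem _

theorem sub_oddProj_mem (a : G.Fun) : a - G.oddProj a ∈ G.gr 0 := by
  classical
  have h := DirectSum.sum_support_decompose G.gr a
  have h2 : a = (DirectSum.decompose G.gr a 0 : G.Fun) + DirectSum.decompose G.gr a 1 := by
    conv_lhs => rw [← h]
    rw [Finset.sum_subset (Finset.subset_univ _)]
    · exact Fin.sum_univ_two _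
    · intro i _ hi; simpa using hi
  have : a - G.oddProj a = (DirectSum.decompose G.gr a 0 : G.Fun) := by
    rw [oddProj, GradedAlgebra.proj_apply]; nth_rw 1 [h2]; abel
  rw [this]; exact SetLike.coe_mem _

theorem ind_even_odd {p : G.Fun → Prop} (h0 : ∀ a ∈ G.gr 0, p a) (h1 : ∀ a ∈ G.gr 1, p a)
    (hadd : ∀ a b, p a → p b → p (a + b)) (a : G.Fun) : p a := by
  have := hadd _ _ (h0 _ (G.sub_oddProj_mem a)) (h1 _ (G.oddProj_mem a))
  simpa using this

theorem parity_of_even {a : G.Fun} (ha : a ∈ G.gr 0) : G.parity a = a := by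
  simp [parity_apply, G.oddProj_of_even ha]

theorem parity_of_odd {a : G.Fun} (ha : a ∈ G.gr 1) : G.parity a = -a := by
  simp [parity_apply, G.oddProj_of_odd ha, two_smul]

/-- The multiplication of `k[G] ⊗ k[G]`, with its sign `(-1)^{|b||c|} = 1 - 2 [b, c both odd]`. -/
theorem graded_tmul_mul (a b c d : G.Fun) :
    (GradedTensorProduct.of k G.gr G.gr).symm
      (GradedTensorProduct.of k G.gr G.gr (a ⊗ₜ b) * GradedTensorProduct.of k G.gr G.gr (c ⊗ₜ d)) =
    (a * c) ⊗ₜ (b * d) - (2 : k) • ((a * G.oddProj c) ⊗ₜ (G.oddProj b * d)) := by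
  induction b using G.ind_even_odd with
  | h0 b hb =>
    rw [G.oddProj_of_even hb]
    induction c using G.ind_even_odd with
    | h0 c hc =>
      have := GradedTensorProduct.tmul_coe_mul_coe_tmul (R := k) G.gr G.gr a ⟨b, hb⟩ ⟨c, hc⟩ d
      simpa using congrArg (GradedTensorProduct.of k G.gr G.gr).symm this
    | h1 c hc =>
      have := GradedTensorProduct.tmul_coe_mul_coe_tmul (R := k) G.gr G.gr a ⟨b, hb⟩ ⟨c, hc⟩ d
      simpa using congrArg (GradedTensorProduct.of k G.gr G.gr).symm this
    | hadd c c' h h' =>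
      simp only [mul_add, TensorProduct.add_tmul, map_add, zero_mul, TensorProduct.tmul_zero,
        smul_zero, sub_zero] at h h' ⊢
      rw [h, h']
  | h1 b hb =>
    rw [G.oddProj_of_odd hb]
    induction c using G.ind_even_odd with
    | h0 c hc =>
      rw [G.oddProj_of_even hc]
      have := GradedTensorProduct.tmul_coe_mul_coe_tmul (R := k) G.gr G.gr a ⟨b, hb⟩ ⟨c, hc⟩ d
      simpa using congrArg (GradedTensorProduct.of k G.gr G.gr).symm this
    | h1 c hc =>
      rw [G.oddProj_of_odd hc]
      have := GradedTensorProduct.tmul_coe_mul_coe_tmul (R := k) G.gr G.gr a ⟨b, hb⟩ ⟨c, hc⟩ d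
      have h2 := congrArg (GradedTensorProduct.of k G.gr G.gr).symm this
      simp only [mul_one, uzpow_one, one_smul, Units.neg_smul, map_neg] at h2
      simp only [GradedTensorProduct.of_symm_of] at h2
      rw [two_smul]
      rw [h2]; abel
    | hadd c c' h h' =>
      simp only [mul_add, TensorProduct.add_tmul, map_add, smul_add] at h h' ⊢
      rw [h, h']; abel
  | hadd b b' h h' =>
      simp only [add_mul, TensorProduct.tmul_add, map_add, smul_add] at h h' ⊢
      rw [h, h']; abel

end Supergroup

/-- A Lie superalgebra over a field of characteristic zero. -/
class LieSuperalgebra (k L : Type*) [Field k] [AddCommGroup L] [Module k L] where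
  /-- the even and the odd part -/
  part : ZMod 2 → Submodule k L
  isCompl : IsCompl (part 0) (part 1)
  /-- the superbracket -/
  bracket : L →ₗ[k] L →ₗ[k] L
  bracket_mem : ∀ {i j : ZMod 2} {x y : L}, x ∈ part i → y ∈ part j → bracket x y ∈ part (i + j)
  skew : ∀ {i j : ZMod 2} {x y : L}, x ∈ part i → y ∈ part j →
    bracket x y = -(koszulSign k i j • bracket y x)
  jacobi : ∀ {i j l : ZMod 2} {x y z : L}, x ∈ part i → y ∈ part j → z ∈ part l →
    bracket x (bracket y z) = bracket (bracket x y) z + koszulSign k i j • bracket y (bracket x z)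

/-- A Lie subsuperalgebra: a graded subspace closed under the bracket. -/
structure LieSubsuperalgebra (k L : Type*) [Field k] [AddCommGroup L] [Module k L]
    [LieSuperalgebra k L] extends Submodule k L where
  graded : ∀ x ∈ carrier, ∃ y ∈ carrier, ∃ z ∈ carrier, y ∈ LieSuperalgebra.part (k := k) (L := L) 0 ∧
    z ∈ LieSuperalgebra.part (k := k) (L := L) 1 ∧ x = y + z
  bracket_mem : ∀ {x y : L}, x ∈ carrier → y ∈ carrier → LieSuperalgebra.bracket (k := k) x y ∈ carrier

namespace LieSuperalgebra

section

variable {k L : Type*} [Field k] [AddCommGroup L] [Module k L] [LieSuperalgebra k L]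

instance (s : LieSubsuperalgebra k L) : AddCommGroup s.toSubmodule :=
  Submodule.addCommGroup s.toSubmodule

instance (s : LieSubsuperalgebra k L) : Module k s.toSubmodule := s.toSubmodule.module

instance (i : ZMod 2) : AddCommGroup (part (k := k) (L := L) i) := Submodule.addCommGroup _

instance (i : ZMod 2) : Module k (part (k := k) (L := L) i) := Submodule.module _

instance (s : LieSubsuperalgebra k L) : LieSuperalgebra k s.toSubmodule where
  part i := (part (k := k) i).comap s.toSubmodule.subtype
  isCompl := by
    have h := isCompl (k := k) (L := L)
    refine ⟨?_, ?_⟩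
    · rw [Submodule.disjoint_def]
      rintro x hx hy
      exact Subtype.ext ((Submodule.disjoint_def.1 h.disjoint) _ hx hy)
    · rw [codisjoint_iff, eq_top_iff]
      rintro ⟨x, hx⟩ -
      obtain ⟨y, hy, z, hz, hy0, hz1, rfl⟩ := s.graded x hx
      exact Submodule.mem_sup.2 ⟨⟨y, hy⟩, hy0, ⟨z, hz⟩, hz1, rfl⟩
  bracket := LinearMap.mk₂ k (fun x y => ⟨bracket (k := k) (x : L) (y : L),
      s.bracket_mem x.2 y.2⟩) (fun _ _ _ => Subtype.ext (by simp)) (fun _ _ _ => Subtype.ext (by simp))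
      (fun _ _ _ => Subtype.ext (by simp)) (fun _ _ _ => Subtype.ext (by simp))
  bracket_mem hx hy := bracket_mem (k := k) (L := L) hx hy
  skew hx hy := Subtype.ext (by simpa using skew (k := k) (L := L) hx hy)
  jacobi hx hy hz := Subtype.ext (by simpa using jacobi (k := k) (L := L) hx hy hz)

variable (k L) in
/-- The even part of a Lie superalgebra, as a Lie subsuperalgebra. -/
def even : LieSubsuperalgebra k L where
  toSubmodule := part (k := k) 0
  graded x hx := ⟨x, hx, 0, Submodule.zero_mem _, hx, Submodule.zero_mem _, (add_zero x).symm⟩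
  bracket_mem hx hy := by simpa using bracket_mem (k := k) (L := L) hx hy

end

/-- A homomorphism of Lie superalgebras. -/
structure Hom (k L M : Type*) [Field k] [AddCommGroup L] [Module k L] [LieSuperalgebra k L]
    [AddCommGroup M] [Module k M] [LieSuperalgebra k M] extends L →ₗ[k] M where
  map_part : ∀ (i : ZMod 2) (x : L), x ∈ part (k := k) i → toFun x ∈ part (k := k) i
  map_bracket : ∀ x y : L, toFun (bracket (k := k) x y) = bracket (k := k) (toFun x) (toFun y)

variable {k L M : Type*} [Field k] [AddCommGroup L] [Module k L] [LieSuperalgebra k L]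
    [AddCommGroup M] [Module k M] [LieSuperalgebra k M]

/-- The inclusion of a Lie subsuperalgebra. -/
def Hom.incl (s : LieSubsuperalgebra k L) : Hom k s.toSubmodule L where
  toLinearMap := s.toSubmodule.subtype
  map_part _ _ hx := hx
  map_bracket _ _ := rfl

/-- The restriction of an endomorphism to a stable Lie subsuperalgebra. -/
def Hom.restrict (f : Hom k L L) (s : LieSubsuperalgebra k L)
    (hs : ∀ x ∈ s.toSubmodule, f.toLinearMap x ∈ s.toSubmodule) :
    Hom k s.toSubmodule s.toSubmodule where
  toLinearMap := f.toLinearMap.restrict hs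
  map_part i x hx := f.map_part i x hx
  map_bracket x y := Subtype.ext (f.map_bracket x y)

variable (k L) in
/-- The defining relations `x y = (-1)^{|x||y|} y x + [x, y]` of the enveloping algebra. -/
inductive Rel : TensorAlgebra k L → TensorAlgebra k L → Prop
  | mk {i j : ZMod 2} {x y : L} : x ∈ part (k := k) i → y ∈ part (k := k) j →
      Rel (TensorAlgebra.ι k x * TensorAlgebra.ι k y)
        (koszulSign k i j • (TensorAlgebra.ι k y * TensorAlgebra.ι k x) +
          TensorAlgebra.ι k (bracket (k := k) x y))

variable (k L) in
/-- The universal enveloping algebra of a Lie superalgebra. -/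
def U : Type _ := RingQuot (Rel k L)

instance : Ring (U k L) := inferInstanceAs (Ring (RingQuot (Rel k L)))

instance : Algebra k (U k L) := inferInstanceAs (Algebra k (RingQuot (Rel k L)))

variable (k L) in
/-- The projection of the tensor algebra to the enveloping algebra. -/
def U.proj : TensorAlgebra k L →ₐ[k] U k L := RingQuot.mkAlgHom k (Rel k L)

variable (k) in
/-- The canonical map of a Lie superalgebra to its enveloping algebra. -/
def ι : L →ₗ[k] U k L :=
  (U.proj k L).toLinearMap ∘ₗ TensorAlgebra.ι k

theorem ι_mul_ι {i j : ZMod 2} {x y : L} (hx : x ∈ part (k := k) i) (hy : y ∈ part (k := k) j) :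
    ι k x * ι k y = koszulSign k i j • (ι k y * ι k x) + ι k (bracket (k := k) x y) := by
  have : U.proj k L _ = U.proj k L _ := RingQuot.mkAlgHom_rel k (Rel.mk hx hy)
  simpa [ι] using this

/-- The homomorphism of enveloping algebras induced by a homomorphism of Lie superalgebras. -/
def U.map (f : Hom k L M) : U k L →ₐ[k] U k M :=
  RingQuot.liftAlgHom k ⟨TensorAlgebra.lift k (ι k ∘ₗ f.toLinearMap), by
    rintro _ _ ⟨hx, hy⟩
    have := ι_mul_ι (f.map_part _ _ hx) (f.map_part _ _ hy)
    simp only [map_mul, map_add, map_smul, TensorAlgebra.lift_ι_apply, LinearMap.comp_apply]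
    rw [show f.toLinearMap (bracket (k := k) _ _) = _ from f.map_bracket _ _]
    exact this⟩

@[simp]
theorem U.map_ι (f : Hom k L M) (x : L) : U.map f (ι k x) = ι k (f.toLinearMap x) := by
  have : U.map f (U.proj k L (TensorAlgebra.ι k x)) =
      TensorAlgebra.lift k (ι k ∘ₗ f.toLinearMap) (TensorAlgebra.ι k x) :=
    RingQuot.liftAlgHom_mkAlgHom_apply k _ _ _
  rw [TensorAlgebra.lift_ι_apply] at this
  exact this

/-- The left ideal `U(L) s` for a subspace `s` of `L`. -/
def leftIdeal (s : Submodule k L) : Submodule (U k L) (U k L) :=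
  Submodule.span (U k L) (ι k '' (s : Set L))

/-- `U(L) / U(L) s` for a subspace `s` of `L`, a left `U(L)`-module. -/
def UQuot (s : Submodule k L) : Type _ := U k L ⧸ leftIdeal s

section UQuot

variable (s : Submodule k L)

instance : AddCommGroup (UQuot s) := inferInstanceAs (AddCommGroup (U k L ⧸ leftIdeal s))

instance : Module (U k L) (UQuot s) := inferInstanceAs (Module (U k L) (U k L ⧸ leftIdeal s))

instance : Module k (UQuot s) := inferInstanceAs (Module k (U k L ⧸ leftIdeal s))

instance : IsScalarTower k (U k L) (UQuot s) :=
  inferInstanceAs (IsScalarTower k (U k L) (U k L ⧸ leftIdeal s))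

/-- The class of an element of `U(L)` in `U(L) / U(L) s` -/
def UQuot.mk : U k L →ₗ[U k L] UQuot s := (leftIdeal s).mkQ

/-- The map of `U(L) / U(L) s` induced by an endomorphism of `L` that preserves `s`. -/
def UQuot.map (f : Hom k L L) (hs : ∀ x ∈ s, f.toLinearMap x ∈ s) :
    UQuot s →ₛₗ[(U.map f).toRingHom] UQuot s :=
  Submodule.mapQ (leftIdeal s) (leftIdeal s)
    ({ toFun := U.map f, map_add' := map_add _, map_smul' := fun a b => map_mul (U.map f) a b } :
      U k L →ₛₗ[(U.map f).toRingHom] U k L) (by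
    unfold leftIdeal
    rw [Submodule.span_le]
    rintro _ ⟨x, hx, rfl⟩
    refine Submodule.subset_span ⟨f.toLinearMap x, hs x hx, ?_⟩
    exact (U.map_ι f x).symm)

/-- Left multiplication by the elements of `L` on `U(L) / U(L) s`. -/
def UQuot.act : L →ₗ[k] Module.End k (UQuot s) :=
  (Algebra.lsmul k k (UQuot s)).toLinearMap ∘ₗ ι k

end UQuot

section Ind

variable {V : Type*} [AddCommGroup V] [Module k V]
  (ρ : part (k := k) (L := L) 0 →ₗ[k] Module.End k V)

/-- The relations `u x ⊗ v = u ⊗ x v`, for `x` in the even part `L₀` of `L`. -/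
def indRel : Submodule (U k L) (U k L ⊗[k] V) :=
  Submodule.span (U k L) {t : U k L ⊗[k] V | ∃ (x : part (k := k) (L := L) 0) (v : V),
    t = ι k (x : L) ⊗ₜ v - 1 ⊗ₜ ρ x v}

/-- The induced module `Ind_{L₀}^{L} V = U(L) ⊗_{U(L₀)} V`, for an action `ρ` of the even part `L₀`
on `V`: the quotient of `U(L) ⊗ V` by the relations `u x ⊗ v = u ⊗ x v` for `x ∈ L₀`. It is a left
`U(L)`-module. -/
def Ind : Type _ := (U k L ⊗[k] V) ⧸ indRel ρ

instance : AddCommGroup (Ind ρ) := inferInstanceAs (AddCommGroup ((U k L ⊗[k] V) ⧸ indRel ρ))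

instance : Module (U k L) (Ind ρ) := inferInstanceAs (Module (U k L) ((U k L ⊗[k] V) ⧸ indRel ρ))

instance : Module k (Ind ρ) := inferInstanceAs (Module k ((U k L ⊗[k] V) ⧸ indRel ρ))

instance : IsScalarTower k (U k L) (Ind ρ) :=
  inferInstanceAs (IsScalarTower k (U k L) ((U k L ⊗[k] V) ⧸ indRel ρ))

/-- The class of `u ⊗ v` in the induced module. -/
def Ind.mk (u : U k L) (v : V) : Ind ρ := (indRel ρ).mkQ (u ⊗ₜ v)

/-- The action of `L` on the induced module. -/
def Ind.act : L →ₗ[k] Module.End k (Ind ρ) := (Algebra.lsmul k k (Ind ρ)).toLinearMap ∘ₗ ι k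

end Ind

end LieSuperalgebra

namespace Supergroup

variable {k : Type*} [Field k] (G : Supergroup k)


/-! ### Slices and translations -/

section slices

variable {G}

/-- `f ↦ ∑ φ(f₁) f₂` -/
def lslice (φ : Module.Dual k G.Fun) : G.Fun →ₗ[k] G.Fun :=
  (TensorProduct.lid k G.Fun).toLinearMap ∘ₗ TensorProduct.map φ LinearMap.id ∘ₗ comul

/-- `f ↦ ∑ f₁ φ(f₂)` -/
def rslice (φ : Module.Dual k G.Fun) : G.Fun →ₗ[k] G.Fun :=
  (TensorProduct.rid k G.Fun).toLinearMap ∘ₗ TensorProduct.map LinearMap.id φ ∘ₗ comul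

variable (G) in
/-- The sign `a ⊗ b ↦ (-1)^{|a||b|} a ⊗ b`. -/
def koszul : G.Fun ⊗[k] G.Fun →ₗ[k] G.Fun ⊗[k] G.Fun :=
  LinearMap.id - (2 : k) • TensorProduct.map G.oddProj G.oddProj

/-- `f ↦ ∑ (-1)^{|f₁||f₂|} φ(f₁) f₂` -/
def transl (φ : Module.Dual k G.Fun) : G.Fun →ₗ[k] G.Fun :=
  (TensorProduct.lid k G.Fun).toLinearMap ∘ₗ TensorProduct.map φ LinearMap.id ∘ₗ G.koszul ∘ₗ comul

theorem lslice_repr (φ : Module.Dual k G.Fun) (f : G.Fun) :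
    lslice φ f = ∑ i ∈ (ℛ k f).index, φ ((ℛ k f).left i) • (ℛ k f).right i := by
  simp only [lslice, LinearMap.comp_apply, ← (ℛ k f).eq, map_sum]
  simp

theorem rslice_repr (φ : Module.Dual k G.Fun) (f : G.Fun) :
    rslice φ f = ∑ i ∈ (ℛ k f).index, φ ((ℛ k f).right i) • (ℛ k f).left i := by
  simp only [rslice, LinearMap.comp_apply, ← (ℛ k f).eq, map_sum]
  simp

theorem transl_eq (φ : Module.Dual k G.Fun) (f : G.Fun) :
    transl φ f = lslice φ f - (2 : k) • G.oddProj (lslice (φ ∘ₗ G.oddProj) f) := by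
  have h1 : lslice φ f = (TensorProduct.lid k G.Fun) (TensorProduct.map φ LinearMap.id (comul f)) :=
    rfl
  have h2 : G.oddProj (lslice (φ ∘ₗ G.oddProj) f) = (TensorProduct.lid k G.Fun)
      (TensorProduct.map φ LinearMap.id (TensorProduct.map G.oddProj G.oddProj (comul f))) := by
    simp only [lslice, LinearMap.comp_apply, ← (ℛ k f).eq, map_sum]
    simp
  rw [h1, h2]
  simp [transl, koszul]

theorem transl_add (φ ψ : Module.Dual k G.Fun) : transl (φ + ψ) = transl φ + transl ψ := by
  ext f
  simp [transl, TensorProduct.map_add_left]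

theorem transl_smul (c : k) (φ : Module.Dual k G.Fun) : transl (c • φ) = c • transl φ := by
  ext f
  simp [transl, TensorProduct.map_smul_left]

theorem comul_mul_repr (a b : G.Fun) : comul (R := k) (a * b) =
    ∑ i ∈ (ℛ k a).index, ∑ j ∈ (ℛ k b).index,
      (((ℛ k a).left i * (ℛ k b).left j) ⊗ₜ ((ℛ k a).right i * (ℛ k b).right j) - (2 : k) •
      (((ℛ k a).left i * G.oddProj ((ℛ k b).left j)) ⊗ₜ
        (G.oddProj ((ℛ k a).right i) * (ℛ k b).right j))) := by
  have h := congrArg (GradedTensorProduct.of k G.gr G.gr).symm (G.comul_mul a b)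
  rw [GradedTensorProduct.of_symm_of] at h
  rw [h]
  conv_lhs => rw [← (ℛ k a).eq, ← (ℛ k b).eq]
  simp only [map_sum, Finset.sum_mul, Finset.mul_sum, graded_tmul_mul]
  rw [Finset.sum_comm]

theorem lslice_mul (φ : Module.Dual k G.Fun) (a b : G.Fun) :
    lslice φ (a * b) = ∑ i ∈ (ℛ k a).index, ∑ j ∈ (ℛ k b).index,
      (φ ((ℛ k a).left i * (ℛ k b).left j) • ((ℛ k a).right i * (ℛ k b).right j) -
        (2 : k) • φ ((ℛ k a).left i * G.oddProj ((ℛ k b).left j)) •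
        (G.oddProj ((ℛ k a).right i) * (ℛ k b).right j)) := by
  simp only [lslice, LinearMap.comp_apply, comul_mul_repr, map_sum]
  simp

theorem rslice_mul (φ : Module.Dual k G.Fun) (a b : G.Fun) :
    rslice φ (a * b) = ∑ i ∈ (ℛ k a).index, ∑ j ∈ (ℛ k b).index,
      (φ ((ℛ k a).right i * (ℛ k b).right j) • ((ℛ k a).left i * (ℛ k b).left j) -
        (2 : k) • φ (G.oddProj ((ℛ k a).right i) * (ℛ k b).right j) •
        ((ℛ k a).left i * G.oddProj ((ℛ k b).left j))) := by
  simp only [rslice, LinearMap.comp_apply, comul_mul_repr, map_sum]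
  simp

theorem lslice_counit (f : G.Fun) : lslice (counit (R := k)) f = f := by
  rw [lslice_repr]
  exact Coalgebra.sum_counit_smul (ℛ k f)

theorem counit_lslice (φ : Module.Dual k G.Fun) (f : G.Fun) :
    counit (R := k) (lslice φ f) = φ f := by
  have h : (∑ i ∈ (ℛ k f).index, counit (R := k) ((ℛ k f).right i) • (ℛ k f).left i) = f := by
    have := congrArg (TensorProduct.rid k G.Fun) (Coalgebra.sum_tmul_counit_eq (ℛ k f))
    simpa only [map_sum, TensorProduct.rid_tmul, one_smul] using this
  conv_rhs => rw [← h]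
  rw [lslice_repr]
  simp [mul_comm]

theorem rslice_counit (f : G.Fun) : rslice (counit (R := k)) f = f := by
  rw [rslice_repr]
  have := congrArg (TensorProduct.rid k G.Fun) (Coalgebra.sum_tmul_counit_eq (ℛ k f))
  simpa only [map_sum, TensorProduct.rid_tmul, one_smul] using this

end slices

/-- The counit, i.e. evaluation at the identity, as a homomorphism of algebras. -/
def counitHom : G.Fun →ₐ[k] k :=
  AlgHom.ofLinearMap counit G.counit_one G.counit_mul

theorem counit_odd [CharZero k] {a : G.Fun} (ha : a ∈ G.gr 1) : counit (R := k) a = 0 := by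
  have h := G.counit_parity a
  have h2 : superParity G.gr a = -a := G.parity_of_odd ha
  rw [h2, map_neg] at h
  exact self_eq_neg.1 h.symm

theorem point_odd [CharZero k] (h : G.Fun →ₐ[k] k) {a : G.Fun} (ha : a ∈ G.gr 1) : h a = 0 := by
  have h1 := G.supercomm ha ha
  simp only [koszulSign, and_self, if_true, neg_smul, one_smul] at h1
  have h2 := congrArg h h1
  rw [map_neg, map_mul] at h2
  exact mul_self_eq_zero.1 (self_eq_neg.1 h2)

theorem point_comp_oddProj [CharZero k] (h : G.Fun →ₐ[k] k) :
    h.toLinearMap ∘ₗ G.oddProj = 0 := by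
  ext a; exact G.point_odd h (G.oddProj_mem a)

theorem lslice_zero : lslice (0 : Module.Dual k G.Fun) = 0 := by
  ext f; simp [lslice]

theorem transl_point [CharZero k] (h : G.Fun →ₐ[k] k) (f : G.Fun) :
    transl h.toLinearMap f = lslice h.toLinearMap f := by
  rw [transl_eq, point_comp_oddProj, lslice_zero]; simp

theorem lslice_point_mul [CharZero k] (h : G.Fun →ₐ[k] k) (a b : G.Fun) :
    lslice h.toLinearMap (a * b) = lslice h.toLinearMap a * lslice h.toLinearMap b := by
  rw [lslice_mul, lslice_repr h.toLinearMap a, lslice_repr h.toLinearMap b, Finset.sum_mul]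
  refine Finset.sum_congr rfl fun i _ => ?_
  rw [Finset.mul_sum]
  refine Finset.sum_congr rfl fun j _ => ?_
  simp [G.point_odd h (G.oddProj_mem _), smul_smul, mul_comm]

theorem rslice_point_mul [CharZero k] (h : G.Fun →ₐ[k] k) (a b : G.Fun) :
    rslice h.toLinearMap (a * b) = rslice h.toLinearMap a * rslice h.toLinearMap b := by
  rw [rslice_mul, rslice_repr h.toLinearMap a, rslice_repr h.toLinearMap b, Finset.sum_mul]
  refine Finset.sum_congr rfl fun i _ => ?_
  rw [Finset.mul_sum]
  refine Finset.sum_congr rfl fun j _ => ?_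
  simp [G.point_odd h (G.oddProj_mem _), smul_smul, mul_comm]

/-! ### The Lie superalgebra -/

variable [CharZero k]

theorem oddProj_mul (a b : G.Fun) :
    G.oddProj (a * b) = (a - G.oddProj a) * G.oddProj b + G.oddProj a * (b - G.oddProj b) := by
  have h00 := SetLike.mul_mem_graded (G.sub_oddProj_mem a) (G.sub_oddProj_mem b)
  have h01 := SetLike.mul_mem_graded (G.sub_oddProj_mem a) (G.oddProj_mem b)
  have h10 := SetLike.mul_mem_graded (G.oddProj_mem a) (G.sub_oddProj_mem b)
  have h11 := SetLike.mul_mem_graded (G.oddProj_mem a) (G.oddProj_mem b)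
  have e : a * b = (a - G.oddProj a) * (b - G.oddProj b) + (a - G.oddProj a) * G.oddProj b +
    G.oddProj a * (b - G.oddProj b) + G.oddProj a * G.oddProj b := by noncomm_ring
  have h2 : (1 + 1 : ZMod 2) = 0 := by decide
  rw [zero_add] at h00 h01
  rw [add_zero] at h10
  rw [h2] at h11
  rw [e, map_add, map_add, map_add, G.oddProj_of_even h00, G.oddProj_of_odd h01,
    G.oddProj_of_odd h10, G.oddProj_of_even h11, zero_add, add_zero]

theorem counit_oddProj (a : G.Fun) : counit (R := k) (G.oddProj a) = 0 :=
  G.counit_odd (G.oddProj_mem a)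

theorem oddProj_oddProj (a : G.Fun) : G.oddProj (G.oddProj a) = G.oddProj a :=
  G.oddProj_of_odd (G.oddProj_mem a)

theorem counit_mul' (a b : G.Fun) :
    counit (R := k) (a * b) = counit (R := k) a * counit (R := k) b := G.counit_mul a b

/-- The tangent space of `G` at the identity. The super Leibniz rule
`δ(fg) = δ(f) ε(g) + (-1)^{|δ||f|} ε(f) δ(g)` needs no sign since `ε` vanishes on odd functions. -/
def lie : Submodule k (Module.Dual k G.Fun) where
  carrier := {x | ∀ f g : G.Fun, x (f * g) = x f * counit (R := k) g + counit (R := k) f * x g}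
  add_mem' hx hy f g := by
    simp only [LinearMap.add_apply, hx f g, hy f g]; ring
  zero_mem' f g := by simp
  smul_mem' c x hx f g := by
    simp only [LinearMap.smul_apply, hx f g, smul_eq_mul]; ring

instance : AddCommGroup G.lie := Submodule.addCommGroup G.lie

instance : Module k G.lie := G.lie.module

variable {G}

theorem comp_oddProj_mem_lie {x : Module.Dual k G.Fun} (hx : x ∈ G.lie) :
    x ∘ₗ G.oddProj ∈ G.lie := by
  intro f g
  simp only [LinearMap.comp_apply, oddProj_mul, map_add, hx _ _, map_sub, counit_oddProj]
  ring

theorem lslice_lie {x : Module.Dual k G.Fun} (hx : x ∈ G.lie) (a b : G.Fun) :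
    lslice x (a * b) = lslice x a * b + a * lslice x b -
      (2 : k) • (G.oddProj a * lslice (x ∘ₗ G.oddProj) b) := by
  have e1 : lslice x (a * b) = ∑ i ∈ (ℛ k a).index, ∑ j ∈ (ℛ k b).index,
      ((x ((ℛ k a).left i) • (ℛ k a).right i) *
          (counit (R := k) ((ℛ k b).left j) • (ℛ k b).right j) +
        (counit (R := k) ((ℛ k a).left i) • (ℛ k a).right i) *
          (x ((ℛ k b).left j) • (ℛ k b).right j) -
        (2 : k) • (G.oddProj (counit (R := k) ((ℛ k a).left i) • (ℛ k a).right i) *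
          ((x ∘ₗ G.oddProj) ((ℛ k b).left j) • (ℛ k b).right j))) := by
    rw [lslice_mul]
    refine Finset.sum_congr rfl fun i _ => Finset.sum_congr rfl fun j _ => ?_
    rw [hx, hx, counit_oddProj, LinearMap.comp_apply, map_smul]
    simp only [smul_mul_smul_comm, add_smul, mul_zero, zero_add]
  rw [e1]
  simp only [Finset.sum_sub_distrib, Finset.sum_add_distrib, ← Finset.mul_sum, ← Finset.sum_mul,
    ← Finset.smul_sum, ← map_sum]
  rw [← lslice_repr, ← lslice_repr, ← lslice_repr, ← lslice_repr, ← lslice_repr, lslice_counit,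
    lslice_counit]

/-- The product of functionals (convolution, with the Koszul sign)
`(φ ψ)(f) = ∑ (-1)^{|f₁||f₂|} φ(f₁) ψ(f₂)`. -/
def mulDual (φ ψ : Module.Dual k G.Fun) : Module.Dual k G.Fun := ψ ∘ₗ transl φ

/-- The supercommutator `φ ψ - (-1)^{|φ||ψ|} ψ φ`, where the sign is `1 - 2 [φ, ψ both odd]`. -/
def bracketDual (φ ψ : Module.Dual k G.Fun) : Module.Dual k G.Fun :=
  mulDual φ ψ - (mulDual ψ φ - (2 : k) • mulDual (ψ ∘ₗ G.oddProj) (φ ∘ₗ G.oddProj))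

theorem mulDual_apply (φ ψ : Module.Dual k G.Fun) (f : G.Fun) :
    mulDual φ ψ f = ψ (lslice φ f) - 2 * ψ (G.oddProj (lslice (φ ∘ₗ G.oddProj) f)) := by
  simp [mulDual, transl_eq]

theorem comp_oddProj_oddProj (φ : Module.Dual k G.Fun) :
    (φ ∘ₗ G.oddProj) ∘ₗ G.oddProj = φ ∘ₗ G.oddProj := by
  ext f; simp [oddProj_oddProj]

open WithConv in
theorem lslice_conv (φ ψ : Module.Dual k G.Fun) (f : G.Fun) :
    ψ (lslice φ f) = (toConv φ * toConv ψ).ofConv f := by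
  rw [lslice_repr]
  have := (ℛ k f).convMul_apply (toConv φ) (toConv ψ)
  simp only [map_sum, map_smul, smul_eq_mul]
  exact this.symm

open WithConv in
theorem mulDual_conv (φ ψ : Module.Dual k G.Fun) : toConv (mulDual φ ψ) =
    toConv φ * toConv ψ - (2 : k) • (toConv (φ ∘ₗ G.oddProj) * toConv (ψ ∘ₗ G.oddProj)) := by
  apply ofConv_injective
  ext f
  rw [show (toConv (mulDual φ ψ)).ofConv f = mulDual φ ψ f from rfl, mulDual_apply]
  rw [lslice_conv, show ψ (G.oddProj (lslice (φ ∘ₗ G.oddProj) f)) =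
    (ψ ∘ₗ G.oddProj) (lslice (φ ∘ₗ G.oddProj) f) from rfl, lslice_conv]
  simp

open WithConv in
theorem bracketDual_conv (φ ψ : Module.Dual k G.Fun) : toConv (bracketDual φ ψ) =
    toConv φ * toConv ψ - toConv ψ * toConv φ -
      (2 : k) • (toConv (φ ∘ₗ G.oddProj) * toConv (ψ ∘ₗ G.oddProj)) := by
  have : toConv (bracketDual φ ψ) = toConv (mulDual φ ψ) - (toConv (mulDual ψ φ) -
    (2 : k) • toConv (mulDual (ψ ∘ₗ G.oddProj) (φ ∘ₗ G.oddProj))) := rfl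
  rw [this, mulDual_conv, mulDual_conv, mulDual_conv, comp_oddProj_oddProj, comp_oddProj_oddProj]
  simp only [two_smul]
  abel

theorem bracketDual_apply (φ ψ : Module.Dual k G.Fun) (f : G.Fun) : bracketDual φ ψ f =
    ψ (lslice φ f) - φ (lslice ψ f) - 2 * (ψ ∘ₗ G.oddProj) (lslice (φ ∘ₗ G.oddProj) f) := by
  rw [lslice_conv, lslice_conv, lslice_conv]
  have := congrArg (fun t => (WithConv.ofConv t) f) (bracketDual_conv φ ψ)
  simpa using this

theorem bracketDual_mem_lie {x y : Module.Dual k G.Fun} (hx : x ∈ G.lie) (hy : y ∈ G.lie) :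
    bracketDual x y ∈ G.lie := by
  have key : ∀ {x y : Module.Dual k G.Fun}, x ∈ G.lie → y ∈ G.lie → ∀ a b : G.Fun,
      y (lslice x (a * b)) = y (lslice x a) * counit (R := k) b + x a * y b + y a * x b +
        counit (R := k) a * y (lslice x b) - 2 * (y (G.oddProj a) * x (G.oddProj b)) := by
    intro x y hx hy a b
    rw [lslice_lie hx]
    simp only [map_sub, map_add, map_smul, hy _ _, counit_lslice, counit_oddProj, smul_eq_mul,
      LinearMap.comp_apply]
    ring
  intro a b
  simp only [bracketDual_apply]
  rw [key hx hy, key hy hx, key (comp_oddProj_mem_lie hx) (comp_oddProj_mem_lie hy)]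
  simp only [LinearMap.comp_apply, oddProj_oddProj]
  ring

variable (G) in
/-- Functionals of parity `i`: those that vanish on the functions of the other parity. -/
def liePart (i : ZMod 2) : Submodule k G.lie where
  carrier := {x | ∀ f ∈ G.gr (i + 1), (x : Module.Dual k G.Fun) f = 0}
  add_mem' hx hy f hf := by simp [hx f hf, hy f hf]
  zero_mem' f _ := by simp
  smul_mem' c x hx f hf := by simp [hx f hf]

theorem mem_liePart_zero {x : G.lie} :
    x ∈ G.liePart 0 ↔ (x : Module.Dual k G.Fun) ∘ₗ G.oddProj = 0 := by
  constructor
  · intro h; ext f; exact h _ (by simpa using G.oddProj_mem f)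
  · intro h f hf
    have := LinearMap.congr_fun h f
    rwa [LinearMap.comp_apply, G.oddProj_of_odd (by simpa using hf)] at this

theorem mem_liePart_one {x : G.lie} :
    x ∈ G.liePart 1 ↔ (x : Module.Dual k G.Fun) ∘ₗ G.oddProj = x := by
  constructor
  · intro h; ext f
    have h2 := h (f - G.oddProj f) (by
      have : (1 + 1 : ZMod 2) = 0 := by decide
      rw [this]; exact G.sub_oddProj_mem f)
    rw [map_sub, sub_eq_zero] at h2
    exact h2.symm
  · intro h f hf
    have h2 : (1 + 1 : ZMod 2) = 0 := by decide
    rw [h2] at hf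
    rw [← h, LinearMap.comp_apply, G.oddProj_of_even hf, map_zero]

open WithConv in
theorem bracket_conv_homogeneous {i j : ZMod 2} {x y : G.lie} (hx : x ∈ G.liePart i)
    (hy : y ∈ G.liePart j) : toConv (bracketDual (x : Module.Dual k G.Fun) y) =
      koszulSign k i j • (toConv (x : Module.Dual k G.Fun) * toConv (y : Module.Dual k G.Fun)) -
        toConv (y : Module.Dual k G.Fun) * toConv (x : Module.Dual k G.Fun) := by
  rw [bracketDual_conv]
  have h0 : (toConv (0 : Module.Dual k G.Fun)) = 0 := rfl
  rcases zmod2_cases i with rfl | rfl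
  · simp [mem_liePart_zero.1 hx, h0]
  · rcases zmod2_cases j with rfl | rfl
    · simp [mem_liePart_zero.1 hy, h0]
    · rw [mem_liePart_one.1 hx, mem_liePart_one.1 hy, koszulSign_one_one, two_smul, neg_smul,
        one_smul]
      abel

open WithConv in
theorem conv_comp_parity (φ ψ : Module.Dual k G.Fun) :
    (toConv φ * toConv ψ).ofConv ∘ₗ G.parity =
      (toConv (φ ∘ₗ G.parity) * toConv (ψ ∘ₗ G.parity)).ofConv := by
  ext f
  have h := G.comul_parity f
  simp only [LinearMap.convMul_def, LinearMap.comp_apply]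
  rw [show comul (G.parity f) = _ from h, ← LinearMap.comp_apply (TensorProduct.map _ _),
    ← TensorProduct.map_comp]
  rfl

theorem mem_liePart_iff {i : ZMod 2} {x : G.lie} : x ∈ G.liePart i ↔
    (x : Module.Dual k G.Fun) ∘ₗ G.parity = (if i = 1 then (-1 : k) else 1) • (x : Module.Dual k G.Fun) := by
  have e : (x : Module.Dual k G.Fun) ∘ₗ G.parity =
      (x : Module.Dual k G.Fun) - (2 : k) • ((x : Module.Dual k G.Fun) ∘ₗ G.oddProj) := by
    ext f; simp [parity_apply]
  rw [e]
  rcases zmod2_cases i with rfl | rfl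
  · refine mem_liePart_zero.trans ?_
    simp
  · refine mem_liePart_one.trans ?_
    have hn : (-1 : k) • (x : Module.Dual k G.Fun) = -(x : Module.Dual k G.Fun) := by ext f; simp
    rw [if_pos rfl, hn, two_smul]
    constructor
    · intro h; rw [h]; abel
    · intro h
      have h2 : (2 : k) • ((x : Module.Dual k G.Fun) ∘ₗ G.oddProj) =
          (2 : k) • (x : Module.Dual k G.Fun) := by
        rw [two_smul, two_smul]
        have := sub_eq_iff_eq_add.1 h
        rw [eq_comm, neg_add_eq_iff_eq_add] at this
        exact this
      exact smul_right_injective _ (two_ne_zero) h2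

theorem part_sign (i j : ZMod 2) : (if i + j = 1 then (-1 : k) else 1) =
    (if i = 1 then (-1 : k) else 1) * (if j = 1 then (-1 : k) else 1) := by
  have h2 : (1 + 1 : ZMod 2) = 0 := by decide
  rcases zmod2_cases i with rfl | rfl <;> rcases zmod2_cases j with rfl | rfl <;> simp [h2]

variable (G) in
/-- The bracket on the tangent space at the identity. -/
def lieBracket : G.lie →ₗ[k] G.lie →ₗ[k] G.lie :=
  LinearMap.mk₂ k (fun x y => ⟨bracketDual x y, bracketDual_mem_lie x.2 y.2⟩)
    (fun x x' y => Subtype.ext (WithConv.toConv_injective (by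
      have := bracketDual_conv (x + x' : Module.Dual k G.Fun) y
      simp only [LinearMap.add_comp, WithConv.toConv_add, add_mul, mul_add, smul_add] at this
      simp only [Submodule.coe_add, WithConv.toConv_add, bracketDual_conv, this]
      abel)))
    (fun c x y => Subtype.ext (WithConv.toConv_injective (by
      have := bracketDual_conv (c • x : Module.Dual k G.Fun) y
      simp only [LinearMap.smul_comp, WithConv.toConv_smul, smul_mul_assoc, mul_smul_comm] at this
      simp only [Submodule.coe_smul, WithConv.toConv_smul, bracketDual_conv, this, smul_sub,
        smul_comm c (2 : k)])))
    (fun x y y' => Subtype.ext (WithConv.toConv_injective (by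
      have := bracketDual_conv (x : Module.Dual k G.Fun) (y + y')
      simp only [LinearMap.add_comp, WithConv.toConv_add, add_mul, mul_add, smul_add] at this
      simp only [Submodule.coe_add, WithConv.toConv_add, bracketDual_conv, this]
      abel)))
    (fun c x y => Subtype.ext (WithConv.toConv_injective (by
      have := bracketDual_conv (x : Module.Dual k G.Fun) (c • y)
      simp only [LinearMap.smul_comp, WithConv.toConv_smul, smul_mul_assoc, mul_smul_comm] at this
      simp only [Submodule.coe_smul, WithConv.toConv_smul, bracketDual_conv, this, smul_sub,
        smul_comm c (2 : k)])))

theorem lieBracket_mem {i j : ZMod 2} {x y : G.lie} (hx : x ∈ G.liePart i) (hy : y ∈ G.liePart j) :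
    G.lieBracket x y ∈ G.liePart (i + j) := by
  rw [mem_liePart_iff]
  change bracketDual (x : Module.Dual k G.Fun) y ∘ₗ G.parity = _ • bracketDual (x : Module.Dual k G.Fun) y
  have h := bracket_conv_homogeneous hx hy
  have h2 := congrArg WithConv.ofConv h
  simp only [WithConv.ofConv_sub, WithConv.ofConv_smul] at h2
  rw [show bracketDual (x : Module.Dual k G.Fun) y =
    (WithConv.toConv (bracketDual (x : Module.Dual k G.Fun) y)).ofConv from rfl, h2,
    LinearMap.sub_comp, LinearMap.smul_comp, conv_comp_parity, conv_comp_parity,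
    mem_liePart_iff.1 hx, mem_liePart_iff.1 hy, part_sign]
  simp only [WithConv.toConv_smul, smul_mul_assoc, mul_smul_comm, WithConv.ofConv_smul, smul_sub,
    smul_smul]
  congr 2
  ring

/-- The Lie superalgebra of a supergroup. -/
instance : LieSuperalgebra k G.lie where
  part := G.liePart
  isCompl := by
    refine ⟨?_, ?_⟩
    · rw [Submodule.disjoint_def]
      intro x h0 h1
      exact Subtype.ext ((mem_liePart_one.1 h1).symm.trans (mem_liePart_zero.1 h0))
    · rw [codisjoint_iff, eq_top_iff]
      intro x _
      refine Submodule.mem_sup.2 ⟨x - ⟨_, comp_oddProj_mem_lie x.2⟩, ?_,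
        ⟨_, comp_oddProj_mem_lie x.2⟩, ?_, Subtype.ext (by simp)⟩
      · rw [mem_liePart_zero]
        simp [LinearMap.sub_comp, comp_oddProj_oddProj]
      · rw [mem_liePart_one]
        exact comp_oddProj_oddProj _
  bracket := G.lieBracket
  bracket_mem := lieBracket_mem
  skew {i j x y} hx hy := by
    apply Subtype.ext
    apply WithConv.toConv_injective
    have h1 := bracket_conv_homogeneous hx hy
    have h2 := bracket_conv_homogeneous hy hx
    change WithConv.toConv (bracketDual (x : Module.Dual k G.Fun) y) =
      -(koszulSign k i j • WithConv.toConv (bracketDual (y : Module.Dual k G.Fun) x))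
    rw [h1, h2]
    by_cases h : i = 1 ∧ j = 1
    · simp [koszulSign, h]
      abel
    · have h' : ¬ (j = 1 ∧ i = 1) := fun h' => h h'.symm
      simp [koszulSign, h, h']
  jacobi {i j l x y z} hx hy hz := by
    apply Subtype.ext
    apply WithConv.toConv_injective
    have hyz := lieBracket_mem hy hz
    have hxy := lieBracket_mem hx hy
    have hxz := lieBracket_mem hx hz
    have e1 := bracket_conv_homogeneous hx hyz
    have e2 := bracket_conv_homogeneous hxy hz
    have e3 := bracket_conv_homogeneous hy hxz
    have d1 : WithConv.toConv (G.lieBracket y z : Module.Dual k G.Fun) = _ :=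
      bracket_conv_homogeneous hy hz
    have d2 : WithConv.toConv (G.lieBracket x y : Module.Dual k G.Fun) = _ :=
      bracket_conv_homogeneous hx hy
    have d3 : WithConv.toConv (G.lieBracket x z : Module.Dual k G.Fun) = _ :=
      bracket_conv_homogeneous hx hz
    change WithConv.toConv (bracketDual (x : Module.Dual k G.Fun) (G.lieBracket y z)) =
      WithConv.toConv (bracketDual (G.lieBracket x y : Module.Dual k G.Fun) z) +
      koszulSign k i j • WithConv.toConv (bracketDual (y : Module.Dual k G.Fun) (G.lieBracket x z))
    rw [e1, e2, e3, d1, d2, d3]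
    exact superJacobi_aux k _ _ _ i j l

/-! ### Closed subgroups and homogeneous spaces -/

variable (G) in
/-- A closed subgroup of `G`, given by its ideal: a homogeneous Hopf ideal with reduced even part. -/
structure ClosedSubgroup where
  /-- the functions that vanish on the subgroup -/
  ideal : Ideal G.Fun
  parity_mem : ∀ f ∈ ideal, G.parity f ∈ ideal
  isCoideal : (ideal.restrictScalars k).IsCoideal
  antipode_mem : ∀ f ∈ ideal, G.antipode f ∈ ideal
  reduced : ∀ (f : G.Fun) (n : ℕ), f ^ n ∈ ideal ⊔ Ideal.span (G.gr 1 : Set G.Fun) →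
    f ∈ ideal ⊔ Ideal.span (G.gr 1 : Set G.Fun)

namespace ClosedSubgroup

variable (K : G.ClosedSubgroup)

/-- The restriction map from `k[G]` to `k[K] = k[G] / I(K)`. -/
def res : G.Fun →ₗ[k] G.Fun ⧸ (K.ideal.restrictScalars k) := (K.ideal.restrictScalars k).mkQ

theorem res_eq_zero {f : G.Fun} : K.res f = 0 ↔ f ∈ K.ideal :=
  Submodule.Quotient.mk_eq_zero _

theorem oddProj_mem_ideal {f : G.Fun} (hf : f ∈ K.ideal) : G.oddProj f ∈ K.ideal := by
  have h : G.oddProj f = (2⁻¹ : k) • (f - G.parity f) := by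
    rw [parity_apply, sub_sub_cancel, smul_smul, inv_mul_cancel₀ two_ne_zero, one_smul]
  rw [h]
  exact (K.ideal.restrictScalars k).smul_mem _ (K.ideal.sub_mem hf (K.parity_mem f hf))

theorem mul_mem_ideal {f : G.Fun} (hf : f ∈ K.ideal) (g : G.Fun) : f * g ∈ K.ideal := by
  have h1 := K.oddProj_mem_ideal hf
  have h0 := K.ideal.sub_mem hf h1
  have key : ∀ (i j : ZMod 2) (a b : G.Fun), a ∈ G.gr i → b ∈ G.gr j → a ∈ K.ideal →
      a * b ∈ K.ideal := by
    intro i j a b ha hb haI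
    rw [G.supercomm ha hb]
    exact (K.ideal.restrictScalars k).smul_mem _ (K.ideal.mul_mem_left _ haI)
  have e : f * g = ((f - G.oddProj f) * (g - G.oddProj g) + (f - G.oddProj f) * G.oddProj g) +
      (G.oddProj f * (g - G.oddProj g) + G.oddProj f * G.oddProj g) := by noncomm_ring
  rw [e]
  refine K.ideal.add_mem (K.ideal.add_mem ?_ ?_) (K.ideal.add_mem ?_ ?_)
  · exact key _ _ _ _ (G.sub_oddProj_mem f) (G.sub_oddProj_mem g) h0
  · exact key _ _ _ _ (G.sub_oddProj_mem f) (G.oddProj_mem g) h0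
  · exact key _ _ _ _ (G.oddProj_mem f) (G.sub_oddProj_mem g) h1
  · exact key _ _ _ _ (G.oddProj_mem f) (G.oddProj_mem g) h1

/-- The `k`-points of the subgroup, i.e. of its even part `K₀`. -/
def points : Set (G.Fun →ₐ[k] k) := {h | ∀ f ∈ K.ideal, h f = 0}

/-- The product of `k[G] ⊗ k[G]`. -/
def tmulMul (x y : G.Fun ⊗[k] G.Fun) : G.Fun ⊗[k] G.Fun :=
  (GradedTensorProduct.of k G.gr G.gr).symm
    (GradedTensorProduct.of k G.gr G.gr x * GradedTensorProduct.of k G.gr G.gr y)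

theorem ltensor_res_mul (x y : G.Fun ⊗[k] G.Fun)
    (h : K.res.lTensor G.Fun x = 0 ∨ K.res.lTensor G.Fun y = 0) :
    K.res.lTensor G.Fun (tmulMul x y) = 0 := by
  have hker : ∀ z : G.Fun ⊗[k] G.Fun, K.res.lTensor G.Fun z = 0 →
      ∃ w : G.Fun ⊗[k] (K.ideal.restrictScalars k),
        (K.ideal.restrictScalars k).subtype.lTensor G.Fun w = z := fun z hz =>
    (lTensor_exact G.Fun (LinearMap.exact_subtype_mkQ (K.ideal.restrictScalars k))
      (Submodule.mkQ_surjective _) z).1 hz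
  have hp : ∀ a b c d : G.Fun, tmulMul (a ⊗ₜ[k] b) (c ⊗ₜ d) =
      (a * c) ⊗ₜ (b * d) - (2 : k) • ((a * G.oddProj c) ⊗ₜ (G.oddProj b * d)) := fun a b c d =>
    G.graded_tmul_mul a b c d
  have add_l : ∀ x x' y : G.Fun ⊗[k] G.Fun, tmulMul (x + x') y = tmulMul x y + tmulMul x' y := by
    intro x x' y; simp [tmulMul, add_mul]
  have add_r : ∀ x y y' : G.Fun ⊗[k] G.Fun, tmulMul x (y + y') = tmulMul x y + tmulMul x y' := by
    intro x y y'; simp [tmulMul, mul_add]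
  have zero_l : ∀ y : G.Fun ⊗[k] G.Fun, tmulMul 0 y = 0 := by intro y; simp [tmulMul]
  have zero_r : ∀ y : G.Fun ⊗[k] G.Fun, tmulMul y 0 = 0 := by intro y; simp [tmulMul]
  rcases h with h | h
  · obtain ⟨w, rfl⟩ := hker _ h
    induction w with
    | zero => rw [map_zero, zero_l, map_zero]
    | add w w' hw hw' =>
      have := fun z : G.Fun ⊗[k] (K.ideal.restrictScalars k) => h
      rw [map_add, add_l, map_add]
      rw [hw, hw', add_zero]
      all_goals
        first
        | exact (lTensor_exact G.Fun (LinearMap.exact_subtype_mkQ (K.ideal.restrictScalars k))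
            (Submodule.mkQ_surjective _) _).2 ⟨_, rfl⟩
    | tmul a i =>
      induction y with
      | zero => rw [zero_r, map_zero]
      | add y y' hy hy' => rw [add_r, map_add, hy, hy', add_zero]
      | tmul c d =>
        rw [LinearMap.lTensor_tmul, Submodule.subtype_apply, hp, map_sub, map_smul, LinearMap.lTensor_tmul,
          LinearMap.lTensor_tmul, K.res_eq_zero.2 (K.mul_mem_ideal i.2 d),
          K.res_eq_zero.2 (K.mul_mem_ideal (K.oddProj_mem_ideal i.2) d)]
        simp
  · obtain ⟨w, rfl⟩ := hker _ h
    induction w with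
    | zero => rw [map_zero, zero_r, map_zero]
    | add w w' hw hw' =>
      rw [map_add, add_r, map_add]
      rw [hw, hw', add_zero]
      all_goals
        first
        | exact (lTensor_exact G.Fun (LinearMap.exact_subtype_mkQ (K.ideal.restrictScalars k))
            (Submodule.mkQ_surjective _) _).2 ⟨_, rfl⟩
    | tmul c i =>
      induction x with
      | zero => rw [zero_l, map_zero]
      | add y y' hy hy' => rw [add_l, map_add, hy, hy', add_zero]
      | tmul a b =>
        rw [LinearMap.lTensor_tmul, Submodule.subtype_apply, hp, map_sub, map_smul, LinearMap.lTensor_tmul,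
          LinearMap.lTensor_tmul, K.res_eq_zero.2 (K.ideal.mul_mem_left b i.2),
          K.res_eq_zero.2 (K.ideal.mul_mem_left (G.oddProj b) i.2)]
        simp

/-- `k[G/K]`: the functions on `G` that are invariant under right translation by `K`. -/
def quotFun : Subalgebra k G.Fun where
  carrier := {f | K.res.lTensor G.Fun (comul f) = f ⊗ₜ K.res 1}
  algebraMap_mem' c := by
    simp only [Set.mem_ofPred_eq, Algebra.algebraMap_eq_smul_one, map_smul, G.comul_one,
      LinearMap.lTensor_tmul, TensorProduct.smul_tmul']
  add_mem' {f g} hf hg := by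
    simp only [Set.mem_ofPred_eq] at hf hg ⊢
    rw [map_add, map_add, hf, hg, TensorProduct.add_tmul]
  mul_mem' {f g} hf hg := by
    simp only [Set.mem_ofPred_eq] at hf hg ⊢
    have hf' : K.res.lTensor G.Fun (comul f - f ⊗ₜ 1) = 0 := by
      rw [map_sub, hf, LinearMap.lTensor_tmul, sub_self]
    have hg' : K.res.lTensor G.Fun (comul g - g ⊗ₜ 1) = 0 := by
      rw [map_sub, hg, LinearMap.lTensor_tmul, sub_self]
    have e : comul (R := k) (f * g) = tmulMul (comul f - f ⊗ₜ 1) (comul g) +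
        (tmulMul (f ⊗ₜ 1) (comul g - g ⊗ₜ 1) + tmulMul (f ⊗ₜ 1) (g ⊗ₜ 1)) := by
      have h := congrArg (GradedTensorProduct.of k G.gr G.gr).symm (G.comul_mul f g)
      rw [GradedTensorProduct.of_symm_of] at h
      rw [h]
      simp [tmulMul, mul_sub, sub_mul]
    have e2 : tmulMul (f ⊗ₜ[k] (1 : G.Fun)) (g ⊗ₜ 1) = (f * g) ⊗ₜ 1 := by
      have h1 : G.oddProj 1 = 0 := G.oddProj_of_even (SetLike.one_mem_graded G.gr)
      have := G.graded_tmul_mul f 1 g 1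
      rw [h1] at this
      simpa [tmulMul] using this
    rw [e, map_add, map_add, K.ltensor_res_mul _ _ (Or.inl hf'), K.ltensor_res_mul _ _ (Or.inr hg'),
      e2, zero_add, zero_add, LinearMap.lTensor_tmul]

theorem mem_quotFun {f : G.Fun} :
    f ∈ K.quotFun ↔ K.res.lTensor G.Fun (comul f) = f ⊗ₜ K.res 1 := Iff.rfl

theorem parity_mem_quotFun {f : G.Fun} (hf : f ∈ K.quotFun) : G.parity f ∈ K.quotFun := by
  rw [mem_quotFun] at hf ⊢
  let s : G.Fun ⧸ (K.ideal.restrictScalars k) →ₗ[k] G.Fun ⧸ (K.ideal.restrictScalars k) :=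
    Submodule.mapQ _ _ G.parity (fun f hf => K.parity_mem f hf)
  have hs : K.res ∘ₗ G.parity = s ∘ₗ K.res := rfl
  have h1 : G.parity 1 = 1 := G.parity_of_even (SetLike.one_mem_graded G.gr)
  have h2 : K.res.lTensor G.Fun (TensorProduct.map G.parity G.parity (comul f)) =
      TensorProduct.map G.parity s (K.res.lTensor G.Fun (comul f)) := by
    induction comul (R := k) f with
    | zero => simp
    | add x y hx hy => simp only [map_add, hx, hy]
    | tmul x y => exact congrArg (G.parity x ⊗ₜ[k] ·) (LinearMap.congr_fun hs y)
  rw [show comul (G.parity f) = _ from G.comul_parity f]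
  change K.res.lTensor G.Fun (TensorProduct.map G.parity G.parity (comul f)) = _
  rw [h2, hf, TensorProduct.map_tmul, ← LinearMap.comp_apply, ← hs, LinearMap.comp_apply, h1]

theorem oddProj_mem_quotFun {f : G.Fun} (hf : f ∈ K.quotFun) : G.oddProj f ∈ K.quotFun := by
  have h : G.oddProj f = (2⁻¹ : k) • (f - G.parity f) := by
    rw [parity_apply, sub_sub_cancel, smul_smul, inv_mul_cancel₀ two_ne_zero, one_smul]
  rw [h]
  exact K.quotFun.smul_mem (K.quotFun.sub_mem hf (K.parity_mem_quotFun hf)) _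

theorem lslice_mem_quotFun (φ : Module.Dual k G.Fun) {f : G.Fun} (hf : f ∈ K.quotFun) :
    lslice φ f ∈ K.quotFun := by
  rw [mem_quotFun] at hf ⊢
  have e1 : comul (lslice φ f) = (TensorProduct.lid k (G.Fun ⊗[k] G.Fun))
      (φ.rTensor _ (comul.lTensor G.Fun (comul f))) := by
    rw [lslice_repr, map_sum]
    conv_rhs => rw [← (ℛ k f).eq]
    simp
  have e2 : K.res.lTensor G.Fun ((TensorProduct.lid k (G.Fun ⊗[k] G.Fun))
      (φ.rTensor _ (comul.lTensor G.Fun (comul f)))) =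
      (TensorProduct.lid k _) (φ.rTensor _ ((TensorProduct.assoc k G.Fun G.Fun _)
        (comul.rTensor _ (K.res.lTensor G.Fun (comul f))))) := by
    rw [← Coalgebra.coassoc_apply (R := k) f]
    conv_lhs => rw [← (ℛ k f).eq]
    conv_rhs => rw [← (ℛ k f).eq]
    simp only [map_sum]
    refine Finset.sum_congr rfl fun i _ => ?_
    simp only [LinearMap.rTensor_tmul, LinearMap.lTensor_tmul]
    induction comul (R := k) ((ℛ k f).left i) with
    | zero => simp
    | add x y hx hy => simp only [TensorProduct.add_tmul, map_add, hx, hy]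
    | tmul x y => simp
  rw [e1, e2, hf, LinearMap.rTensor_tmul]
  rw [lslice_repr]
  conv_lhs => rw [← (ℛ k f).eq]
  simp [TensorProduct.sum_tmul, TensorProduct.smul_tmul']

theorem transl_mem_quotFun (φ : Module.Dual k G.Fun) {f : G.Fun} (hf : f ∈ K.quotFun) :
    transl φ f ∈ K.quotFun := by
  rw [transl_eq]
  exact K.quotFun.sub_mem (K.lslice_mem_quotFun _ hf)
    (K.quotFun.smul_mem (K.oddProj_mem_quotFun (K.lslice_mem_quotFun _ hf)) _)

end ClosedSubgroup

namespace ClosedSubgroup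

variable (K : G.ClosedSubgroup)

/-! ### Distributions on `G/K` at the point `eK` -/

/-- The maximal ideal of `k[G/K]` at the point `eK`. -/
def maxIdeal : Ideal K.quotFun := RingHom.ker (G.counitHom.comp K.quotFun.val)

/-- `Dist(G/K, eK)`: the functionals on `k[G/K]` that vanish on a power of the maximal ideal. -/
def Dist : Submodule k (Module.Dual k K.quotFun) where
  carrier := {ψ | ∃ n : ℕ, ∀ f ∈ K.maxIdeal ^ n, ψ f = 0}
  add_mem' := by
    rintro ψ χ ⟨n, hn⟩ ⟨m, hm⟩
    refine ⟨n + m, fun f hf => ?_⟩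
    rw [LinearMap.add_apply, hn f (Ideal.pow_le_pow_right (Nat.le_add_right n m) hf),
      hm f (Ideal.pow_le_pow_right (Nat.le_add_left m n) hf), add_zero]
  zero_mem' := ⟨0, fun _ _ => rfl⟩
  smul_mem' c ψ := by
    rintro ⟨n, hn⟩
    exact ⟨n, fun f hf => by rw [LinearMap.smul_apply, hn f hf, smul_zero]⟩

theorem maxIdeal_pow_zero : K.maxIdeal ^ 0 = ⊤ := by
  rw [Submodule.pow_zero, Ideal.one_eq_top]

theorem maxIdeal_pow_succ (n : ℕ) : K.maxIdeal ^ (n + 1) = K.maxIdeal * K.maxIdeal ^ n := by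
  rcases Nat.eq_zero_or_pos n with rfl | hn
  · rw [Submodule.pow_succ, maxIdeal_pow_zero]
    refine le_antisymm (Ideal.mul_le.2 fun a _ b hb => ?_) (Ideal.mul_le.2 fun a ha b _ => ?_)
    · simpa using Ideal.mul_mem_mul (K.maxIdeal.mul_mem_left a hb)
        (Submodule.mem_top : (1 : K.quotFun) ∈ (⊤ : Ideal K.quotFun))
    · have : a * b ∈ K.maxIdeal := by
        unfold maxIdeal at ha ⊢
        rw [RingHom.mem_ker] at ha ⊢
        rw [map_mul, ha, zero_mul]
      simpa using Ideal.mul_mem_mul (I := ⊤) (J := K.maxIdeal) (trivial : (1 : K.quotFun) ∈ _) this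
  · exact Submodule.pow_succ' _ hn.ne'

theorem pow_mem_of_mul (S : K.quotFun →ₗ[k] K.quotFun) (hS : ∀ a b, S (a * b) = S a * S b)
    (hm : ∀ a ∈ K.maxIdeal, S a ∈ K.maxIdeal) (n : ℕ) :
    ∀ f ∈ K.maxIdeal ^ n, S f ∈ K.maxIdeal ^ n := by
  induction n with
  | zero => intro f _; rw [maxIdeal_pow_zero]; trivial
  | succ n ih =>
    intro f hf
    rw [maxIdeal_pow_succ] at hf ⊢
    refine Submodule.smul_induction_on hf (fun a ha b hb => ?_) (fun a b ha hb => ?_)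
    · rw [smul_eq_mul, hS]
      exact Ideal.mul_mem_mul (hm a ha) (ih b hb)
    · rw [map_add]; exact Ideal.add_mem _ ha hb

theorem pow_mem_of_leibniz (D S : K.quotFun →ₗ[k] K.quotFun)
    (hS : ∀ n, ∀ f ∈ K.maxIdeal ^ n, S f ∈ K.maxIdeal ^ n)
    (hD : ∀ a b, D (a * b) = D a * S b + a * D b) (n : ℕ) :
    ∀ f ∈ K.maxIdeal ^ (n + 1), D f ∈ K.maxIdeal ^ n := by
  induction n with
  | zero => intro f _; rw [maxIdeal_pow_zero]; trivial
  | succ n ih =>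
    intro f hf
    rw [maxIdeal_pow_succ] at hf
    refine Submodule.smul_induction_on hf (fun a ha b hb => ?_) (fun a b ha hb => ?_)
    · rw [smul_eq_mul, hD]
      refine Ideal.add_mem _ (Ideal.mul_mem_left _ _ (hS _ b hb)) ?_
      rw [maxIdeal_pow_succ]
      exact Ideal.mul_mem_mul ha (ih b hb)
    · rw [map_add]; exact Ideal.add_mem _ ha hb

theorem parity_mul (a b : G.Fun) : G.parity (a * b) = G.parity a * G.parity b := by
  simp only [parity_apply, oddProj_mul, two_smul]
  noncomm_ring

/-- The parity operator on `k[G/K]`. -/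
def quotParity : K.quotFun →ₗ[k] K.quotFun :=
  G.parity.restrict (p := K.quotFun.toSubmodule) (q := K.quotFun.toSubmodule)
    (fun _ hf => K.parity_mem_quotFun hf)

/-- `f ↦ ∑ (-1)^{|f₁||f₂|} φ(f₁) f₂` on `k[G/K]` -/
def quotTransl (φ : Module.Dual k G.Fun) : K.quotFun →ₗ[k] K.quotFun :=
  (transl φ).restrict (p := K.quotFun.toSubmodule) (q := K.quotFun.toSubmodule)
    (fun _ hf => K.transl_mem_quotFun φ hf)

theorem coe_quotParity (f : K.quotFun) : (K.quotParity f : G.Fun) = G.parity f := rfl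

theorem coe_quotTransl (φ : Module.Dual k G.Fun) (f : K.quotFun) :
    (K.quotTransl φ f : G.Fun) = transl φ f := rfl

theorem mem_maxIdeal {f : K.quotFun} : f ∈ K.maxIdeal ↔ counit (R := k) (f : G.Fun) = 0 :=
  Iff.rfl

theorem quotParity_pow (n : ℕ) : ∀ f ∈ K.maxIdeal ^ n, K.quotParity f ∈ K.maxIdeal ^ n := by
  refine K.pow_mem_of_mul _ (fun a b => Subtype.ext ?_) (fun a ha => ?_) n
  · simp only [coe_quotParity, MulMemClass.coe_mul, parity_mul]
  · rw [mem_maxIdeal] at ha ⊢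
    rw [coe_quotParity, ← ha]
    exact G.counit_parity a

theorem quotTransl_pow {x : Module.Dual k G.Fun} (hx : x ∈ G.lie) (n : ℕ) :
    ∀ f ∈ K.maxIdeal ^ (n + 1), K.quotTransl x f ∈ K.maxIdeal ^ n := by
  have h1 := comp_oddProj_mem_lie hx
  have h0 := G.lie.sub_mem hx h1
  have e0 : (x - x ∘ₗ G.oddProj) ∘ₗ G.oddProj = 0 := by
    rw [LinearMap.sub_comp, comp_oddProj_oddProj, sub_self]
  have t0 : ∀ f, transl (x - x ∘ₗ G.oddProj) f = lslice (x - x ∘ₗ G.oddProj) f := by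
    intro f; rw [transl_eq, e0, lslice_zero]; simp
  have t1 : ∀ f, transl (x ∘ₗ G.oddProj) f = G.parity (lslice (x ∘ₗ G.oddProj) f) := by
    intro f; rw [transl_eq, comp_oddProj_oddProj, parity_apply]
  intro f hf
  have e : K.quotTransl x f =
      K.quotTransl (x - x ∘ₗ G.oddProj) f + K.quotTransl (x ∘ₗ G.oddProj) f := by
    apply Subtype.ext
    rw [Subalgebra.coe_add, coe_quotTransl, coe_quotTransl, coe_quotTransl, ← LinearMap.add_apply,
      ← transl_add, sub_add_cancel]
  rw [e]
  refine Ideal.add_mem _ ?_ ?_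
  · refine K.pow_mem_of_leibniz _ LinearMap.id (fun _ _ h => h) (fun a b => Subtype.ext ?_) n f hf
    simp only [Subalgebra.coe_add, MulMemClass.coe_mul, coe_quotTransl, t0, LinearMap.id_apply]
    rw [lslice_lie h0, e0, lslice_zero]; simp
  · refine K.pow_mem_of_leibniz _ K.quotParity K.quotParity_pow (fun a b => Subtype.ext ?_) n f hf
    simp only [Subalgebra.coe_add, MulMemClass.coe_mul, coe_quotTransl, t1, coe_quotParity]
    rw [← parity_mul]
    have hpp : G.parity (G.parity (a : G.Fun)) = a := by
      rw [parity_apply, parity_apply, map_sub, map_smul, oddProj_oddProj, two_smul, two_smul]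
      abel
    have : (a : G.Fun) * G.parity (lslice (x ∘ₗ G.oddProj) (b : G.Fun)) =
        G.parity (G.parity (a : G.Fun) * lslice (x ∘ₗ G.oddProj) (b : G.Fun)) := by
      rw [parity_mul, hpp]
    rw [this, ← map_add]
    congr 1
    rw [lslice_lie h1, comp_oddProj_oddProj, parity_apply, sub_mul, smul_mul_assoc]
    abel

theorem point_apply_quotFun {h : G.Fun →ₐ[k] k} (hh : h ∈ K.points) {f : G.Fun}
    (hf : f ∈ K.quotFun) : h f = counit (R := k) f := by
  rw [mem_quotFun] at hf
  let h' : G.Fun ⧸ (K.ideal.restrictScalars k) →ₗ[k] k :=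
    (K.ideal.restrictScalars k).liftQ h.toLinearMap (fun f hf => hh f hf)
  have e : ∀ t : G.Fun ⊗[k] G.Fun,
      TensorProduct.lid k k (TensorProduct.map counit h' (K.res.lTensor G.Fun t)) =
        TensorProduct.lid k k (TensorProduct.map counit h.toLinearMap t) := by
    intro t
    induction t with
    | zero => simp
    | add x y hx hy => simp only [map_add, hx, hy]
    | tmul x y => rfl
  have h1 := e (comul f)
  rw [hf] at h1
  have h2 : TensorProduct.lid k k (TensorProduct.map (counit (R := k)) h.toLinearMap (comul f)) =
      h f := by
    have e2 : h f = h (lslice (counit (R := k)) f) := by rw [lslice_counit]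
    rw [e2, lslice_repr]
    conv_lhs => rw [← (ℛ k f).eq]
    simp only [map_sum, map_smul, TensorProduct.map_tmul, TensorProduct.lid_tmul,
      AlgHom.toLinearMap_apply]
  rw [h2] at h1
  rw [← h1]
  have h3 : h' (K.res 1) = 1 := map_one h
  simp [h3]

theorem quotTransl_point_pow {h : G.Fun →ₐ[k] k} (hh : h ∈ K.points) (n : ℕ) :
    ∀ f ∈ K.maxIdeal ^ n, K.quotTransl h.toLinearMap f ∈ K.maxIdeal ^ n := by
  refine K.pow_mem_of_mul _ (fun a b => Subtype.ext ?_) (fun a ha => ?_) n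
  · simp only [coe_quotTransl, MulMemClass.coe_mul, transl_point, lslice_point_mul]
  · rw [mem_maxIdeal] at ha ⊢
    rw [coe_quotTransl, transl_point, counit_lslice, ← ha]
    exact K.point_apply_quotFun hh a.2

/-- The action of the Lie superalgebra of `G` on `Dist(G/K, eK)`:
`(x ψ)(f) = ∑ (-1)^{|f₁||f₂|} x(f₁) ψ(f₂)`. -/
def distAct : G.lie →ₗ[k] Module.End k K.Dist :=
  LinearMap.mk₂ k (fun x ψ => ⟨(ψ : Module.Dual k K.quotFun) ∘ₗ K.quotTransl x, by
      obtain ⟨n, hn⟩ := ψ.2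
      exact ⟨n + 1, fun f hf => hn _ (K.quotTransl_pow x.2 n f hf)⟩⟩)
    (fun x y ψ => Subtype.ext (LinearMap.ext fun f => by
      have : K.quotTransl (x + y : G.lie) f = K.quotTransl x f + K.quotTransl y f :=
        Subtype.ext (LinearMap.congr_fun (transl_add _ _) _)
      change (ψ : Module.Dual k K.quotFun) (K.quotTransl (x + y : G.lie) f) = _
      rw [this, map_add]; rfl))
    (fun c x ψ => Subtype.ext (LinearMap.ext fun f => by
      have : K.quotTransl (c • x : G.lie) f = c • K.quotTransl x f :=
        Subtype.ext (LinearMap.congr_fun (transl_smul _ _) _)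
      change (ψ : Module.Dual k K.quotFun) (K.quotTransl (c • x : G.lie) f) = _
      rw [this, map_smul]; rfl))
    (fun x ψ χ => Subtype.ext rfl) (fun c x ψ => Subtype.ext rfl)

/-- The action of the points of `K₀` on `Dist(G/K, eK)`, by left translation. -/
def distTransl (h : K.points) : Module.End k K.Dist where
  toFun ψ := ⟨(ψ : Module.Dual k K.quotFun) ∘ₗ K.quotTransl (h : G.Fun →ₐ[k] k).toLinearMap, by
    obtain ⟨n, hn⟩ := ψ.2
    exact ⟨n, fun f hf => hn _ (K.quotTransl_point_pow h.2 n f hf)⟩⟩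
  map_add' _ _ := rfl
  map_smul' _ _ := rfl

/-! ### The Lie superalgebra of a closed subgroup -/

theorem conv_mem_ideal {φ ψ : Module.Dual k G.Fun} (hφ : ∀ f ∈ K.ideal, φ f = 0)
    (hψ : ∀ f ∈ K.ideal, ψ f = 0) : ∀ f ∈ K.ideal, ψ (lslice φ f) = 0 := by
  intro f hf
  let I := K.ideal.restrictScalars k
  let φ' : G.Fun ⧸ I →ₗ[k] k := I.liftQ φ (fun f hf => hφ f hf)
  let ψ' : G.Fun ⧸ I →ₗ[k] k := I.liftQ ψ (fun f hf => hψ f hf)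
  have h0 : TensorProduct.map I.mkQ I.mkQ (comul f) = 0 := K.isCoideal.map_mkQ_comul_eq_zero hf
  have e : ∀ t : G.Fun ⊗[k] G.Fun,
      TensorProduct.lid k k (TensorProduct.map φ' ψ' (TensorProduct.map I.mkQ I.mkQ t)) =
        TensorProduct.lid k k (TensorProduct.map φ ψ t) := by
    intro t
    induction t with
    | zero => simp
    | add x y hx hy => simp only [map_add, hx, hy]
    | tmul x y => rfl
  have h1 := e (comul f)
  rw [h0, map_zero, map_zero] at h1
  rw [h1, lslice_repr]
  conv_rhs => rw [← (ℛ k f).eq]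
  simp

/-- The Lie superalgebra of a closed subgroup: the derivations at the identity that vanish on the
ideal of the subgroup. -/
def lie : LieSubsuperalgebra k G.lie where
  carrier := {x | ∀ f ∈ K.ideal, (x : Module.Dual k G.Fun) f = 0}
  add_mem' hx hy f hf := by simp [hx f hf, hy f hf]
  zero_mem' f _ := by simp
  smul_mem' c x hx f hf := by simp [hx f hf]
  graded x hx := by
    have h1 : ∀ f ∈ K.ideal, ((x : Module.Dual k G.Fun) ∘ₗ G.oddProj) f = 0 :=
      fun f hf => hx _ (K.oddProj_mem_ideal hf)
    refine ⟨x - ⟨_, comp_oddProj_mem_lie x.2⟩, ?_, ⟨_, comp_oddProj_mem_lie x.2⟩, h1, ?_, ?_,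
      Subtype.ext (by simp)⟩
    · intro f hf
      have := hx f hf
      have h1' := h1 f hf
      simp only [Submodule.coe_sub, LinearMap.sub_apply, this, h1', sub_zero]
    · exact mem_liePart_zero.2 (by simp [LinearMap.sub_comp, comp_oddProj_oddProj])
    · exact mem_liePart_one.2 (comp_oddProj_oddProj _)
  bracket_mem {x y} hx hy f hf := by
    have hx1 : ∀ f ∈ K.ideal, ((x : Module.Dual k G.Fun) ∘ₗ G.oddProj) f = 0 :=
      fun f hf => hx _ (K.oddProj_mem_ideal hf)
    have hy1 : ∀ f ∈ K.ideal, ((y : Module.Dual k G.Fun) ∘ₗ G.oddProj) f = 0 :=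
      fun f hf => hy _ (K.oddProj_mem_ideal hf)
    change bracketDual (x : Module.Dual k G.Fun) y f = 0
    rw [bracketDual_apply, K.conv_mem_ideal hx hy f hf, K.conv_mem_ideal hy hx f hf,
      K.conv_mem_ideal hx1 hy1 f hf]
    ring

end ClosedSubgroup

/-! ### The adjoint action of the points of `G₀` -/

open WithConv in
theorem rslice_conv (φ ψ : Module.Dual k G.Fun) (f : G.Fun) :
    ψ (rslice φ f) = (toConv ψ * toConv φ).ofConv f := by
  rw [rslice_repr]
  have := (ℛ k f).convMul_apply (toConv ψ) (toConv φ)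
  simp only [map_sum, map_smul, smul_eq_mul]
  refine Eq.trans (Finset.sum_congr rfl fun i _ => mul_comm _ _) this.symm

/-- Pullback of functions under conjugation by a point `h`: `f ↦ ∑ h(f₁) f₂ h(f₃⁻¹)`, where
`h(f⁻¹)` stands for the value of `f` at the inverse of `h`. -/
def conj (h : G.Fun →ₐ[k] k) : G.Fun →ₗ[k] G.Fun :=
  rslice (h.comp G.antipode).toLinearMap ∘ₗ lslice h.toLinearMap

open WithConv in
theorem comp_conj (h : G.Fun →ₐ[k] k) (φ : Module.Dual k G.Fun) :
    toConv (φ ∘ₗ conj h) =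
      toConv h.toLinearMap * (toConv φ * toConv (h.comp G.antipode).toLinearMap) := by
  apply ofConv_injective
  ext f
  change φ (rslice _ (lslice _ f)) = _
  rw [rslice_conv, lslice_conv]

open WithConv in
theorem antipode_conv (h : G.Fun →ₐ[k] k) :
    toConv (h.comp G.antipode).toLinearMap * toConv h.toLinearMap = 1 := by
  apply ofConv_injective
  ext f
  have h1 := congrArg h (G.mul_antipode_left f)
  rw [AlgHom.commutes] at h1
  have h2 := (ℛ k f).convMul_apply (toConv (h.comp G.antipode).toLinearMap)
    (toConv h.toLinearMap)
  refine h2.trans ?_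
  change _ = counit (R := k) f
  rw [show counit (R := k) f = algebraMap k k (counit (R := k) f) from rfl, ← h1]
  conv_rhs => rw [← (ℛ k f).eq]
  simp

open WithConv in
theorem conv_antipode (h : G.Fun →ₐ[k] k) :
    toConv h.toLinearMap * toConv (h.comp G.antipode).toLinearMap = 1 := by
  apply ofConv_injective
  ext f
  have h1 := congrArg h (G.mul_antipode_right f)
  rw [AlgHom.commutes] at h1
  have h2 := (ℛ k f).convMul_apply (toConv h.toLinearMap)
    (toConv (h.comp G.antipode).toLinearMap)
  refine h2.trans ?_
  change _ = counit (R := k) f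
  rw [show counit (R := k) f = algebraMap k k (counit (R := k) f) from rfl, ← h1]
  conv_rhs => rw [← (ℛ k f).eq]
  simp

theorem conj_mul (h : G.Fun →ₐ[k] k) (a b : G.Fun) : conj h (a * b) = conj h a * conj h b := by
  simp only [conj, LinearMap.comp_apply, lslice_point_mul, rslice_point_mul]

theorem counit_conj (h : G.Fun →ₐ[k] k) (f : G.Fun) :
    counit (R := k) (conj h f) = counit (R := k) f := by
  have h1 : WithConv.toConv ((counit (R := k)) ∘ₗ conj h) = WithConv.toConv (counit (R := k)) := by
    rw [comp_conj, show (WithConv.toConv (counit (R := k)) : WithConv (Module.Dual k G.Fun)) = 1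
      from rfl, one_mul, conv_antipode]
  exact LinearMap.congr_fun (WithConv.toConv_injective h1) f

theorem comp_conj_mem_lie (h : G.Fun →ₐ[k] k) {x : Module.Dual k G.Fun} (hx : x ∈ G.lie) :
    x ∘ₗ conj h ∈ G.lie := by
  intro a b
  simp only [LinearMap.comp_apply, conj_mul, hx _ _, counit_conj]

theorem point_parity (h : G.Fun →ₐ[k] k) : h.toLinearMap ∘ₗ G.parity = h.toLinearMap := by
  ext f
  simp [parity_apply, G.point_odd h (G.oddProj_mem f)]

theorem comp_conj_parity (h : G.Fun →ₐ[k] k) (φ : Module.Dual k G.Fun) :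
    (φ ∘ₗ conj h) ∘ₗ G.parity = (φ ∘ₗ G.parity) ∘ₗ conj h := by
  apply WithConv.toConv_injective
  have e := congrArg WithConv.ofConv (comp_conj h φ)
  change φ ∘ₗ conj h = _ at e
  rw [e, comp_conj h (φ ∘ₗ G.parity)]
  have e1 := conv_comp_parity h.toLinearMap
    (WithConv.toConv φ * WithConv.toConv (h.comp G.antipode).toLinearMap).ofConv
  have e2 := conv_comp_parity φ (h.comp G.antipode).toLinearMap
  rw [point_parity] at e2
  rw [WithConv.toConv_ofConv, point_parity, e2] at e1
  rw [e1]

theorem comp_conj_oddProj (h : G.Fun →ₐ[k] k) (φ : Module.Dual k G.Fun) :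
    (φ ∘ₗ conj h) ∘ₗ G.oddProj = (φ ∘ₗ G.oddProj) ∘ₗ conj h := by
  have e : ∀ f : G.Fun, G.oddProj f = (2⁻¹ : k) • (f - G.parity f) := by
    intro f
    rw [parity_apply, sub_sub_cancel, smul_smul, inv_mul_cancel₀ two_ne_zero, one_smul]
  ext f
  have := LinearMap.congr_fun (comp_conj_parity h φ) f
  simp only [LinearMap.comp_apply] at this ⊢
  rw [e, e, map_smul, map_smul, map_smul, map_sub, map_sub, map_sub, this]

variable (G) in
/-- The adjoint action of a point of `G₀` on the Lie superalgebra of `G`. -/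
def ad (h : G.Fun →ₐ[k] k) : LieSuperalgebra.Hom k G.lie G.lie where
  toFun x := ⟨(x : Module.Dual k G.Fun) ∘ₗ conj h, comp_conj_mem_lie h x.2⟩
  map_add' _ _ := rfl
  map_smul' _ _ := rfl
  map_part i x hx := by
    change x ∈ G.liePart i at hx
    change _ ∈ G.liePart i
    rw [mem_liePart_iff] at hx ⊢
    rw [comp_conj_parity, hx, LinearMap.smul_comp]
  map_bracket x y := by
    apply Subtype.ext
    change bracketDual (x : Module.Dual k G.Fun) y ∘ₗ conj h =
      bracketDual ((x : Module.Dual k G.Fun) ∘ₗ conj h) ((y : Module.Dual k G.Fun) ∘ₗ conj h)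
    apply WithConv.toConv_injective
    have key : ∀ a b s t : WithConv (Module.Dual k G.Fun), t * s = 1 →
        s * (a * t) * (s * (b * t)) = s * (a * b * t) := by
      intro a b s t ht
      calc s * (a * t) * (s * (b * t)) = s * a * (t * s) * b * t := by simp only [mul_assoc]
        _ = _ := by rw [ht]; simp only [mul_assoc, one_mul]
    rw [comp_conj, bracketDual_conv, bracketDual_conv, comp_conj_oddProj, comp_conj_oddProj,
      comp_conj, comp_conj, comp_conj, comp_conj, key _ _ _ _ (antipode_conv h),
      key _ _ _ _ (antipode_conv h), key _ _ _ _ (antipode_conv h)]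
    simp only [mul_sub, sub_mul, mul_smul_comm, smul_mul_assoc]

theorem ClosedSubgroup.ad_mem_lie (K : G.ClosedSubgroup) {h : G.Fun →ₐ[k] k} (hh : h ∈ K.points) :
    ∀ x ∈ K.lie.toSubmodule, (G.ad h).toLinearMap x ∈ K.lie.toSubmodule := by
  intro x hx f hf
  change (x : Module.Dual k G.Fun) (rslice _ (lslice _ f)) = 0
  have h1 : ∀ f ∈ K.ideal, (h.comp G.antipode).toLinearMap f = 0 :=
    fun f hf => hh _ (K.antipode_mem f hf)
  have h2 : ∀ f ∈ K.ideal, (x : Module.Dual k G.Fun) (rslice (h.comp G.antipode).toLinearMap f) =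
      0 := by
    intro f hf
    rw [rslice_conv, ← lslice_conv]
    exact K.conv_mem_ideal hx h1 f hf
  exact K.conv_mem_ideal (ψ := (x : Module.Dual k G.Fun) ∘ₗ rslice _) (fun f hf => hh f hf) h2 f hf

/-- The adjoint action of a point of `K₀` on the Lie superalgebra of `K`. -/
def ClosedSubgroup.ad (K : G.ClosedSubgroup) (h : K.points) :
    LieSuperalgebra.Hom k K.lie.toSubmodule K.lie.toSubmodule :=
  (G.ad h).restrict K.lie (K.ad_mem_lie h.2)

/-! ### The even part `G₀` -/

/-- A quotient of a coalgebra to which the comultiplication and the counit descend. -/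
abbrev coalgebraOfSurjective {k C B : Type*} [Field k] [AddCommGroup C] [Module k C]
    [Coalgebra k C] [AddCommGroup B] [Module k B] (p : C →ₗ[k] B) (hp : Function.Surjective p)
    (Δ : B →ₗ[k] B ⊗[k] B) (e : B →ₗ[k] k)
    (hΔ : ∀ c, Δ (p c) = TensorProduct.map p p (comul c)) (he : ∀ c, e (p c) = counit (R := k) c) :
    Coalgebra k B where
  comul := Δ
  counit := e
  coassoc := by
    refine LinearMap.ext fun x => ?_
    obtain ⟨f, rfl⟩ := hp x
    have h := congrArg (TensorProduct.map p (TensorProduct.map p p)) (coassoc_apply (R := k) f)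
    simp only [LinearMap.comp_apply, LinearEquiv.coe_coe, hΔ]
    refine Eq.trans ?_ (h.trans ?_)
    · induction comul (R := k) f with
      | zero => simp
      | add x y hx hy => simp only [map_add, hx, hy]
      | tmul x y =>
        simp only [TensorProduct.map_tmul, LinearMap.rTensor_tmul, hΔ]
        induction comul (R := k) x with
        | zero => simp
        | add x y hx hy => simp only [TensorProduct.add_tmul, map_add, hx, hy]
        | tmul a b => simp
    · induction comul (R := k) f with
      | zero => simp
      | add x y hx hy => simp only [map_add, hx, hy]
      | tmul x y => simp only [TensorProduct.map_tmul, LinearMap.lTensor_tmul, hΔ]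
  rTensor_counit_comp_comul := by
    refine LinearMap.ext fun x => ?_
    obtain ⟨f, rfl⟩ := hp x
    have h := congrArg (TensorProduct.map LinearMap.id p) (rTensor_counit_comul (R := k) f)
    simp only [LinearMap.comp_apply, hΔ]
    refine Eq.trans ?_ h
    induction comul (R := k) f with
    | zero => simp
    | add x y hx hy => simp only [map_add, hx, hy]
    | tmul x y => simp [he]
  lTensor_counit_comp_comul := by
    refine LinearMap.ext fun x => ?_
    obtain ⟨f, rfl⟩ := hp x
    have h := congrArg (TensorProduct.map p LinearMap.id) (lTensor_counit_comul (R := k) f)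
    simp only [LinearMap.comp_apply, hΔ]
    refine Eq.trans ?_ h
    induction comul (R := k) f with
    | zero => simp
    | add x y hx hy => simp only [map_add, hx, hy]
    | tmul x y => simp [he]


variable (G) in
/-- The ideal generated by the odd functions. -/
def oddIdeal : Ideal G.Fun := Ideal.span (G.gr 1 : Set G.Fun)

theorem oddProj_mem_oddIdeal (f : G.Fun) : G.oddProj f ∈ G.oddIdeal :=
  Ideal.subset_span (G.oddProj_mem f)

instance : G.oddIdeal.IsTwoSided := ⟨by
  intro a b ha
  unfold oddIdeal at ha ⊢
  induction ha using Submodule.span_induction with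
  | mem x hx =>
    have h : x * b = (b - G.oddProj b) * x - G.oddProj b * x := by
      have h0 := G.supercomm hx (G.sub_oddProj_mem b)
      have h1 := G.supercomm hx (G.oddProj_mem b)
      rw [koszulSign_zero_right, one_smul] at h0
      rw [koszulSign_one_one, neg_smul, one_smul] at h1
      rw [sub_eq_add_neg, ← h0, ← h1, ← mul_add, sub_add_cancel]
    rw [h]
    exact Ideal.sub_mem _ (Ideal.mul_mem_left _ _ (Ideal.subset_span hx))
      (Ideal.mul_mem_left _ _ (Ideal.subset_span hx))
  | zero => rw [zero_mul]; exact Ideal.zero_mem _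
  | add x y _ _ hx hy => rw [add_mul]; exact Ideal.add_mem _ hx hy
  | smul c x _ hx => rw [smul_eq_mul, mul_assoc]; exact Ideal.mul_mem_left _ _ hx⟩

variable (G) in
/-- The algebra `k[G₀]`. -/
def EvenFun : Type _ := G.Fun ⧸ G.oddIdeal

instance : Ring G.EvenFun := inferInstanceAs (Ring (G.Fun ⧸ G.oddIdeal))

theorem evenFun_mul_comm (x y : G.EvenFun) : x * y = y * x := by
    obtain ⟨a, rfl⟩ := Ideal.Quotient.mk_surjective (I := G.oddIdeal) x
    obtain ⟨b, rfl⟩ := Ideal.Quotient.mk_surjective (I := G.oddIdeal) y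
    have e : ∀ f : G.Fun, Ideal.Quotient.mk G.oddIdeal f =
        Ideal.Quotient.mk G.oddIdeal (f - G.oddProj f) := fun f => by
      rw [map_sub, Ideal.Quotient.eq_zero_iff_mem.2 (oddProj_mem_oddIdeal f), sub_zero]
    have h := G.supercomm (G.sub_oddProj_mem a) (G.sub_oddProj_mem b)
    rw [koszulSign_zero_right, one_smul] at h
    rw [e a, e b]
    exact congrArg (Ideal.Quotient.mk G.oddIdeal) h

instance : Algebra k G.EvenFun := inferInstanceAs (Algebra k (G.Fun ⧸ G.oddIdeal))

variable (G) in
/-- The restriction of functions from `G` to `G₀`. -/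
def toEven : G.Fun →ₐ[k] G.EvenFun := Ideal.Quotient.mkₐ k G.oddIdeal

theorem toEven_surjective : Function.Surjective G.toEven := Ideal.Quotient.mk_surjective

theorem toEven_eq_zero {f : G.Fun} : G.toEven f = 0 ↔ f ∈ G.oddIdeal :=
  Ideal.Quotient.eq_zero_iff_mem

theorem toEven_oddProj (f : G.Fun) : G.toEven (G.oddProj f) = 0 :=
  toEven_eq_zero.2 (oddProj_mem_oddIdeal f)

theorem toEven_parity (f : G.Fun) : G.toEven (G.parity f) = G.toEven f := by
  rw [parity_apply, map_sub, map_smul, toEven_oddProj, smul_zero, sub_zero]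

theorem toEven_comul_mul (a b : G.Fun) :
    TensorProduct.map G.toEven.toLinearMap G.toEven.toLinearMap (comul (a * b)) =
      TensorProduct.map G.toEven.toLinearMap G.toEven.toLinearMap (comul a) *
        TensorProduct.map G.toEven.toLinearMap G.toEven.toLinearMap (comul b) := by
  rw [comul_mul_repr]
  conv_rhs => rw [← (ℛ k a).eq, ← (ℛ k b).eq]
  simp only [map_sum, Finset.sum_mul, Finset.mul_sum]
  rw [Finset.sum_comm]
  refine Finset.sum_congr rfl fun i _ => Finset.sum_congr rfl fun j _ => ?_
  rw [map_sub, map_smul, TensorProduct.map_tmul, TensorProduct.map_tmul, TensorProduct.map_tmul,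
    TensorProduct.map_tmul]
  simp only [AlgHom.toLinearMap_apply, map_mul, toEven_oddProj, mul_zero, zero_mul,
    TensorProduct.tmul_zero, smul_zero, sub_zero]
  exact (Algebra.TensorProduct.tmul_mul_tmul _ _ _ _).symm

variable (G) in
/-- The comultiplication of `k[G]`, restricted to `G₀`. -/
def evenComulAux : G.Fun →ₐ[k] G.EvenFun ⊗[k] G.EvenFun :=
  AlgHom.ofLinearMap (TensorProduct.map G.toEven.toLinearMap G.toEven.toLinearMap ∘ₗ comul)
    (by rw [LinearMap.comp_apply, G.comul_one]; rfl) toEven_comul_mul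

theorem algHom_oddIdeal {B : Type*} [Ring B] [Algebra k B] (F : G.Fun →ₐ[k] B)
    (hF : ∀ f, F (G.parity f) = F f) : ∀ f ∈ G.oddIdeal, F f = 0 := by
  intro f hf
  unfold oddIdeal at hf
  induction hf using Submodule.span_induction with
  | mem x hx =>
    have h := hF x
    rw [G.parity_of_odd hx, map_neg] at h
    have h2 : (2 : k) • F x = 0 := by rw [two_smul]; nth_rw 1 [← h]; exact neg_add_cancel _
    exact (smul_eq_zero.1 h2).resolve_left two_ne_zero
  | zero => exact map_zero F
  | add x y _ _ hx hy => rw [map_add, hx, hy, add_zero]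
  | smul c x _ hx => rw [smul_eq_mul, map_mul, hx, mul_zero]

theorem evenComulAux_parity (f : G.Fun) : G.evenComulAux (G.parity f) = G.evenComulAux f := by
  change TensorProduct.map G.toEven.toLinearMap G.toEven.toLinearMap (comul (superParity G.gr f)) =
    TensorProduct.map G.toEven.toLinearMap G.toEven.toLinearMap (comul f)
  rw [G.comul_parity]
  induction comul (R := k) f with
  | zero => simp
  | add x y hx hy => simp only [map_add, hx, hy]
  | tmul x y =>
    simp only [TensorProduct.map_tmul, AlgHom.toLinearMap_apply]
    rw [show G.toEven (superParity G.gr x) = _ from toEven_parity x,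
      show G.toEven (superParity G.gr y) = _ from toEven_parity y]

variable (G) in
/-- The comultiplication of `k[G₀]`. -/
def evenComul : G.EvenFun →ₐ[k] G.EvenFun ⊗[k] G.EvenFun :=
  Ideal.Quotient.liftₐ G.oddIdeal G.evenComulAux (algHom_oddIdeal _ evenComulAux_parity)

variable (G) in
/-- The restriction of a point to `G₀`. -/
def evenPoint (h : G.Fun →ₐ[k] k) : G.EvenFun →ₐ[k] k :=
  Ideal.Quotient.liftₐ G.oddIdeal h
    (algHom_oddIdeal _ fun f => LinearMap.congr_fun (point_parity h) f)

variable (G) in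
/-- The inversion of `G₀`. -/
def evenAntipode : G.EvenFun →ₐ[k] G.EvenFun :=
  Ideal.Quotient.liftₐ G.oddIdeal (G.toEven.comp G.antipode) (algHom_oddIdeal _ fun f => by
    rw [AlgHom.comp_apply, AlgHom.comp_apply,
      show G.antipode (G.parity f) = G.parity (G.antipode f) from G.antipode_parity f,
      toEven_parity])

theorem evenComul_toEven (f : G.Fun) : G.evenComul (G.toEven f) =
    TensorProduct.map G.toEven.toLinearMap G.toEven.toLinearMap (comul f) := rfl

theorem evenPoint_toEven (h : G.Fun →ₐ[k] k) (f : G.Fun) : G.evenPoint h (G.toEven f) = h f := rfl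

theorem evenAntipode_toEven (f : G.Fun) : G.evenAntipode (G.toEven f) = G.toEven (G.antipode f) :=
  rfl

instance : Coalgebra k G.EvenFun :=
  coalgebraOfSurjective G.toEven.toLinearMap toEven_surjective G.evenComul.toLinearMap
    (G.evenPoint G.counitHom).toLinearMap (fun _ => rfl) (fun _ => rfl)

theorem comul_toEven (f : G.Fun) : comul (R := k) (G.toEven f) =
    TensorProduct.map G.toEven.toLinearMap G.toEven.toLinearMap (comul f) := rfl

theorem counit_toEven (f : G.Fun) : counit (R := k) (G.toEven f) = counit (R := k) f := rfl

/-- The grading of an ordinary algebra, in even degree. -/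
def trivialGrading (k A : Type*) [Field k] [Ring A] [Algebra k A] (i : ZMod 2) : Submodule k A :=
  if i = 0 then ⊤ else ⊥

instance (k A : Type*) [Field k] [Ring A] [Algebra k A] : GradedAlgebra (trivialGrading k A) where
  one_mem := by simp [trivialGrading]
  mul_mem i j a b ha hb := by
    rcases zmod2_cases i with rfl | rfl
    · rcases zmod2_cases j with rfl | rfl
      · simp [trivialGrading]
      · have : b = 0 := by simpa [trivialGrading] using hb
        rw [this, mul_zero]; exact Submodule.zero_mem _
    · have : a = 0 := by simpa [trivialGrading] using ha
      rw [this, zero_mul]; exact Submodule.zero_mem _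
  decompose' a := DirectSum.of (fun i => trivialGrading k A i) 0 ⟨a, by simp [trivialGrading]⟩
  left_inv a := by simp
  right_inv x := by
    induction x using DirectSum.induction_on with
    | zero =>
      rw [map_zero]
      exact map_zero (DirectSum.of (fun i => trivialGrading k A i) 0)
    | of i a =>
      rcases zmod2_cases i with rfl | rfl
      · simp
      · have : a = 0 := Subtype.ext (by simpa [trivialGrading] using a.2)
        rw [this, map_zero, map_zero]
        exact map_zero (DirectSum.of (fun i => trivialGrading k A i) 0)
    | add x y hx hy =>
      rw [map_add]
      conv_rhs => rw [← hx, ← hy]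
      refine Eq.trans ?_ (map_add (DirectSum.of (fun i => trivialGrading k A i) 0) _ _)
      refine congrArg (DirectSum.of (fun i => trivialGrading k A i) 0) (Subtype.ext ?_)
      rfl

theorem trivialGrading_one (k A : Type*) [Field k] [Ring A] [Algebra k A] :
    trivialGrading k A 1 = ⊥ := by simp [trivialGrading]

theorem trivialGrading_parity (k A : Type*) [Field k] [Ring A] [Algebra k A] (a : A) :
    superParity (trivialGrading k A) a = a := by
  have h : GradedAlgebra.proj (trivialGrading k A) 1 a = 0 := by
    rw [GradedAlgebra.proj_apply]
    have := (DirectSum.decompose (trivialGrading k A) a 1).2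
    simpa [trivialGrading] using this
  simp [superParity, h]

theorem trivialGrading_mul (k A : Type*) [Field k] [Ring A] [Algebra k A] (x y : A ⊗[k] A) :
    GradedTensorProduct.of k (trivialGrading k A) (trivialGrading k A) (x * y) =
      GradedTensorProduct.of k (trivialGrading k A) (trivialGrading k A) x *
        GradedTensorProduct.of k (trivialGrading k A) (trivialGrading k A) y := by
  induction x with
  | zero => simp
  | add x x' hx hx' => simp only [add_mul, map_add, hx, hx']
  | tmul a b =>
    induction y with
    | zero => simp
    | add x x' hx hx' => simp only [mul_add, map_add, hx, hx']
    | tmul c d =>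
      have := GradedTensorProduct.tmul_coe_mul_coe_tmul (R := k) (trivialGrading k A)
        (trivialGrading k A) a (⟨b, by simp [trivialGrading]⟩ : trivialGrading k A 0)
        (⟨c, by simp [trivialGrading]⟩ : trivialGrading k A 0) d
      simp only [mul_zero, uzpow_zero, one_smul] at this
      rw [Algebra.TensorProduct.tmul_mul_tmul]
      exact this.symm

variable (G) in
/-- The even part `G₀` of `G`, an ordinary algebraic group. -/
def even : Supergroup k where
  Fun := G.EvenFun
  gr := trivialGrading k G.EvenFun
  supercomm {i j a b} ha hb := by
    rcases zmod2_cases i with rfl | rfl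
    · rw [koszulSign_zero_left, one_smul, evenFun_mul_comm]
    · have : a = 0 := by simpa [trivialGrading] using ha
      rw [this, zero_mul, mul_zero, smul_zero]
  finiteType := by
    have := G.finiteType
    exact Algebra.FiniteType.of_surjective G.toEven toEven_surjective
  reduced x n hx := by
    rw [trivialGrading_one, Submodule.bot_coe, Ideal.span_singleton_zero] at hx ⊢
    obtain ⟨a, rfl⟩ := toEven_surjective x
    rw [← map_pow] at hx
    exact toEven_eq_zero.2 (G.reduced a n (toEven_eq_zero.1 hx))
  counit_one := map_one (G.evenPoint G.counitHom)
  counit_mul := map_mul (G.evenPoint G.counitHom)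
  counit_parity a := by rw [trivialGrading_parity]
  comul_one := map_one G.evenComul
  comul_mul a b := by
    rw [← trivialGrading_mul]
    exact congrArg _ (map_mul G.evenComul a b)
  comul_parity a := by
    rw [trivialGrading_parity]
    have : superParity (trivialGrading k G.EvenFun) = LinearMap.id :=
      LinearMap.ext (trivialGrading_parity k _)
    rw [this, TensorProduct.map_id]; rfl
  antipode := G.evenAntipode
  antipode_parity a := by rw [trivialGrading_parity, trivialGrading_parity]
  mul_antipode_left x := by
    obtain ⟨f, rfl⟩ := toEven_surjective x
    have h := congrArg G.toEven (G.mul_antipode_left f)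
    rw [AlgHom.commutes] at h
    rw [comul_toEven, counit_toEven, ← h]
    induction comul (R := k) f with
    | zero => simp
    | add x y hx hy => simp only [map_add, hx, hy]
    | tmul x y => simp [evenAntipode_toEven]
  mul_antipode_right x := by
    obtain ⟨f, rfl⟩ := toEven_surjective x
    have h := congrArg G.toEven (G.mul_antipode_right f)
    rw [AlgHom.commutes] at h
    rw [comul_toEven, counit_toEven, ← h]
    induction comul (R := k) f with
    | zero => simp
    | add x y hx hy => simp only [map_add, hx, hy]
    | tmul x y => simp [evenAntipode_toEven]

variable (G) in
/-- The restriction of functions from `G` to `G₀`. -/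
def restrEven : G.Fun →ₐ[k] G.even.Fun := G.toEven

theorem restrEven_surjective : Function.Surjective G.restrEven := toEven_surjective

theorem restrEven_eq_zero {f : G.Fun} : G.restrEven f = 0 ↔ f ∈ G.oddIdeal := toEven_eq_zero

theorem comul_restrEven (f : G.Fun) : comul (R := k) (G.restrEven f) =
    TensorProduct.map G.restrEven.toLinearMap G.restrEven.toLinearMap (comul f) := rfl

theorem counit_restrEven (f : G.Fun) : counit (R := k) (G.restrEven f) = counit (R := k) f := rfl

theorem even_parity (f : G.even.Fun) : G.even.parity f = f :=
  trivialGrading_parity k G.EvenFun f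

theorem even_span_odd : Ideal.span (G.even.gr 1 : Set G.even.Fun) = ⊥ := by
  have : G.even.gr 1 = ⊥ := trivialGrading_one k G.EvenFun
  rw [this, Submodule.bot_coe, Ideal.span_singleton_zero]

namespace ClosedSubgroup

variable (K : G.ClosedSubgroup)

theorem mem_map_restrEven {f : G.Fun} :
    G.restrEven f ∈ K.ideal.map G.restrEven ↔ f ∈ K.ideal ⊔ G.oddIdeal := by
  rw [Ideal.mem_map_iff_of_surjective _ restrEven_surjective, Submodule.mem_sup]
  constructor
  · rintro ⟨a, ha, h⟩
    refine ⟨a, ha, f - a, ?_, add_sub_cancel _ _⟩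
    rw [← restrEven_eq_zero, map_sub, h, sub_self]
  · rintro ⟨a, ha, b, hb, rfl⟩
    exact ⟨a, ha, by rw [map_add, restrEven_eq_zero.2 hb, add_zero]⟩

/-- The even part `K₀` of a closed subgroup `K`, as a closed subgroup of `G₀`. -/
def even : G.even.ClosedSubgroup where
  ideal := K.ideal.map G.restrEven
  parity_mem f hf := by rwa [even_parity]
  isCoideal := by
    refine ⟨fun x hx => ?_, fun x hx => ?_⟩
    · obtain ⟨a, ha, rfl⟩ := (Ideal.mem_map_iff_of_surjective _ restrEven_surjective).1 hx
      rw [counit_restrEven]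
      exact K.isCoideal.counit_eq_zero ha
    · obtain ⟨a, ha, rfl⟩ := (Ideal.mem_map_iff_of_surjective _ restrEven_surjective).1 hx
      have h0 := K.isCoideal.map_mkQ_comul_eq_zero ha
      let q : G.Fun ⧸ (K.ideal.restrictScalars k) →ₗ[k]
          G.even.Fun ⧸ ((K.ideal.map G.restrEven).restrictScalars k) :=
        Submodule.mapQ _ _ G.restrEven.toLinearMap (fun f hf => Ideal.mem_map_of_mem _ hf)
      have h1 := congrArg (TensorProduct.map q q) h0
      rw [map_zero] at h1
      rw [comul_restrEven, ← h1]
      induction comul (R := k) a with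
      | zero => simp
      | add x y hx hy => simp only [map_add, hx, hy]
      | tmul x y =>
        rw [TensorProduct.map_tmul, TensorProduct.map_tmul, TensorProduct.map_tmul,
          TensorProduct.map_tmul]
        exact congrArg₂ (fun s t => s ⊗ₜ[k] t) rfl rfl
  antipode_mem f hf := by
    obtain ⟨a, ha, rfl⟩ := (Ideal.mem_map_iff_of_surjective _ restrEven_surjective).1 hf
    exact Ideal.mem_map_of_mem G.restrEven (K.antipode_mem a ha)
  reduced f n hf := by
    obtain ⟨a, rfl⟩ := restrEven_surjective f
    rw [even_span_odd, sup_bot_eq] at hf ⊢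
    rw [← map_pow, mem_map_restrEven] at hf
    exact K.mem_map_restrEven.2 (K.reduced a n hf)

theorem point_oddIdeal (h : G.Fun →ₐ[k] k) : ∀ f ∈ G.oddIdeal, h f = 0 :=
  algHom_oddIdeal h fun f => LinearMap.congr_fun (point_parity h) f

/-- A point of `K₀`, seen in the group `G₀`. -/
def evenPoints (h : K.points) : K.even.points :=
  ⟨G.evenPoint h, fun f hf => by
    obtain ⟨a, ha, rfl⟩ := (Ideal.mem_map_iff_of_surjective _ restrEven_surjective).1 hf
    exact h.2 a ha⟩

theorem points_of_even_eq {K K' : G.ClosedSubgroup} (e : K'.even = K.even) {h : G.Fun →ₐ[k] k}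
    (hh : h ∈ K.points) : h ∈ K'.points := by
  intro f hf
  have h1 : G.restrEven f ∈ K'.even.ideal := Ideal.mem_map_of_mem _ hf
  rw [e] at h1
  obtain ⟨a, ha, b, hb, rfl⟩ := Submodule.mem_sup.1 (K.mem_map_restrEven.1 h1)
  rw [map_add, hh a ha, point_oddIdeal h b hb, add_zero]

theorem restrEven_mem_quotFun {f : G.Fun} (hf : f ∈ K.quotFun) :
    G.restrEven f ∈ K.even.quotFun := by
  rw [mem_quotFun] at hf ⊢
  let q : G.Fun ⧸ (K.ideal.restrictScalars k) →ₗ[k]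
      G.even.Fun ⧸ (K.even.ideal.restrictScalars k) :=
    Submodule.mapQ _ _ G.restrEven.toLinearMap (fun f hf => Ideal.mem_map_of_mem G.restrEven hf)
  have h1 := congrArg (TensorProduct.map G.restrEven.toLinearMap q) hf
  refine Eq.trans ?_ (h1.trans ?_)
  · rw [comul_restrEven]
    induction comul (R := k) f with
    | zero => simp
    | add x y hx hy => simp only [map_add, hx, hy]
    | tmul x y => rfl
  · rw [TensorProduct.map_tmul]
    have h2 : q (K.res 1) = K.even.res 1 := congrArg K.even.res (map_one G.restrEven)
    rw [h2]; rfl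

/-- The restriction of functions from `G/K` to `G₀/K₀`. -/
def quotRestr : K.quotFun →ₐ[k] K.even.quotFun :=
  (G.restrEven.comp K.quotFun.val).codRestrict K.even.quotFun
    (fun f => K.restrEven_mem_quotFun f.2)

theorem quotRestr_pow (n : ℕ) :
    ∀ f ∈ K.maxIdeal ^ n, K.quotRestr f ∈ K.even.maxIdeal ^ n := by
  induction n with
  | zero => intro f _; rw [maxIdeal_pow_zero]; trivial
  | succ n ih =>
    intro f hf
    rw [maxIdeal_pow_succ] at hf ⊢
    refine Submodule.smul_induction_on hf (fun a ha b hb => ?_) (fun a b ha hb => ?_)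
    · rw [smul_eq_mul, map_mul]
      refine Ideal.mul_mem_mul ?_ (ih b hb)
      exact (counit_restrEven (a : G.Fun)).trans ha
    · rw [map_add]; exact Ideal.add_mem _ ha hb

/-- The pushforward of distributions from `G₀/K₀` to `G/K`. -/
def pushDist : K.even.Dist →ₗ[k] K.Dist where
  toFun ψ := ⟨(ψ : Module.Dual k K.even.quotFun) ∘ₗ K.quotRestr.toLinearMap, by
    obtain ⟨n, hn⟩ := ψ.2
    exact ⟨n, fun f hf => hn _ (K.quotRestr_pow n f hf)⟩⟩
  map_add' _ _ := rfl
  map_smul' _ _ := rfl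

end ClosedSubgroup

theorem lie_even_oddIdeal {x : G.lie} (hx : x ∈ G.liePart 0) :
    ∀ f ∈ G.oddIdeal, (x : Module.Dual k G.Fun) f = 0 := by
  intro f hf
  have hc : ∀ f ∈ G.oddIdeal, counit (R := k) f = 0 := ClosedSubgroup.point_oddIdeal G.counitHom
  have hf' := hf
  unfold oddIdeal at hf'
  induction hf' using Submodule.span_induction with
  | mem y hy => exact hx y (by simpa using hy)
  | zero => exact map_zero _
  | add a b ha hb iha ihb => rw [map_add, iha ha, ihb hb, add_zero]
  | smul c a ha iha => rw [smul_eq_mul, x.2, iha ha, hc a ha]; ring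

variable (G) in
/-- The identification of the even part of the Lie superalgebra of `G` with the Lie algebra of
`G₀`: an even derivation at the identity vanishes on the ideal generated by the odd functions. -/
def lieRestr : LieSuperalgebra.part (k := k) (L := G.lie) 0 →ₗ[k] G.even.lie where
  toFun x := ⟨(G.oddIdeal.restrictScalars k).liftQ ((x : G.lie) : Module.Dual k G.Fun)
      (fun f hf => lie_even_oddIdeal x.2 f hf), by
    intro f g
    obtain ⟨a, rfl⟩ := restrEven_surjective f
    obtain ⟨b, rfl⟩ := restrEven_surjective g
    exact (x : G.lie).2 a b⟩
  map_add' x y := Subtype.ext (LinearMap.ext fun f => by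
    obtain ⟨a, rfl⟩ := restrEven_surjective f
    rfl)
  map_smul' c x := Subtype.ext (LinearMap.ext fun f => by
    obtain ⟨a, rfl⟩ := restrEven_surjective f
    rfl)

/-! ### Affine homogeneous spaces -/

namespace ClosedSubgroup

variable (K : G.ClosedSubgroup)

/-- `a ⊗ b ↦ ∑ a b₁ ⊗ b₂|_K`, the pullback of functions under `G × K → G × G`, `(g, h) ↦ (g, g h)` -/
def torsorMap : G.Fun ⊗[k] G.Fun →ₗ[k] G.Fun ⊗[k] (G.Fun ⧸ (K.ideal.restrictScalars k)) :=
  TensorProduct.map (LinearMap.mul' k G.Fun) K.res ∘ₗ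
    (TensorProduct.assoc k G.Fun G.Fun G.Fun).symm.toLinearMap ∘ₗ comul.lTensor G.Fun

/-- The homogeneous space `G/K` is affine: `G → Spec k[G]^K` is the quotient of `G` by `K`, i.e. it
is faithfully flat and `G ×_{Spec k[G]^K} G` is `G × K`. (Flatness is written out by the equational
criterion, as `k[G]^K` need not be commutative.) -/
structure IsAffineQuotient : Prop where
  flat : ∀ (n : ℕ) (r : Fin n → K.quotFun) (s : Fin n → G.Fun), ∑ i, (r i : G.Fun) * s i = 0 →
    ∃ (m : ℕ) (c : Fin n → Fin m → K.quotFun) (t : Fin m → G.Fun),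
      (∀ i, s i = ∑ j, (c i j : G.Fun) * t j) ∧ ∀ j, ∑ i, r i * c i j = 0
  faithful : ∀ (n : ℕ) (r : Fin n → K.quotFun) (s : Fin n → G.Fun),
    ∑ i, (r i : G.Fun) * s i = 1 → ∃ c : Fin n → K.quotFun, ∑ i, r i * c i = 1
  torsor : ∀ t : G.Fun ⊗[k] G.Fun, K.torsorMap t = 0 →
    t ∈ Submodule.span k {u : G.Fun ⊗[k] G.Fun | ∃ (a b : G.Fun) (r : K.quotFun),
      u = (a * r) ⊗ₜ b - a ⊗ₜ (r * b)}

end ClosedSubgroup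

/-! ### Symmetric subgroups -/

variable (G) in
/-- An involution of the supergroup `G`, given by the pullback of functions. -/
structure Involution where
  /-- the pullback of functions -/
  pullback : G.Fun →ₐ[k] G.Fun
  involutive : ∀ f, pullback (pullback f) = f
  parity : ∀ f, pullback (G.parity f) = G.parity (pullback f)
  comul : ∀ f, Coalgebra.comul (R := k) (pullback f) =
    TensorProduct.map pullback.toLinearMap pullback.toLinearMap (Coalgebra.comul f)
  counit : ∀ f, Coalgebra.counit (R := k) (pullback f) = Coalgebra.counit (R := k) f

namespace Involution

variable (θ : G.Involution)

/-- The ideal of the fixed point subgroup `G^θ`. -/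
def fixedIdeal : Ideal G.Fun := Ideal.span {g | ∃ f : G.Fun, g = θ.pullback f - f}

/-- The ideal of the identity component of `G^θ`: it is generated, modulo the ideal of `G^θ`, by the
idempotents that vanish at the identity. -/
def fixedIdentityIdeal : Ideal G.Fun :=
  θ.fixedIdeal ⊔ Ideal.span {e | e * e - e ∈ θ.fixedIdeal ∧ Coalgebra.counit (R := k) e = 0}

/-- `(G^θ)⁰ ⊆ K ⊆ G^θ` -/
def IsSymmetric (K : G.ClosedSubgroup) : Prop :=
  θ.fixedIdeal ≤ K.ideal ∧ K.ideal ≤ θ.fixedIdentityIdeal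

/-- `𝔭`, the `(-1)`-eigenspace of the involution on the Lie superalgebra of `G`. -/
def antiInvariants : Submodule k G.lie where
  carrier := {x | ∀ f : G.Fun, (x : Module.Dual k G.Fun) (θ.pullback f) =
    -(x : Module.Dual k G.Fun) f}
  add_mem' hx hy f := by simp only [Submodule.coe_add, LinearMap.add_apply, hx f, hy f, neg_add]
  zero_mem' f := by simp
  smul_mem' c x hx f := by simp only [Submodule.coe_smul, LinearMap.smul_apply, hx f, smul_neg]

/-- `K'` is the subgroup with `K'₀ = K₀` and with Lie superalgebra `𝔨' = 𝔨₀ ⊕ 𝔭₁`. -/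
def IsDual (K K' : G.ClosedSubgroup) : Prop :=
  K'.even = K.even ∧
    K'.lie.toSubmodule = (K.lie.toSubmodule ⊓ LieSuperalgebra.part (k := k) (L := G.lie) 0) ⊔
      (θ.antiInvariants ⊓ LieSuperalgebra.part (k := k) (L := G.lie) 1)

end Involution

/-! ### Modules over `K'` -/

namespace ClosedSubgroup

variable (K K' : G.ClosedSubgroup)

/-- The inclusion of the even part of the Lie superalgebra of `K'` into that of `G`. -/
def evenIncl : LieSuperalgebra.part (k := k) (L := K'.lie.toSubmodule) 0 →ₗ[k]
    LieSuperalgebra.part (k := k) (L := G.lie) 0 :=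
  K'.lie.toSubmodule.subtype.restrict (fun _ hx => hx)

/-- The action of the even part of the Lie superalgebra of `K'` on `Dist(G₀/K₀, eK₀)`. -/
def evenDistAct : LieSuperalgebra.part (k := k) (L := K'.lie.toSubmodule) 0 →ₗ[k]
    Module.End k K.even.Dist :=
  K.even.distAct ∘ₗ G.lieRestr ∘ₗ K'.evenIncl

/-- The distributions on `G/K` that are invariant under `K'`: those fixed by the points of
`K'₀ = K₀` and annihilated by the Lie superalgebra of `K'`. -/
def distInvariants : Submodule k K.Dist where
  carrier := {ψ | (∀ h : K.points, K.distTransl h ψ = ψ) ∧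
    ∀ x : K'.lie.toSubmodule, K.distAct (x : G.lie) ψ = 0}
  add_mem' := fun ⟨h1, h2⟩ ⟨h3, h4⟩ =>
    ⟨fun h => by rw [map_add, h1, h3], fun x => by rw [map_add, h2, h4, add_zero]⟩
  zero_mem' := ⟨fun h => map_zero _, fun x => map_zero _⟩
  smul_mem' c _ := fun ⟨h1, h2⟩ =>
    ⟨fun h => by rw [map_smul, h1], fun x => by rw [map_smul, h2, smul_zero]⟩

/-- The distributions on `G₀/K₀` that are invariant under `K₀`. -/
def evenDistInvariants : Submodule k K.even.Dist where
  carrier := {ψ | ∀ h : K.even.points, K.even.distTransl h ψ = ψ}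
  add_mem' h1 h2 h := by rw [map_add, h1, h2]
  zero_mem' h := map_zero _
  smul_mem' c _ h1 h := by rw [map_smul, h1]

/-- The adjoint action of a point of `K₀` on the odd part of the Lie superalgebra of `K`. -/
def adOdd (h : K.points) : Module.End k (LieSuperalgebra.part (k := k) (L := K.lie.toSubmodule) 1) :=
  (K.ad h).toLinearMap.restrict ((K.ad h).map_part 1)

/-- The endomorphism `f` of `V` induces the identity on the top exterior power of `V`. -/
def IsTopExteriorTrivial {V : Type*} [AddCommGroup V] [Module k V] (f : Module.End k V) : Prop :=
  ∀ ω : ⋀[k]^(Module.finrank k V) V, exteriorPower.map (Module.finrank k V) f ω = ω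

/-- The top exterior power of the odd part of the Lie superalgebra of `K` is a trivial
`K₀`-module. -/
def TopExteriorTrivial : Prop :=
  ∀ h : K.points, IsTopExteriorTrivial (K.adOdd h)

/-- The left ideal `U(𝔨) 𝔨₀` of the enveloping algebra of the Lie superalgebra `𝔨` of `K`. -/
def evenLeftIdeal : Submodule (LieSuperalgebra.U k K.lie.toSubmodule)
    (LieSuperalgebra.U k K.lie.toSubmodule) :=
  LieSuperalgebra.leftIdeal (LieSuperalgebra.part (k := k) (L := K.lie.toSubmodule) 0)

/-- The image of `v` in `U(𝔨) / U(𝔨) 𝔨₀` is a nonzero `K`-invariant, `𝔨` being the Lie superalgebra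
of `K`. -/
structure IsGhost (v : LieSuperalgebra.U k K.lie.toSubmodule) : Prop where
  ne_zero : v ∉ K.evenLeftIdeal
  lie_invariant : ∀ x : K.lie.toSubmodule, LieSuperalgebra.ι k x * v ∈ K.evenLeftIdeal
  group_invariant : ∀ h : K.points, LieSuperalgebra.U.map (K.ad h) v - v ∈ K.evenLeftIdeal

/-! ### The version with enveloping algebras -/

variable (G) in
/-- The even part `𝔤₀` of the Lie superalgebra of `G`. -/
abbrev lieEven : LieSubsuperalgebra k G.lie := LieSuperalgebra.even k G.lie

/-- `𝔨₀`, as a subspace of `𝔤₀`. -/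
def lieEvenSub : Submodule k (lieEven G).toSubmodule :=
  K.lie.toSubmodule.comap (lieEven G).toSubmodule.subtype

/-- The action of the even part of the Lie superalgebra of `K'` on `U(𝔤₀) / U(𝔤₀) 𝔨₀` by left
multiplication -/
def evenUAct : LieSuperalgebra.part (k := k) (L := K'.lie.toSubmodule) 0 →ₗ[k]
    Module.End k (LieSuperalgebra.UQuot (k := k) K.lieEvenSub) :=
  LieSuperalgebra.UQuot.act (k := k) K.lieEvenSub ∘ₗ K'.evenIncl

/-- The adjoint action of a point of `G₀` on `𝔤₀`. -/
def adEven (h : G.Fun →ₐ[k] k) :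
    LieSuperalgebra.Hom k (lieEven G).toSubmodule (lieEven G).toSubmodule :=
  (G.ad h).restrict (lieEven G) ((G.ad h).map_part 0)

/-- The adjoint action of a point of `K₀` on `U(𝔤) / U(𝔤) 𝔨`. -/
def adUQuot (h : K.points) (w : LieSuperalgebra.UQuot (k := k) K.lie.toSubmodule) :
    LieSuperalgebra.UQuot (k := k) K.lie.toSubmodule :=
  LieSuperalgebra.UQuot.map K.lie.toSubmodule (G.ad h) (K.ad_mem_lie h.2) w

/-- The adjoint action of a point of `K₀` on `U(𝔤₀) / U(𝔤₀) 𝔨₀`. -/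
def adEvenUQuot (h : K.points) (w : LieSuperalgebra.UQuot (k := k) K.lieEvenSub) :
    LieSuperalgebra.UQuot (k := k) K.lieEvenSub :=
  LieSuperalgebra.UQuot.map K.lieEvenSub (adEven h) (fun x hx => K.ad_mem_lie h.2 x hx) w

end ClosedSubgroup

end Supergroup

end

set_option linter.unusedSectionVars false

/-! Write X = Dist(G/K, eK), δ for the point distribution at eK, and V ⊆ X for the image of i_*.
Everything is compared inside X, viewed as a module over 𝔨'. Two odd elements anticommute up to an
even bracket, and V is stable under 𝔨₀, so X carries a filtration by the number of odd factors of 𝔨'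
applied to V. For a basis θ_i of 𝔭₁ its graded pieces are spanned by the θ_I V, where θ_I is an
ordered product. Hence Φ is bijective as soon as i_* is injective, the monomials θ_I are free over
V, and they exhaust X (`Ind.lift_bijective`). For |I| = |J|, the product of θ_J with the
complementary monomial of θ_I is ± the full product θ_top if I = J, and a shorter product otherwise.
So freeness reduces to one condition on θ_top, recorded in `OddFree`.

The geometry is first order at the base point. The torsor condition shows that I(K) is generated by
the maximal ideal 𝔪 of k[G/K]. Because θ acts by -1 on each θ(g) - g, one has I(K) ∩ 𝔪_e² ⊆ 𝔪_e
I(K), where 𝔪_e is the maximal ideal of k[G] at e. With flatness this shows that a function in 𝔪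
lying in 𝔪_e² already lies in 𝔪². So tangent vectors of G/K extend to G, and there are dual families
x_i in 𝔤 modulo 𝔨 and b_i in 𝔪 modulo 𝔪² (`exists_isDualBasis`). The same argument for G₀/K₀ shows
that restriction of functions is onto modulo every power of the maximal ideal, so i_* is injective
(`pushDist_injective`).

Freeness (`oddFree`): odd functions dual to the θ_i act on distributions like contractions and strip
the factors of θ_top one by one. Generation (`exists_mem_oddFil_dist`): the Euler operator ∑ x_i b_i
multiplies distributions of order n by n up to lower order, so in characteristic zero δ generates X.
As 𝔨 does not raise the order, the odd directions can be taken in 𝔭₁.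

For the enveloping algebras, the Euler relation is lifted to U𝔤/U𝔤𝔨. This proves that [u] ↦ uδ is an
isomorphism onto X (`uquotToDist_bijective`), likewise for G₀, and the second isomorphism follows
from the first.

For the invariants, M = U𝔨'/U𝔨'𝔨₀ embeds in X by [u] ↦ uδ. When Λ^top 𝔭₁ is trivial, the top
coefficient τ on M is K₀-invariant, hence killed by 𝔨₀, and it defines a nondegenerate pairing on M;
the vector dual to the augmentation is the invariant class of v (`exists_ghost`). Any such v has a
nonzero top coefficient c, so vz is cθ_top z up to shorter products, and an element without top part
that is killed by all odd elements vanishes. This gives the bijection on invariants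
(`ghost_mul_bijective`). -/

noncomputable section

/-! ### Representations of Lie superalgebras and filtrations -/

namespace LieSuperalgebra

section Rep

variable {k L X : Type*} [Field k] [AddCommGroup L] [Module k L] [LieSuperalgebra k L]
  [AddCommGroup X] [Module k X]

theorem exists_even_add_odd (x : L) : ∃ y ∈ part (k := k) (L := L) 0,
    ∃ z ∈ part (k := k) (L := L) 1, y + z = x :=
  Submodule.mem_sup.1 (by rw [(isCompl (k := k) (L := L)).sup_eq_top]; trivial)

theorem adjoin_range_ι : Algebra.adjoin k (Set.range (ι k : L → U k L)) = ⊤ := by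
  have h := congrArg (Subalgebra.map (U.proj k L)) (TensorAlgebra.adjoin_range_ι (R := k) (M := L))
  rw [AlgHom.map_adjoin, ← Set.range_comp, Algebra.map_top] at h
  rw [show (ι k : L → U k L) = U.proj k L ∘ TensorAlgebra.ι k from rfl, h]
  exact (AlgHom.range_eq_top _).2 (RingQuot.mkAlgHom_surjective k (Rel k L))

/-- The elements whose left multiplication preserves `p` contain the scalars and the image of `L`
and are closed under sums and products, so they are all of `U k L`. -/
theorem U.induction {p : U k L → Prop} (one : p 1) (mul : ∀ x u, p u → p (ι k x * u))
    (add : ∀ u v, p u → p v → p (u + v)) (smul : ∀ (c : k) u, p u → p (c • u)) (u : U k L) :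
    p u := by
  have h : ∀ a : U k L, ∀ u, p u → p (a * u) := fun a => by
    have ha : a ∈ Algebra.adjoin k (Set.range (ι k : L → U k L)) := by
      rw [adjoin_range_ι]; trivial
    induction ha using Algebra.adjoin_induction with
    | mem x hx => obtain ⟨y, rfl⟩ := hx; exact mul y
    | algebraMap c => intro u hu; rw [← Algebra.smul_def]; exact smul c u hu
    | add x y _ _ hx hy => intro u hu; rw [add_mul]; exact add _ _ (hx u hu) (hy u hu)
    | mul x y _ _ hx hy => intro u hu; rw [mul_assoc]; exact hx _ (hy u hu)
  simpa using h u 1 one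

/-- `r` is a representation of the Lie superalgebra `L` on the space `X`. -/
def IsRep (r : L →ₗ[k] Module.End k X) : Prop :=
  ∀ ⦃i j : ZMod 2⦄ ⦃x y : L⦄, x ∈ part (k := k) i → y ∈ part (k := k) j → ∀ v : X,
    r x (r y v) = koszulSign k i j • r y (r x v) + r (bracket (k := k) x y) v

variable {r : L →ₗ[k] Module.End k X}

/-- The action of the enveloping algebra on a representation. -/
def IsRep.lift (h : IsRep r) : U k L →ₐ[k] Module.End k X :=
  RingQuot.liftAlgHom k ⟨TensorAlgebra.lift k r, by
    rintro _ _ ⟨hx, hy⟩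
    refine LinearMap.ext fun v => ?_
    simp only [map_mul, map_add, map_smul, TensorAlgebra.lift_ι_apply]
    exact h hx hy v⟩

@[simp]
theorem IsRep.lift_ι (h : IsRep r) (x : L) : h.lift (ι k x) = r x := by
  have : h.lift (U.proj k L (TensorAlgebra.ι k x)) =
      TensorAlgebra.lift k r (TensorAlgebra.ι k x) :=
    RingQuot.liftAlgHom_mkAlgHom_apply k _ _ _
  rwa [TensorAlgebra.lift_ι_apply] at this

theorem IsRep.comp {M : Type*} [AddCommGroup M] [Module k M] [LieSuperalgebra k M]
    (h : IsRep r) (f : Hom k M L) : IsRep (r ∘ₗ f.toLinearMap) := by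
  intro i j x y hx hy v
  have := h (f.map_part _ _ hx) (f.map_part _ _ hy) v
  rwa [show bracket (k := k) (f.toFun x) (f.toFun y) = f.toLinearMap (bracket (k := k) x y) from
    (f.map_bracket x y).symm] at this

theorem IsRep.lift_map {M : Type*} [AddCommGroup M] [Module k M] [LieSuperalgebra k M]
    (h : IsRep r) (f : Hom k M L) (u : U k M) : h.lift (U.map f u) = (h.comp f).lift u := by
  induction u using U.induction with
  | one => simp
  | mul x u hu => rw [map_mul, map_mul, map_mul, hu, U.map_ι, lift_ι, lift_ι]; rfl
  | add u v hu hv => simp only [map_add, hu, hv]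
  | smul c u hu => simp only [map_smul, hu]

theorem isRep_act (s : Submodule k L) : IsRep (UQuot.act (k := k) s) := by
  intro i j x y hx hy v
  have h := congrArg (fun a : U k L => a • v) (ι_mul_ι hx hy)
  simp only [mul_smul, add_smul, smul_assoc] at h
  exact h

theorem isRep_ind_act {V : Type*} [AddCommGroup V] [Module k V]
    (ρ : part (k := k) (L := L) 0 →ₗ[k] Module.End k V) : IsRep (Ind.act ρ) := by
  intro i j x y hx hy v
  have h := congrArg (fun a : U k L => a • v) (ι_mul_ι hx hy)
  simp only [mul_smul, add_smul, smul_assoc] at h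
  exact h

/-- The filtration of `X` generated by `V` and the action of `S`, starting in degree `1`. -/
def fil (r : L →ₗ[k] Module.End k X) (S : Submodule k L) (V : Submodule k X) : ℕ → Submodule k X
  | 0 => ⊥
  | n + 1 => V ⊔ Submodule.map₂ r S (fil r S V n)

section fil

variable {S : Submodule k L} {V : Submodule k X}

theorem act_mem_fil {n : ℕ} {x : L} {v : X} (hx : x ∈ S) (hv : v ∈ fil r S V n) :
    r x v ∈ fil r S V (n + 1) :=
  Submodule.mem_sup_right (Submodule.apply_mem_map₂ r hx hv)

theorem le_fil_succ (n : ℕ) : V ≤ fil r S V (n + 1) := le_sup_left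

theorem fil_le_succ (n : ℕ) : fil r S V n ≤ fil r S V (n + 1) := by
  induction n with
  | zero => exact bot_le
  | succ n ih => exact sup_le_sup_left (Submodule.map₂_le_map₂_right ih) _

theorem fil_mono {m n : ℕ} (h : m ≤ n) : fil r S V m ≤ fil r S V n :=
  monotone_nat_of_le_succ fil_le_succ h

theorem fil_one : fil r S V 1 = V := by
  change V ⊔ Submodule.map₂ r S ⊥ = V
  rw [Submodule.map₂_bot_right, sup_bot_eq]

/-- An induction principle for the steps of the filtration. -/
theorem fil_succ_le {n : ℕ} {W : Submodule k X} (h : V ≤ W)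
    (h' : ∀ x ∈ S, ∀ v ∈ fil r S V n, r x v ∈ W) : fil r S V (n + 1) ≤ W :=
  sup_le h (Submodule.map₂_le.2 h')

theorem fil_map_le {Y : Type*} [AddCommGroup Y] [Module k Y] {q : L →ₗ[k] Module.End k Y}
    {W : Submodule k Y} (f : X →ₗ[k] Y) (hf : ∀ x ∈ S, ∀ v, f (r x v) = q x (f v))
    (hV : ∀ v ∈ V, f v ∈ W) (n : ℕ) : ∀ v ∈ fil r S V n, f v ∈ fil q S W n := by
  induction n with
  | zero => intro v hv; rw [(Submodule.mem_bot k).1 hv, map_zero]; exact Submodule.zero_mem _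
  | succ n ih =>
    refine fil_succ_le (W := (fil q S W (n + 1)).comap f) (fun v hv => ?_) fun x hx v hv => ?_
    · exact le_fil_succ n (hV v hv)
    · rw [Submodule.mem_comap, hf x hx]; exact act_mem_fil hx (ih v hv)

/-- Serves to show that the filtration exhausts a module generated by `V`: elements of `L` outside
`S` may act with any shift of the degree. -/
theorem exists_mem_fil_of_isRep (h : IsRep r) (hS : ∀ x : L, ∀ n, ∀ v ∈ fil r S V n,
    ∃ m, r x v ∈ fil r S V m) {v : X} (hv : ∃ n, v ∈ fil r S V n) (u : U k L) :
    ∃ n, h.lift u v ∈ fil r S V n := by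
  induction u using U.induction with
  | one => simpa using hv
  | mul x u hu =>
    obtain ⟨n, hn⟩ := hu
    obtain ⟨m, hm⟩ := hS x n _ hn
    exact ⟨m, by rwa [map_mul, IsRep.lift_ι]⟩
  | add u w hu hw =>
    obtain ⟨n, hn⟩ := hu
    obtain ⟨m, hm⟩ := hw
    exact ⟨n + m, by
      rw [map_add]
      exact Submodule.add_mem _ (fil_mono (Nat.le_add_right n m) hn)
        (fil_mono (Nat.le_add_left m n) hm)⟩
  | smul c u hu =>
    obtain ⟨n, hn⟩ := hu
    exact ⟨n, by rw [map_smul]; exact Submodule.smul_mem _ _ hn⟩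

/-- The product of the actions of the elements of a list. -/
def lprod (r : L →ₗ[k] Module.End k X) (l : List L) : Module.End k X := (l.map r).prod

@[simp] theorem lprod_nil (v : X) : lprod r [] v = v := rfl

@[simp] theorem lprod_cons (x : L) (l : List L) (v : X) :
    lprod r (x :: l) v = r x (lprod r l v) := by simp [lprod]

theorem lprod_append (l l' : List L) (v : X) :
    lprod r (l ++ l') v = lprod r l (lprod r l' v) := by simp [lprod]

theorem lprod_comm {Y : Type*} [AddCommGroup Y] [Module k Y] {q : L →ₗ[k] Module.End k Y}
    (f : X →ₗ[k] Y) (hf : ∀ x v, f (r x v) = q x (f v)) (l : List L) (v : X) :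
    f (lprod r l v) = lprod q l (f v) := by
  induction l with
  | nil => rfl
  | cons x l ih => rw [lprod_cons, lprod_cons, hf, ih]

theorem lprod_mem_fil {l : List L} (hl : ∀ x ∈ l, x ∈ S) {n : ℕ} {v : X}
    (hv : v ∈ fil r S V n) : lprod r l v ∈ fil r S V (n + l.length) := by
  induction l with
  | nil => exact hv
  | cons x l ih =>
    rw [lprod_cons]
    exact act_mem_fil (hl x (by simp)) (ih fun y hy => hl y (by simp [hy]))

theorem lprod_mem_fil_of_mem {l : List L} (hl : ∀ x ∈ l, x ∈ S) {v : X} (hv : v ∈ V) :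
    lprod r l v ∈ fil r S V (l.length + 1) := by
  rw [add_comm]
  exact lprod_mem_fil hl (fil_one.ge hv)

end fil

/-! ### The filtration by the odd part -/

section odd

variable {V : Submodule k X}

/-- The filtration by the odd part -/
abbrev oddFil (r : L →ₗ[k] Module.End k X) (V : Submodule k X) : ℕ → Submodule k X :=
  fil r (part (k := k) 1) V

/-- An even `y` moves through an odd `x` at the cost of the bracket of `y` and `x`, which is again
odd. So `y` travels down to `V` without lengthening the product. -/
theorem even_mem_oddFil (hr : IsRep r) (hV : ∀ y ∈ part (k := k) (L := L) 0, ∀ z ∈ V, r y z ∈ V)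
    {y : L} (hy : y ∈ part (k := k) 0) (n : ℕ) : ∀ v ∈ oddFil r V n, r y v ∈ oddFil r V n := by
  induction n with
  | zero => intro v hv; rw [(Submodule.mem_bot k).1 hv, map_zero]; exact Submodule.zero_mem _
  | succ n ih =>
    refine fil_succ_le (W := (oddFil r V (n + 1)).comap (r y)) (fun v hv => ?_) fun x hx v hv => ?_
    · exact le_fil_succ n (hV y hy v hv)
    · rw [Submodule.mem_comap, hr hy hx, koszulSign_zero_left, one_smul]
      have h := bracket_mem hy hx
      rw [zero_add] at h
      exact Submodule.add_mem _ (act_mem_fil hx (ih v hv)) (act_mem_fil h hv)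

/-- Exchanging two neighbouring odd factors costs a sign and a bracket, which is even and so
replaces two factors by none. Of the sign only its nonvanishing and its independence of `z` matter.
-/
theorem lprod_perm (hr : IsRep r) (hV : ∀ y ∈ part (k := k) (L := L) 0, ∀ z ∈ V, r y z ∈ V)
    {l l' : List L} (h : l.Perm l') (hl : ∀ x ∈ l, x ∈ part (k := k) 1) :
    ∃ ε : k, ε ≠ 0 ∧ ∀ z ∈ V, lprod r l z - ε • lprod r l' z ∈ oddFil r V l.length := by
  induction h with
  | nil => exact ⟨1, one_ne_zero, fun z _ => by simp⟩
  | cons x _ ih =>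
    obtain ⟨ε, h0, h⟩ := ih fun y hy => hl y (by simp [hy])
    refine ⟨ε, h0, fun z hz => ?_⟩
    have := act_mem_fil (hl x (by simp)) (h z hz)
    simpa using this
  | swap x y l =>
    refine ⟨-1, by simp, fun z hz => ?_⟩
    have hx := hl x (by simp)
    have hy := hl y (by simp)
    have hb : bracket (k := k) y x ∈ part (k := k) 0 := bracket_mem hy hx
    have h := even_mem_oddFil hr hV hb _ _
      (lprod_mem_fil_of_mem (r := r) (l := l) (fun y hy => hl y (by simp [hy])) hz)
    have e := hr hy hx (lprod r l z)
    rw [koszulSign_one_one] at e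
    simp only [lprod_cons, e, add_sub_cancel_left]
    exact fil_le_succ _ h
  | trans h1 h2 ih1 ih2 =>
    obtain ⟨ε, h0, h⟩ := ih1 hl
    obtain ⟨ε', h0', h'⟩ := ih2 fun y hy => hl y (h1.mem_iff.2 hy)
    refine ⟨ε * ε', mul_ne_zero h0 h0', fun z hz => ?_⟩
    have h2 := Submodule.smul_mem _ ε (h' z hz)
    rw [← h1.length_eq] at h2
    have := Submodule.add_mem _ (h z hz) h2
    rwa [smul_sub, smul_smul, sub_add_sub_cancel] at this

/-- Two equal factors are brought together at the front, where `2 a a` is the bracket of `a` with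
itself, an even element. -/
theorem lprod_of_not_nodup [CharZero k] (hr : IsRep r)
    (hV : ∀ y ∈ part (k := k) (L := L) 0, ∀ z ∈ V, r y z ∈ V) {l : List L}
    (hl : ∀ x ∈ l, x ∈ part (k := k) 1) (h : ¬ l.Nodup) {z : X} (hz : z ∈ V) :
    lprod r l z ∈ oddFil r V l.length := by
  obtain ⟨a, ha⟩ := List.exists_duplicate_iff_not_nodup.2 h
  obtain ⟨l', hp⟩ := (List.duplicate_iff_sublist.1 ha).exists_perm_append
  obtain ⟨ε, -, hε⟩ := lprod_perm hr hV hp hl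
  have ha1 := hl a (hp.mem_iff.2 (by simp))
  have hb : bracket (k := k) a a ∈ part (k := k) 0 := bracket_mem ha1 ha1
  have h1 := even_mem_oddFil hr hV hb _ _
    (lprod_mem_fil_of_mem (r := r) (l := l') (fun y hy => hl y (hp.mem_iff.2 (by simp [hy]))) hz)
  have e := hr ha1 ha1 (lprod r l' z)
  rw [koszulSign_one_one, neg_smul, one_smul, ← sub_eq_iff_eq_add', sub_neg_eq_add, ← two_smul k] at e
  rw [← e] at h1
  have h2 := (Submodule.smul_mem_iff _ (two_ne_zero' k)).1 h1
  have h3 := Submodule.smul_mem _ ε (fil_le_succ _ h2)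
  have hlen : l.length = l'.length + 1 + 1 := by simpa using hp.length_eq
  rw [← hlen] at h3
  have := Submodule.add_mem _ (hε z hz) h3
  simpa using this

/-- The product of the odd elements `θ i`, `i ∈ I`, in some order. -/
def mon {ι : Type*} (r : L →ₗ[k] Module.End k X) (θ : ι → L) (I : Finset ι) : Module.End k X :=
  lprod r (I.toList.map θ)

/-- `X` is a representation of `L`, `V ⊆ X` a subspace that is stable under the even part, the
family `θ` spans the odd part of `L`, and the product of all the `θ i` is injective on `V`, even
modulo products of fewer odd elements. -/
structure OddFree {ι : Type*} [Fintype ι] (r : L →ₗ[k] Module.End k X) (V : Submodule k X)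
    (θ : ι → L) : Prop where
  isRep : IsRep r
  even_mem : ∀ y ∈ part (k := k) (L := L) 0, ∀ z ∈ V, r y z ∈ V
  odd : ∀ i, θ i ∈ part (k := k) 1
  span : part (k := k) 1 ≤ Submodule.span k (Set.range θ)
  top : ∀ z ∈ V, mon r θ Finset.univ z ∈ oddFil r V (Fintype.card ι) → z = 0

section basis

variable {ι : Type*} {θ : ι → L}

theorem odd_of_mem_map (hθ : ∀ i, θ i ∈ part (k := k) 1) {l : List ι} :
    ∀ x ∈ l.map θ, x ∈ part (k := k) 1 := by
  intro x hx
  obtain ⟨i, -, rfl⟩ := List.mem_map.1 hx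
  exact hθ i

/-- A further odd factor may be taken to be some `θ a`. If `a ∈ I`, a factor is repeated and the
product drops; otherwise it can be reordered into the monomial of `insert a I`. -/
theorem oddFil_succ_le_mon [CharZero k] [Fintype ι] (hr : IsRep r)
    (hV : ∀ y ∈ part (k := k) (L := L) 0, ∀ z ∈ V, r y z ∈ V)
    (hθ : ∀ i, θ i ∈ part (k := k) 1) (hs : part (k := k) 1 ≤ Submodule.span k (Set.range θ))
    (j : ℕ) : oddFil r V (j + 1) ≤
      (⨆ I ∈ Finset.powersetCard j Finset.univ, V.map (mon r θ I)) ⊔ oddFil r V j := by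
  classical
  induction j with
  | zero =>
    rw [oddFil, fil_one]
    refine le_trans ?_ le_sup_left
    refine le_trans (fun z hz => ?_) (le_iSup₂ (∅ : Finset ι) (by simp))
    exact ⟨z, hz, by simp [mon]⟩
  | succ j ih =>
    refine fil_succ_le ((le_fil_succ j).trans le_sup_right) fun x hx v hv => ?_
    have key : ∀ a, oddFil r V (j + 1) ≤ Submodule.comap (r (θ a))
        ((⨆ I ∈ Finset.powersetCard (j + 1) Finset.univ, V.map (mon r θ I)) ⊔
          oddFil r V (j + 1)) := by
      intro a
      refine ih.trans (sup_le (iSup₂_le fun I hI => ?_) fun w hw => ?_)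
      · rintro _ ⟨z, hz, rfl⟩
        rw [Submodule.mem_comap, mon, ← lprod_cons, ← List.map_cons]
        have hc := (Finset.mem_powersetCard.1 hI).2
        have hlen : ((a :: I.toList).map θ).length = j + 1 := by simp [hc]
        by_cases ha : a ∈ I
        · refine Submodule.mem_sup_right ?_
          rw [← hlen]
          refine lprod_of_not_nodup hr hV (odd_of_mem_map hθ) (fun h => ?_) hz
          have := h.of_map
          simp [ha] at this
        · have hp : ((a :: I.toList).map θ).Perm ((insert a I).toList.map θ) :=
            (Finset.toList_insert ha).symm.map θ
          obtain ⟨ε, -, hε⟩ := lprod_perm hr hV hp (odd_of_mem_map hθ)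
          have h1 := hε z hz
          rw [hlen] at h1
          rw [← sub_add_cancel (lprod r _ z) (ε • lprod r ((insert a I).toList.map θ) z)]
          refine Submodule.add_mem _ (Submodule.mem_sup_right h1)
            (Submodule.smul_mem _ _ (Submodule.mem_sup_left ?_))
          refine Submodule.mem_iSup_of_mem (insert a I) (Submodule.mem_iSup_of_mem ?_ ⟨z, hz, rfl⟩)
          rw [Finset.mem_powersetCard]
          exact ⟨Finset.subset_univ _, by rw [Finset.card_insert_of_notMem ha, hc]⟩
      · exact Submodule.mem_sup_right (act_mem_fil (hθ a) hw)
    have hx' := hs hx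
    clear hx
    induction hx' using Submodule.span_induction with
    | mem x h => obtain ⟨a, rfl⟩ := h; exact key a hv
    | zero => rw [map_zero, LinearMap.zero_apply]; exact Submodule.zero_mem _
    | add x y _ _ h1 h2 => rw [map_add, LinearMap.add_apply]; exact Submodule.add_mem _ h1 h2
    | smul c x _ h1 => rw [map_smul, LinearMap.smul_apply]; exact Submodule.smul_mem _ _ h1

/-- Leading coefficients with respect to the monomials in the `θ i`. Their uniqueness is what
`OddFree` adds. -/
theorem exists_sum_mon [CharZero k] [Fintype ι] (hr : IsRep r)
    (hV : ∀ y ∈ part (k := k) (L := L) 0, ∀ z ∈ V, r y z ∈ V)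
    (hθ : ∀ i, θ i ∈ part (k := k) 1) (hs : part (k := k) 1 ≤ Submodule.span k (Set.range θ))
    {j : ℕ} {x : X} (hx : x ∈ oddFil r V (j + 1)) : ∃ z : Finset ι → X, (∀ I, z I ∈ V) ∧
      x - ∑ I ∈ Finset.powersetCard j Finset.univ, mon r θ I (z I) ∈ oddFil r V j := by
  classical
  obtain ⟨a, ha, b, hb, rfl⟩ := Submodule.mem_sup.1 (oddFil_succ_le_mon hr hV hθ hs j hx)
  obtain ⟨μ, rfl⟩ := (Submodule.mem_iSup_finset_iff_exists_sum _ _).1 ha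
  choose z hz hz' using fun I => (μ I).2
  refine ⟨z, hz, ?_⟩
  simpa only [hz', add_sub_cancel_left] using hb

namespace OddFree

variable [Fintype ι] [CharZero k] (h : OddFree r V θ)
include h

/-- Distinct sets of the same size: `J` meets the complement of `I`, so some factor occurs twice. -/
theorem mon_compl_of_ne [DecidableEq ι] {j : ℕ} {I J : Finset ι}
    (hI : I ∈ Finset.powersetCard j Finset.univ) (hJ : J ∈ Finset.powersetCard j Finset.univ)
    (hne : I ≠ J) {z : X} (hz : z ∈ V) :
    mon r θ Iᶜ (mon r θ J z) ∈ oddFil r V (Fintype.card ι) := by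
  have hI' := (Finset.mem_powersetCard.1 hI).2
  have hJ' := (Finset.mem_powersetCard.1 hJ).2
  have hlen : ((Iᶜ.toList ++ J.toList).map θ).length = Fintype.card ι := by
    have := Finset.card_le_univ I
    simp only [List.map_append, List.length_append, List.length_map, Finset.length_toList,
      Finset.card_compl]
    omega
  rw [mon, mon, ← lprod_append, ← List.map_append, ← hlen]
  refine lprod_of_not_nodup h.isRep h.even_mem (odd_of_mem_map h.odd) (fun hn => hne ?_) hz
  have hd := (List.nodup_append.1 hn.of_map).2.2
  refine (Finset.eq_of_subset_of_card_le (fun a ha => ?_) (by omega)).symm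
  by_contra hc
  exact hd a (by simpa using hc) a (by simpa using ha) rfl

theorem mon_compl_self [DecidableEq ι] (I : Finset ι) : ∃ ε : k, ε ≠ 0 ∧ ∀ z ∈ V,
    mon r θ Iᶜ (mon r θ I z) - ε • mon r θ Finset.univ z ∈ oddFil r V (Fintype.card ι) := by
  have hp : (Iᶜ.toList ++ I.toList).Perm (Finset.univ : Finset ι).toList := by
    rw [List.perm_ext_iff_of_nodup]
    · intro a; simpa using (em (a ∈ I)).symm
    · rw [List.nodup_append]
      refine ⟨Finset.nodup_toList _, Finset.nodup_toList _, ?_⟩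
      rintro a ha b hb rfl
      simp at ha hb
      exact ha hb
    · exact Finset.nodup_toList _
  obtain ⟨ε, h0, hε⟩ := lprod_perm h.isRep h.even_mem (hp.map θ) (odd_of_mem_map h.odd)
  refine ⟨ε, h0, fun z hz => ?_⟩
  have := hε z hz
  rw [(hp.map θ).length_eq, List.map_append, lprod_append, List.length_map, Finset.length_toList,
    Finset.card_univ] at this
  exact this

/-- Multiplication by the monomial of `Iᶜ` isolates the coefficient of the monomial of `I`, as in
the perfect pairing of complementary exterior powers; the condition `top` then makes this
coefficient vanish. -/
theorem sum_mon_eq_zero [DecidableEq ι] {j : ℕ} {z : Finset ι → X} (hz : ∀ I, z I ∈ V)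
    (hs : ∀ I ∈ Finset.powersetCard j (Finset.univ : Finset ι),
      mon r θ Iᶜ (∑ J ∈ Finset.powersetCard j Finset.univ, mon r θ J (z J)) ∈
        oddFil r V (Fintype.card ι)) :
    ∀ I ∈ Finset.powersetCard j (Finset.univ : Finset ι), z I = 0 := by
  intro I hI
  obtain ⟨ε, h0, hε⟩ := h.mon_compl_self I
  have h1 := hs I hI
  rw [map_sum, ← Finset.add_sum_erase _ _ hI] at h1
  have h2 : ∑ J ∈ (Finset.powersetCard j Finset.univ).erase I, mon r θ Iᶜ (mon r θ J (z J)) ∈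
      oddFil r V (Fintype.card ι) := Submodule.sum_mem _ fun J hJ =>
    h.mon_compl_of_ne hI (Finset.mem_of_mem_erase hJ) (Finset.ne_of_mem_erase hJ).symm (hz J)
  have h3 := Submodule.sub_mem _ ((Submodule.add_mem_iff_left _ h2).1 h1) (hε _ (hz I))
  rw [sub_sub_cancel] at h3
  exact h.top _ (hz I) ((Submodule.smul_mem_iff _ h0).1 h3)

/-- Leading coefficients in degree `j` are detected by products of complementary length. If `j`
exceeds the number of the `θ i`, there are neither monomials of degree `j` nor complementary
products, and `hl` is empty. -/
theorem mem_oddFil_of_lprod {j : ℕ} {x : X} (hx : x ∈ oddFil r V (j + 1))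
    (hl : ∀ l : List L, (∀ y ∈ l, y ∈ part (k := k) 1) → l.length + j = Fintype.card ι →
      lprod r l x ∈ oddFil r V (Fintype.card ι)) : x ∈ oddFil r V j := by
  classical
  obtain ⟨z, hz, hd⟩ := exists_sum_mon h.isRep h.even_mem h.odd h.span hx
  have h0 := h.sum_mon_eq_zero hz (j := j) fun I hI => by
    have hI' := (Finset.mem_powersetCard.1 hI).2
    have hc : (Iᶜ.toList.map θ).length + j = Fintype.card ι := by
      have := Finset.card_le_univ I
      simp only [List.length_map, Finset.length_toList, Finset.card_compl]
      omega
    have h1 := lprod_mem_fil (odd_of_mem_map (l := Iᶜ.toList) h.odd) hd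
    rw [add_comm, hc] at h1
    have h2 := Submodule.sub_mem _ (hl _ (odd_of_mem_map h.odd) hc) h1
    rwa [← map_sub, sub_sub_cancel] at h2
  rwa [Finset.sum_eq_zero (fun I hI => by rw [h0 I hI, map_zero]), sub_zero] at hd

/-- An element of `X` vanishes if its multiples by products of odd elements have no top part. -/
theorem eq_zero_of_lprod {n : ℕ} {x : X} (hx : x ∈ oddFil r V n)
    (hl : ∀ l : List L, (∀ y ∈ l, y ∈ part (k := k) 1) →
      lprod r l x ∈ oddFil r V (Fintype.card ι)) : x = 0 := by
  induction n with
  | zero => exact (Submodule.mem_bot k).1 hx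
  | succ n ih => exact ih (h.mem_oddFil_of_lprod hx fun l h1 _ => hl l h1)

/-- In a nonempty product the last factor acts first and kills `x`; the empty product is covered by
`hx`. -/
theorem eq_zero_of_odd {x : X} (hx : x ∈ oddFil r V (Fintype.card ι))
    (h1 : ∀ y ∈ part (k := k) (L := L) 1, r y x = 0) : x = 0 := by
  refine h.eq_zero_of_lprod hx fun l hl => ?_
  rcases List.eq_nil_or_concat l with rfl | ⟨l', a, rfl⟩
  · exact hx
  · rw [List.concat_eq_append, lprod_append, lprod_cons, lprod_nil, h1 a (hl a (by simp)), map_zero]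
    exact Submodule.zero_mem _

/-- More factors than there are `θ i` force a repetition, so the filtration is constant from here
on. -/
theorem mem_oddFil_card_succ {n : ℕ} {x : X} (hx : x ∈ oddFil r V n) :
    x ∈ oddFil r V (Fintype.card ι + 1) := by
  induction n with
  | zero => rw [(Submodule.mem_bot k).1 hx]; exact Submodule.zero_mem _
  | succ n ih =>
    rcases Nat.lt_or_ge (Fintype.card ι) n with hn | hn
    · exact ih (h.mem_oddFil_of_lprod hx fun l _ hc => by omega)
    · exact fil_mono (Nat.succ_le_succ hn) hx

/-- Only one set of indices has full size, so the leading term in top degree is a single monomial.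
-/
theorem exists_top {n : ℕ} {x : X} (hx : x ∈ oddFil r V n) :
    ∃ z ∈ V, x - mon r θ Finset.univ z ∈ oddFil r V (Fintype.card ι) := by
  obtain ⟨z, hz, hd⟩ := exists_sum_mon h.isRep h.even_mem h.odd h.span (h.mem_oddFil_card_succ hx)
  refine ⟨z Finset.univ, hz _, ?_⟩
  rwa [← Finset.card_univ, Finset.powersetCard_self, Finset.sum_singleton] at hd

end OddFree

end basis

end odd

/-! ### Maps out of induced modules -/

section Ind

variable {V : Type*} [AddCommGroup V] [Module k V]
  {ρ : part (k := k) (L := L) 0 →ₗ[k] Module.End k V}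

theorem Ind.mk_add (u u' : U k L) (v : V) : Ind.mk ρ (u + u') v = Ind.mk ρ u v + Ind.mk ρ u' v :=
  (congrArg (indRel ρ).mkQ (TensorProduct.add_tmul u u' v)).trans (map_add _ _ _)

theorem Ind.mk_smul (c : k) (u : U k L) (v : V) : Ind.mk ρ (c • u) v = c • Ind.mk ρ u v := rfl

theorem Ind.smul_mk (a u : U k L) (v : V) : a • Ind.mk ρ u v = Ind.mk ρ (a * u) v := rfl

theorem Ind.mk_even (x : part (k := k) (L := L) 0) (v : V) :
    Ind.mk ρ (ι k (x : L)) v = Ind.mk ρ 1 (ρ x v) :=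
  (Submodule.Quotient.eq (indRel ρ)).2 (Submodule.subset_span ⟨x, v, rfl⟩)

/-- `v ↦ 1 ⊗ v` -/
def Ind.incl (ρ : part (k := k) (L := L) 0 →ₗ[k] Module.End k V) : V →ₗ[k] Ind ρ where
  toFun v := Ind.mk ρ 1 v
  map_add' v w := (congrArg (indRel ρ).mkQ (TensorProduct.tmul_add 1 v w)).trans (map_add _ _ _)
  map_smul' c v := by
    have : (1 : U k L) ⊗ₜ[k] (c • v) = (c • (1 : U k L)) ⊗ₜ v := (TensorProduct.smul_tmul _ _ _).symm
    rw [Ind.mk, this]; rfl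

theorem Ind.induction {p : Ind ρ → Prop} (mk : ∀ u v, p (Ind.mk ρ u v))
    (add : ∀ x y, p x → p y → p (x + y)) (x : Ind ρ) : p x := by
  obtain ⟨t, rfl⟩ := (indRel ρ).mkQ_surjective x
  induction t with
  | zero => simpa [Ind.mk] using mk 0 0
  | tmul u v => exact mk u v
  | add x y hx hy => rw [map_add]; exact add _ _ hx hy

/-- The map of the induced module to `X` induced by a map `V → X` of representations of the even
part. -/
def Ind.lift (hr : IsRep r) (j : V →ₗ[k] X)
    (hj : ∀ (x : part (k := k) (L := L) 0) (v : V), j (ρ x v) = r (x : L) (j v)) :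
    Ind ρ →ₗ[k] X :=
  let π : U k L ⊗[k] V →ₗ[k] X := TensorProduct.lift (j.lcomp k X ∘ₗ hr.lift.toLinearMap)
  have hπ : ∀ (a : U k L) (t : U k L ⊗[k] V), π (a • t) = hr.lift a (π t) := fun a t => by
    induction t with
    | zero => simp
    | tmul u v => simp [π, TensorProduct.smul_tmul']
    | add x y hx hy => rw [smul_add, map_add, hx, hy, map_add, map_add]
  ((indRel ρ).restrictScalars k).liftQ π (fun t ht => by
    have ht' : t ∈ indRel ρ := ht
    unfold indRel at ht'
    induction ht' using Submodule.span_induction with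
    | mem t h =>
      obtain ⟨x, v, rfl⟩ := h
      rw [LinearMap.mem_ker, map_sub, sub_eq_zero]
      simp [π, hj]
    | zero => exact Submodule.zero_mem _
    | add x y hx hy h1 h2 => exact Submodule.add_mem _ (h1 hx) (h2 hy)
    | smul a x hx h1 => rw [LinearMap.mem_ker, hπ, LinearMap.mem_ker.1 (h1 hx), map_zero]) ∘ₗ
  (Submodule.Quotient.restrictScalarsEquiv k (indRel ρ)).symm.toLinearMap

variable {hr : IsRep r} {j : V →ₗ[k] X}
    {hj : ∀ (x : part (k := k) (L := L) 0) (v : V), j (ρ x v) = r (x : L) (j v)}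

@[simp]
theorem Ind.lift_mk (u : U k L) (v : V) : Ind.lift hr j hj (Ind.mk ρ u v) = hr.lift u (j v) := rfl

theorem Ind.lift_act (x : L) (w : Ind ρ) :
    Ind.lift hr j hj (Ind.act ρ x w) = r x (Ind.lift hr j hj w) := by
  induction w using Ind.induction with
  | mk u v =>
    change Ind.lift hr j hj (ι k x • Ind.mk ρ u v) = _
    rw [Ind.smul_mk, Ind.lift_mk, Ind.lift_mk, map_mul, IsRep.lift_ι]; rfl
  | add x y hx hy => simp only [map_add, hx, hy]

theorem Ind.even_mem : ∀ y ∈ part (k := k) (L := L) 0, ∀ z ∈ LinearMap.range (Ind.incl ρ),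
    Ind.act ρ y z ∈ LinearMap.range (Ind.incl ρ) := by
  rintro y hy _ ⟨v, rfl⟩
  refine ⟨ρ ⟨y, hy⟩ v, ?_⟩
  refine (Ind.mk_even ⟨y, hy⟩ v).symm.trans ?_
  change _ = ι k y • Ind.mk ρ 1 v
  rw [Ind.smul_mk, mul_one]

theorem Ind.exists_mem_oddFil (w : Ind ρ) :
    ∃ n, w ∈ oddFil (Ind.act ρ) (LinearMap.range (Ind.incl ρ)) n := by
  induction w using Ind.induction with
  | mk u v =>
    have hm : ∀ a : U k L, (isRep_ind_act ρ).lift a (Ind.incl ρ v) = Ind.mk ρ a v := by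
      intro a
      induction a using U.induction with
      | one => rw [map_one]; rfl
      | mul x a ha => rw [map_mul, Module.End.mul_apply, ha, IsRep.lift_ι]; rfl
      | add a b ha hb => rw [map_add, LinearMap.add_apply, ha, hb, Ind.mk_add]
      | smul c a ha => rw [map_smul, LinearMap.smul_apply, ha, Ind.mk_smul]
    rw [← hm]
    refine exists_mem_fil_of_isRep _ (fun x n v hv => ?_) ⟨1, by rw [fil_one]; exact ⟨v, rfl⟩⟩ u
    obtain ⟨y, hy, z, hz, rfl⟩ := exists_even_add_odd (k := k) x
    refine ⟨n + 1, ?_⟩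
    rw [map_add, LinearMap.add_apply]
    exact Submodule.add_mem _
      (fil_le_succ n (even_mem_oddFil (isRep_ind_act ρ) Ind.even_mem hy n v hv)) (act_mem_fil hz hv)
  | add x y hx hy =>
    obtain ⟨n, hn⟩ := hx
    obtain ⟨m, hm⟩ := hy
    exact ⟨n + m, Submodule.add_mem _ (fil_mono (Nat.le_add_right n m) hn)
        (fil_mono (Nat.le_add_left m n) hm)⟩

/-- Linear independence is imported from `X`: the leading coefficients of an element of the kernel
become leading coefficients of `0` in `X`, vanish there by `sum_mon_eq_zero`, and vanish in the
induced module because `j` is injective. So the element descends through the filtration to `0`.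
Nothing has to be known beforehand about the size of the induced module. -/
theorem Ind.lift_bijective {κ : Type*} [Fintype κ] [CharZero k] {θ : κ → L}
    (hinj : Function.Injective j) (h : OddFree r (LinearMap.range j) θ)
    (hX : ∀ x, ∃ n, x ∈ oddFil r (LinearMap.range j) n) :
    Function.Bijective (Ind.lift (ρ := ρ) hr j hj) := by
  classical
  have hincl : ∀ v, Ind.lift hr j hj (Ind.incl ρ v) = j v := fun v => by
    change Ind.lift hr j hj (Ind.mk ρ 1 v) = j v
    rw [Ind.lift_mk, map_one]; rfl
  constructor
  · rw [injective_iff_map_eq_zero]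
    intro x hx
    obtain ⟨n, hn⟩ := Ind.exists_mem_oddFil x
    induction n with
    | zero => exact (Submodule.mem_bot k).1 hn
    | succ n ih =>
      refine ih ?_
      obtain ⟨z, hz, hd⟩ := exists_sum_mon (isRep_ind_act ρ) Ind.even_mem h.odd h.span hn
      choose v hv using hz
      have h1 := fil_map_le (Ind.lift hr j hj) (fun x _ => Ind.lift_act x)
        (W := LinearMap.range j) (by rintro _ ⟨v, rfl⟩; exact ⟨v, (hincl v).symm⟩) n _ hd
      rw [map_sub, hx, zero_sub, Submodule.neg_mem_iff, map_sum] at h1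
      have hm : ∀ I, Ind.lift hr j hj (mon (Ind.act ρ) θ I (z I)) = mon r θ I (j (v I)) := by
        intro I
        rw [mon, mon, lprod_comm _ Ind.lift_act, ← hv, hincl]
      simp only [hm] at h1
      have h0 := h.sum_mon_eq_zero (z := fun I => j (v I)) (fun I => ⟨_, rfl⟩) (j := n)
        fun I hI => by
          have hI' := (Finset.mem_powersetCard.1 hI).2
          -- The remainder is a product of fewer than `n` factors; with the complementary monomial
          -- it stays below the top degree.
          have h2 := lprod_mem_fil (odd_of_mem_map (l := Iᶜ.toList) h.odd) h1
          have hc : n + (Iᶜ.toList.map θ).length = Fintype.card κ := by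
            have := Finset.card_le_univ I
            simp only [List.length_map, Finset.length_toList, Finset.card_compl]
            omega
          rwa [hc] at h2
      rwa [Finset.sum_eq_zero (fun I hI => by
        rw [← hv, hinj ((h0 I hI).trans (map_zero j).symm), map_zero, map_zero]), sub_zero] at hd
  · rw [← LinearMap.range_eq_top, eq_top_iff]
    intro x _
    obtain ⟨n, hn⟩ := hX x
    induction n generalizing x with
    | zero => rw [(Submodule.mem_bot k).1 hn]; exact Submodule.zero_mem _
    | succ n ih =>
      refine fil_succ_le ?_ (fun y _ v hv => ?_) hn
      · rintro _ ⟨v, rfl⟩; exact ⟨_, hincl v⟩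
      · obtain ⟨w, rfl⟩ := ih trivial hv
        exact ⟨_, Ind.lift_act y w⟩

end Ind

end Rep

end LieSuperalgebra

/-! ### Maps out of the quotients `U(L) / U(L) s`. -/

namespace LieSuperalgebra

section UQuotLift

variable {k L X : Type*} [Field k] [AddCommGroup L] [Module k L] [LieSuperalgebra k L]
  [AddCommGroup X] [Module k X] {r : L →ₗ[k] Module.End k X} {s : Submodule k L}

theorem IsRep.lift_leftIdeal (hr : IsRep r) {z : X} (hz : ∀ x ∈ s, r x z = 0) {u : U k L}
    (hu : u ∈ leftIdeal s) : hr.lift u z = 0 := by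
  unfold leftIdeal at hu
  induction hu using Submodule.span_induction with
  | mem u h => obtain ⟨x, hx, rfl⟩ := h; rw [lift_ι, hz x hx]
  | zero => rw [map_zero, LinearMap.zero_apply]
  | add u v _ _ hu hv => rw [map_add, LinearMap.add_apply, hu, hv, add_zero]
  | smul a u _ hu => rw [smul_eq_mul, map_mul, Module.End.mul_apply, hu, map_zero]

/-- The map `U(L) / U(L) s → X`, `[u] ↦ u z`, for a vector `z` annihilated by `s`. -/
def UQuot.lift (hr : IsRep r) (z : X) (hz : ∀ x ∈ s, r x z = 0) : UQuot s →ₗ[k] X :=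
  ((leftIdeal s).restrictScalars k).liftQ ((LinearMap.applyₗ z) ∘ₗ hr.lift.toLinearMap)
    (fun _ hu => hr.lift_leftIdeal hz hu) ∘ₗ
  (Submodule.Quotient.restrictScalarsEquiv k (leftIdeal s)).symm.toLinearMap

variable {hr : IsRep r} {z : X} {hz : ∀ x ∈ s, r x z = 0}

@[simp]
theorem UQuot.lift_mk (u : U k L) : UQuot.lift hr z hz (UQuot.mk s u) = hr.lift u z := rfl

theorem UQuot.mk_surjective : Function.Surjective (UQuot.mk s) := (leftIdeal s).mkQ_surjective

theorem UQuot.mk_eq_zero {u : U k L} : UQuot.mk s u = 0 ↔ u ∈ leftIdeal s :=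
  Submodule.Quotient.mk_eq_zero _

theorem UQuot.mk_eq_mk {u v : U k L} : UQuot.mk s u = UQuot.mk s v ↔ u - v ∈ leftIdeal s :=
  Submodule.Quotient.eq _

theorem UQuot.act_mk (x : L) (u : U k L) :
    UQuot.act s x (UQuot.mk s u) = UQuot.mk s (ι k x * u) := rfl

theorem UQuot.mk_add (u v : U k L) : UQuot.mk s (u + v) = UQuot.mk s u + UQuot.mk s v :=
  map_add _ _ _

theorem UQuot.mk_smul (c : k) (u : U k L) : UQuot.mk s (c • u) = c • UQuot.mk s u := rfl

theorem UQuot.lift_act (x : L) (w : UQuot s) :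
    UQuot.lift hr z hz (UQuot.act s x w) = r x (UQuot.lift hr z hz w) := by
  obtain ⟨u, rfl⟩ := UQuot.mk_surjective w
  rw [UQuot.act_mk, UQuot.lift_mk, UQuot.lift_mk, map_mul, IsRep.lift_ι]; rfl

theorem UQuot.act_lift_mk (a u : U k L) :
    (isRep_act s).lift a (UQuot.mk s u) = UQuot.mk s (a * u) := by
  induction a using U.induction with
  | one => rw [map_one, one_mul]; rfl
  | mul x a ha => rw [map_mul, Module.End.mul_apply, ha, IsRep.lift_ι, UQuot.act_mk, mul_assoc]
  | add a b ha hb => rw [map_add, LinearMap.add_apply, ha, hb, add_mul, UQuot.mk_add]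
  | smul c a ha => rw [map_smul, LinearMap.smul_apply, ha, smul_mul_assoc, UQuot.mk_smul]

theorem UQuot.act_lift_one (u : U k L) : (isRep_act s).lift u (UQuot.mk s 1) = UQuot.mk s u := by
  rw [UQuot.act_lift_mk, mul_one]

theorem UQuot.act_one {x : L} (hx : x ∈ s) : UQuot.act s x (UQuot.mk s 1) = 0 := by
  rw [UQuot.act_mk, mul_one, UQuot.mk_eq_zero]
  exact Submodule.subset_span ⟨x, hx, rfl⟩

/-- The endomorphism of `U(L) / U(L) s` induced by an endomorphism of `L`, as a linear map. -/
def UQuot.mapLinear (a : Hom k L L) (hs : ∀ x ∈ s, a.toLinearMap x ∈ s) : Module.End k (UQuot s) :=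
  UQuot.lift ((isRep_act s).comp a) (UQuot.mk s 1) fun x hx => UQuot.act_one (hs x hx)

theorem UQuot.mapLinear_mk (a : Hom k L L) (hs : ∀ x ∈ s, a.toLinearMap x ∈ s) (u : U k L) :
    UQuot.mapLinear a hs (UQuot.mk s u) = UQuot.mk s (U.map a u) := by
  rw [UQuot.mapLinear, UQuot.lift_mk, ← IsRep.lift_map (isRep_act s), UQuot.act_lift_one]

theorem UQuot.mapLinear_act (a : Hom k L L) (hs : ∀ x ∈ s, a.toLinearMap x ∈ s) (x : L)
    (w : UQuot s) : UQuot.mapLinear a hs (UQuot.act s x w) =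
      UQuot.act s (a.toLinearMap x) (UQuot.mapLinear a hs w) := by
  rw [UQuot.mapLinear, UQuot.lift_act]; rfl

end UQuotLift

/-! ### Compatible group actions and the top exterior power of the odd part. -/

section Equivariance

variable {k L X : Type*} [Field k] [AddCommGroup L] [Module k L] [LieSuperalgebra k L]
  [AddCommGroup X] [Module k X] {r : L →ₗ[k] Module.End k X} {V : Submodule k X}

theorem IsRep.map_lift {M Y : Type*} [AddCommGroup M] [Module k M] [LieSuperalgebra k M]
    [AddCommGroup Y] [Module k Y] {q : M →ₗ[k] Module.End k Y} (hr : IsRep r) (hq : IsRep q)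
    {a : Hom k L M} {A : X →ₗ[k] Y} (hA : ∀ x v, A (r x v) = q (a.toLinearMap x) (A v))
    (u : U k L) (v : X) : A (hr.lift u v) = hq.lift (U.map a u) (A v) := by
  induction u using U.induction with
  | one => simp
  | mul x u hu =>
    rw [map_mul, map_mul, map_mul, Module.End.mul_apply, Module.End.mul_apply, lift_ι, hA, hu,
      U.map_ι, lift_ι]
  | add u v hu hv => simp only [map_add, LinearMap.add_apply, hu, hv]
  | smul c u hu => simp only [map_smul, LinearMap.smul_apply, hu]

theorem IsRep.apply_lift (hr : IsRep r) {a : Hom k L L} {A : Module.End k X}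
    (hA : ∀ x v, A (r x v) = r (a.toLinearMap x) (A v)) (u : U k L) (v : X) :
    A (hr.lift u v) = hr.lift (U.map a u) (A v) :=
  hr.map_lift hr hA u v

theorem apply_mem_oddFil {a : Hom k L L} {A : Module.End k X}
    (hA : ∀ x v, A (r x v) = r (a.toLinearMap x) (A v)) (hV : ∀ z ∈ V, A z ∈ V) (n : ℕ) :
    ∀ v ∈ oddFil r V n, A v ∈ oddFil r V n := by
  induction n with
  | zero => intro v hv; rw [(Submodule.mem_bot k).1 hv, map_zero]; exact Submodule.zero_mem _
  | succ n ih =>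
    refine fil_succ_le (W := (oddFil r V (n + 1)).comap A) (fun v hv => ?_) fun x hx v hv => ?_
    · exact le_fil_succ n (hV v hv)
    · rw [Submodule.mem_comap, hA]; exact act_mem_fil (a.map_part 1 x hx) (ih v hv)

theorem apply_lprod {a : Hom k L L} {A : Module.End k X}
    (hA : ∀ x v, A (r x v) = r (a.toLinearMap x) (A v)) (l : List L) (v : X) :
    A (lprod r l v) = lprod r (l.map a.toLinearMap) (A v) := by
  induction l with
  | nil => rfl
  | cons x l ih => rw [lprod_cons, List.map_cons, lprod_cons, hA, ih]

/-- The restriction of an endomorphism to the odd part. -/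
def Hom.odd (a : Hom k L L) : Module.End k (part (k := k) (L := L) 1) :=
  a.toLinearMap.restrict (a.map_part 1)

/-- The product of `n` odd elements applied to `z ∈ V`, modulo products of fewer odd elements. -/
def oddAlternating [CharZero k] (hr : IsRep r)
    (hV : ∀ y ∈ part (k := k) (L := L) 0, ∀ z ∈ V, r y z ∈ V) (n : ℕ) (z : V) :
    (part (k := k) (L := L) 1) [⋀^Fin n]→ₗ[k] (X ⧸ oddFil r V n) where
  toMultilinearMap := ((oddFil r V n).mkQ ∘ₗ LinearMap.applyₗ (z : X)).compMultilinearMap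
    ((MultilinearMap.mkPiAlgebraFin k n (Module.End k X)).compLinearMap
      fun _ => r ∘ₗ (part (k := k) 1).subtype)
  map_eq_zero_of_eq' v i j hv hij := by
    have h : ¬ (List.ofFn fun i => (v i : L)).Nodup := fun h =>
      hij (List.nodup_ofFn.1 h (congrArg Subtype.val hv))
    have hl : ∀ x ∈ List.ofFn fun i => (v i : L), x ∈ part (k := k) 1 := by
      intro x hx
      obtain ⟨i, rfl⟩ := List.mem_ofFn.1 hx
      exact (v i).2
    have := lprod_of_not_nodup hr hV hl h z.2
    rw [List.length_ofFn, lprod, List.map_ofFn] at this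
    exact (Submodule.Quotient.mk_eq_zero _).2 this

theorem oddAlternating_apply [CharZero k] (hr : IsRep r)
    (hV : ∀ y ∈ part (k := k) (L := L) 0, ∀ z ∈ V, r y z ∈ V) (n : ℕ) (z : V)
    (v : Fin n → part (k := k) (L := L) 1) : oddAlternating hr hV n z v =
      (oddFil r V n).mkQ (lprod r (List.ofFn fun i => (v i : L)) z) := by
  rw [lprod, List.map_ofFn]; rfl

/-- An alternating map in as many variables as the dimension factors through the top exterior power,
where `f` acts as the identity. -/
theorem _root_.Supergroup.ClosedSubgroup.IsTopExteriorTrivial.alternating_comp {W N : Type*}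
    [AddCommGroup W] [Module k W] [AddCommGroup N] [Module k N] {f : Module.End k W}
    (hf : Supergroup.ClosedSubgroup.IsTopExteriorTrivial f)
    (g : W [⋀^Fin (Module.finrank k W)]→ₗ[k] N) (b : Fin (Module.finrank k W) → W) :
    g (f ∘ b) = g b := by
  have h := hf (exteriorPower.ιMulti k _ b)
  rw [exteriorPower.map_apply_ιMulti] at h
  have := congrArg (exteriorPower.alternatingMapLinearEquiv g) h
  simpa only [exteriorPower.alternatingMapLinearEquiv_apply_ιMulti] using this

/-- Applied to the determinant form of a basis, triviality on the top exterior power says that `f`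
has determinant `1`. -/
theorem _root_.Supergroup.ClosedSubgroup.IsTopExteriorTrivial.surjective {W : Type*}
    [AddCommGroup W] [Module k W] [FiniteDimensional k W] {f : Module.End k W}
    (hf : Supergroup.ClosedSubgroup.IsTopExteriorTrivial f) : Function.Surjective f := by
  have h := hf.alternating_comp (Module.finBasis k W).det (Module.finBasis k W)
  rw [Module.Basis.det_comp, Module.Basis.det_self, mul_one] at h
  exact (LinearMap.equivOfDetNeZero f (by rw [h]; exact one_ne_zero)).surjective

variable [FiniteDimensional k (part (k := k) (L := L) 1)]

variable (k L) in
/-- A basis of the odd part of `L`. -/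
def oddBasis (i : Fin (Module.finrank k (part (k := k) (L := L) 1))) : L :=
  (Module.finBasis k (part (k := k) (L := L) 1) i : L)

theorem oddBasis_mem (i) : oddBasis k L i ∈ part (k := k) 1 := Subtype.prop _

theorem span_oddBasis : part (k := k) 1 ≤ Submodule.span k (Set.range (oddBasis k L)) := by
  have h := congrArg (Submodule.map (part (k := k) (L := L) 1).subtype)
    (Module.finBasis k (part (k := k) (L := L) 1)).span_eq
  rw [Submodule.map_span, ← Set.range_comp, Submodule.map_top, Submodule.range_subtype] at h
  exact h.ge

/-- Modulo shorter products the full product is an alternating function of its odd factors, so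
replacing every factor by its image under `a` changes nothing. -/
theorem apply_mon_sub_mem [CharZero k] (hr : IsRep r)
    (hV : ∀ y ∈ part (k := k) (L := L) 0, ∀ z ∈ V, r y z ∈ V) {a : Hom k L L}
    (ha : Supergroup.ClosedSubgroup.IsTopExteriorTrivial a.odd) {A : Module.End k X}
    (hA : ∀ x v, A (r x v) = r (a.toLinearMap x) (A v)) (hAV : ∀ z ∈ V, A z ∈ V) {z : X}
    (hz : z ∈ V) : A (mon r (oddBasis k L) Finset.univ z) -
      mon r (oddBasis k L) Finset.univ (A z) ∈
        oddFil r V (Fintype.card (Fin (Module.finrank k (part (k := k) (L := L) 1)))) := by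
  rw [Fintype.card_fin]
  set n := Module.finrank k (part (k := k) (L := L) 1) with hn
  -- `mon` orders the factors by `Finset.toList`, the alternating map by `List.ofFn`. The same `ε`
  -- compares the two orders at `z` and at `A z`, so it drops out.
  have hp : ((Finset.univ : Finset (Fin n)).toList.map (oddBasis k L)).Perm
      (List.ofFn (oddBasis k L)) := by
    rw [List.ofFn_eq_map]
    refine List.Perm.map _ ((List.perm_ext_iff_of_nodup (Finset.nodup_toList _)
      (List.nodup_finRange n)).2 fun i => by simp)
  obtain ⟨ε, -, hε⟩ := lprod_perm hr hV hp (odd_of_mem_map oddBasis_mem)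
  rw [List.length_map, Finset.length_toList, Finset.card_univ, Fintype.card_fin] at hε
  have h1 := apply_mem_oddFil hA hAV _ _ (hε z hz)
  rw [map_sub, map_smul] at h1
  have h2 := ha.alternating_comp (oddAlternating hr hV n ⟨A z, hAV z hz⟩)
    (Module.finBasis k (part (k := k) (L := L) 1))
  rw [oddAlternating_apply, oddAlternating_apply, ← sub_eq_zero, ← map_sub, Submodule.mkQ_apply,
    Submodule.Quotient.mk_eq_zero] at h2
  rw [apply_lprod hA (List.ofFn _), List.map_ofFn] at h1
  have h3 := Submodule.sub_mem _ (Submodule.add_mem _ h1 (Submodule.smul_mem _ ε h2))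
    (hε _ (hAV z hz))
  convert h3 using 1
  rw [smul_sub]
  change A (lprod r _ z) - lprod r _ (A z) = _
  have e : (List.ofFn (⇑a.toLinearMap ∘ oddBasis k L)) =
    List.ofFn fun i => ((⇑a.odd ∘ ⇑(Module.finBasis k (part (k := k) (L := L) 1))) i : L) := rfl
  have e' : (List.ofFn (oddBasis k L)) =
    List.ofFn fun i => ((Module.finBasis k (part (k := k) (L := L) 1)) i : L) := rfl
  rw [e, e']
  abel

end Equivariance

/-! ### Invariants in induced modules -/

section Ghost

variable {k L : Type*} [Field k] [CharZero k] [AddCommGroup L] [Module k L] [LieSuperalgebra k L]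

variable (k L) in
/-- `U(L) / U(L) L₀` -/
abbrev EvenQuot : Type _ := UQuot (part (k := k) (L := L) 0)

variable (k L) in
/-- The line spanned by the class of `1` in `U(L) / U(L) L₀` -/
def unitLine : Submodule k (EvenQuot k L) := Submodule.span k {UQuot.mk _ 1}

variable (k L) in
/-- The action of `L` on `U(L) / U(L) L₀` -/
abbrev evenQuotAct : L →ₗ[k] Module.End k (EvenQuot k L) := UQuot.act (part (k := k) (L := L) 0)

theorem evenQuot_isRep : IsRep (evenQuotAct k L) := isRep_act _

theorem unitLine_even : ∀ y ∈ part (k := k) (L := L) 0, ∀ z ∈ unitLine k L,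
    evenQuotAct k L y z ∈ unitLine k L := by
  intro y hy z hz
  obtain ⟨c, rfl⟩ := Submodule.mem_span_singleton.1 hz
  rw [map_smul, UQuot.act_one hy, smul_zero]
  exact Submodule.zero_mem _

theorem exists_mem_oddFil_evenQuot (w : EvenQuot k L) :
    ∃ n, w ∈ oddFil (evenQuotAct k L) (unitLine k L) n := by
  obtain ⟨u, rfl⟩ := UQuot.mk_surjective w
  rw [← UQuot.act_lift_one]
  refine exists_mem_fil_of_isRep _ (fun x n v hv => ?_)
    ⟨1, by rw [fil_one]; exact Submodule.mem_span_singleton_self _⟩ u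
  obtain ⟨y, hy, z, hz, rfl⟩ := exists_even_add_odd (k := k) x
  refine ⟨n + 1, ?_⟩
  rw [map_add, LinearMap.add_apply]
  exact Submodule.add_mem _
    (fil_le_succ n (even_mem_oddFil evenQuot_isRep unitLine_even hy n v hv)) (act_mem_fil hz hv)

/-- Freeness over the odd part passes from a module with an invariant to `U(L) / U(L) L₀`. -/
theorem OddFree.evenQuot {X : Type*} [AddCommGroup X] [Module k X] {r : L →ₗ[k] Module.End k X}
    {V : Submodule k X} {ι : Type*} [Fintype ι] {θ : ι → L} (h : OddFree r V θ) {δ : X}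
    (hδV : δ ∈ V) (hδ : δ ≠ 0) (h0 : ∀ y ∈ part (k := k) (L := L) 0, r y δ = 0) :
    OddFree (evenQuotAct k L) (unitLine k L) θ where
  isRep := evenQuot_isRep
  even_mem := unitLine_even
  odd := h.odd
  span := h.span
  top z hz hm := by
    obtain ⟨c, rfl⟩ := Submodule.mem_span_singleton.1 hz
    -- The map `[u] ↦ u δ` sends the unit line into `V` and shorter products to shorter products, so
    -- the condition `top` can be tested in `X`.
    have h1 := fil_map_le (UQuot.lift h.isRep δ h0) (fun x _ => UQuot.lift_act x) (W := V)
      (fun v hv => by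
        obtain ⟨c, rfl⟩ := Submodule.mem_span_singleton.1 hv
        rw [map_smul, UQuot.lift_mk, map_one]
        exact V.smul_mem _ hδV) _ _ hm
    rw [mon, lprod_comm _ UQuot.lift_act, map_smul, UQuot.lift_mk, map_one] at h1
    have h2 := h.top _ (V.smul_mem c hδV) h1
    have : c = 0 := (smul_eq_zero.1 h2).resolve_right hδ
    rw [this, zero_smul]

variable {X : Type*} [AddCommGroup X] [Module k X] {r : L →ₗ[k] Module.End k X} {V : Submodule k X}

section ghostMul

variable {κ : Type*} [Fintype κ] {θ : κ → L}

/-- The scalar `c` is the top coefficient of the class of `v`. If it were zero, the class would be a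
combination of shorter products killed by all odd elements, and would vanish by `eq_zero_of_odd`.
The congruence is carried to `X` along `[u] ↦ u z`. -/
theorem exists_top_coeff (h : OddFree r V θ) (hM : OddFree (evenQuotAct k L) (unitLine k L) θ)
    {v : U k L} (hv : v ∉ leftIdeal (part (k := k) (L := L) 0))
    (hinv : ∀ x : L, ι k x * v ∈ leftIdeal (part (k := k) (L := L) 0)) :
    ∃ c : k, c ≠ 0 ∧ ∀ z ∈ V, (∀ y ∈ part (k := k) (L := L) 0, r y z = 0) →
      h.isRep.lift v z - c • mon r θ Finset.univ z ∈ oddFil r V (Fintype.card κ) := by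
  obtain ⟨n, hn⟩ := exists_mem_oddFil_evenQuot (UQuot.mk _ v)
  obtain ⟨w, hw, hd⟩ := hM.exists_top hn
  obtain ⟨c, rfl⟩ := Submodule.mem_span_singleton.1 hw
  refine ⟨c, ?_, fun z hz h0 => ?_⟩
  · rintro rfl
    rw [zero_smul, map_zero, sub_zero] at hd
    refine hv (UQuot.mk_eq_zero.1 (hM.eq_zero_of_odd hd fun y _ => ?_))
    rw [UQuot.act_mk, UQuot.mk_eq_zero]
    exact hinv y
  · have h1 := fil_map_le (UQuot.lift h.isRep z h0) (fun x _ => UQuot.lift_act x) (W := V)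
      (fun v hv => by
        obtain ⟨c, rfl⟩ := Submodule.mem_span_singleton.1 hv
        rw [map_smul, UQuot.lift_mk, map_one]
        exact V.smul_mem _ hz) _ _ hd
    rw [map_sub, mon, lprod_comm _ UQuot.lift_act, map_smul, UQuot.lift_mk, UQuot.lift_mk,
      map_one, map_smul] at h1
    exact h1

end ghostMul

variable [FiniteDimensional k (part (k := k) (L := L) 1)]

/-- Multiplication by an invariant `v` of `U(L) / U(L) L₀` identifies the invariants of `V` with
the invariants of `X`. -/
theorem ghost_mul_bijective {H : Type*} {a : H → Hom k L L}
    (ha : ∀ h, Supergroup.ClosedSubgroup.IsTopExteriorTrivial (a h).odd)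
    {A : H → Module.End k X} (hA : ∀ h x v, A h (r x v) = r ((a h).toLinearMap x) (A h v))
    (hAV : ∀ h, ∀ z ∈ V, A h z ∈ V) (hf : OddFree r V (oddBasis k L))
    (hX : ∀ x, ∃ n, x ∈ oddFil r V n)
    (hM : OddFree (evenQuotAct k L) (unitLine k L) (oddBasis k L))
    (hV0 : ∀ z ∈ V, (∀ h, A h z = z) → ∀ y ∈ part (k := k) (L := L) 0, r y z = 0)
    {v : U k L} (hv : v ∉ leftIdeal (part (k := k) (L := L) 0))
    (hinv : ∀ x : L, ι k x * v ∈ leftIdeal (part (k := k) (L := L) 0))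
    (hinv' : ∀ h, U.map (a h) v - v ∈ leftIdeal (part (k := k) (L := L) 0)) :
    (∀ z ∈ V, (∀ h, A h z = z) → (∀ h, A h (hf.isRep.lift v z) = hf.isRep.lift v z) ∧
      ∀ x, r x (hf.isRep.lift v z) = 0) ∧
    (∀ z ∈ V, (∀ h, A h z = z) → hf.isRep.lift v z = 0 → z = 0) ∧
    (∀ d, (∀ h, A h d = d) → (∀ x, r x d = 0) →
      ∃ z ∈ V, (∀ h, A h z = z) ∧ hf.isRep.lift v z = d) := by
  obtain ⟨c, hc, htop⟩ := exists_top_coeff hf hM hv hinv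
  have h1 : ∀ z ∈ V, (∀ h, A h z = z) → (∀ h, A h (hf.isRep.lift v z) = hf.isRep.lift v z) ∧
      ∀ x, r x (hf.isRep.lift v z) = 0 := by
    intro z hz hh
    have h0 := hV0 z hz hh
    refine ⟨fun h => ?_, fun x => ?_⟩
    · rw [hf.isRep.apply_lift (hA h), hh, ← sub_eq_zero, ← LinearMap.sub_apply, ← map_sub]
      exact hf.isRep.lift_leftIdeal h0 (hinv' h)
    · have := hf.isRep.lift_leftIdeal h0 (hinv x)
      rwa [map_mul, IsRep.lift_ι] at this
  refine ⟨h1, fun z hz hh h => ?_, fun d hd hd' => ?_⟩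
  · have := htop z hz (hV0 z hz hh)
    rw [h, zero_sub, Submodule.neg_mem_iff] at this
    exact hf.top z hz ((Submodule.smul_mem_iff _ hc).1 this)
  · obtain ⟨n, hn⟩ := hX d
    obtain ⟨z, hz, hdz⟩ := hf.exists_top hn
    -- Comparing `d` with `A h d = d` modulo shorter products, the full product applied to `A h z -
    -- z` is a sum of shorter ones. Freeness makes `z` invariant.
    have hz' : ∀ h, A h z = z := fun h => by
      have e1 := apply_mem_oddFil (hA h) (hAV h) _ _ hdz
      have e2 := apply_mon_sub_mem hf.isRep hf.even_mem (ha h) (hA h) (hAV h) hz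
      rw [map_sub, hd] at e1
      have e3 := Submodule.sub_mem _ (Submodule.sub_mem _ hdz e1) e2
      rw [sub_sub_sub_cancel_left, sub_sub_sub_cancel_left, ← map_sub] at e3
      refine sub_eq_zero.1 (hf.top _ (V.sub_mem (hAV h z hz) hz) ?_)
      exact e3
    -- After rescaling by `c`, `v z` and `d` have the same top part. Their difference is a
    -- combination of shorter products and is killed by all odd elements.
    refine ⟨c⁻¹ • z, V.smul_mem _ hz, fun h => by rw [map_smul, hz'], ?_⟩
    have h2 := h1 _ hz hz'
    have e := Submodule.smul_mem _ c⁻¹ (htop z hz (hV0 z hz hz'))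
    rw [smul_sub, smul_smul, inv_mul_cancel₀ hc, one_smul, ← map_smul] at e
    have e2 := Submodule.sub_mem _ e hdz
    rw [sub_sub_sub_cancel_right] at e2
    refine sub_eq_zero.1 (hf.eq_zero_of_odd e2 fun y _ => ?_)
    rw [map_sub, map_smul, map_smul, h2.2, hd', smul_zero, sub_zero]

/-! ### Existence of invariants -/

/-- The contragredient representation; the scalar `i` is a square root of `-1`. -/
def contragredient (i : k) (r : L →ₗ[k] Module.End k X) : L →ₗ[k] Module.End k (Module.Dual k X) :=
  Module.Dual.transpose ∘ₗ r ∘ₗ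
    (i • (part (k := k) (L := L) 1).subtype ∘ₗ
        Submodule.projectionOnto _ _ (isCompl (k := k) (L := L)).symm -
      (part (k := k) (L := L) 0).subtype ∘ₗ
        Submodule.projectionOnto _ _ (isCompl (k := k) (L := L)))

theorem contragredient_even (i : k) {x : L} (hx : x ∈ part (k := k) 0) (φ : Module.Dual k X) (v : X) :
    contragredient i r x φ v = - φ (r x v) := by
  have h0 : Submodule.projectionOnto _ _ (isCompl (k := k) (L := L)) x = ⟨x, hx⟩ :=
    Submodule.projectionOnto_apply_left _ ⟨x, hx⟩
  have h1 : Submodule.projectionOnto _ _ (isCompl (k := k) (L := L)).symm x = 0 :=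
    Submodule.projectionOnto_apply_right _ ⟨x, hx⟩
  simp [contragredient, h0, h1, Module.Dual.transpose_apply]

theorem contragredient_odd (i : k) {x : L} (hx : x ∈ part (k := k) 1) (φ : Module.Dual k X) (v : X) :
    contragredient i r x φ v = i * φ (r x v) := by
  have h0 : Submodule.projectionOnto _ _ (isCompl (k := k) (L := L)) x = 0 :=
    Submodule.projectionOnto_apply_right _ ⟨x, hx⟩
  have h1 : Submodule.projectionOnto _ _ (isCompl (k := k) (L := L)).symm x = ⟨x, hx⟩ :=
    Submodule.projectionOnto_apply_left _ ⟨x, hx⟩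
  simp [contragredient, h0, h1, Module.Dual.transpose_apply]

/-- The usual contragredient needs the parity of the functional, but `X` carries no grading here.
Scaling the action of odd elements by a square root of `-1` supplies the same sign, since it only
matters for products of two odd actions. -/
theorem isRep_contragredient {i : k} (hi : i * i = -1) (hr : IsRep r) :
    IsRep (contragredient i r) := by
  have h2 : (1 + 1 : ZMod 2) = 0 := by decide
  intro p q x y hx hy φ
  refine LinearMap.ext fun v => ?_
  have hb := bracket_mem hx hy
  have e := congrArg φ (hr hy hx v)
  have hs := skew (k := k) hy hx
  rw [hs] at e
  simp only [LinearMap.add_apply, LinearMap.smul_apply]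
  rcases zmod2_cases p with rfl | rfl <;> rcases zmod2_cases q with rfl | rfl
  · rw [add_zero] at hb
    simp only [contragredient_even i hx, contragredient_even i hy, contragredient_even i hb]
    simp only [koszulSign_zero_left, one_smul, map_add, map_neg, LinearMap.neg_apply] at e ⊢
    rw [e]; ring
  · rw [zero_add] at hb
    simp only [contragredient_even i hx, contragredient_odd i hy, contragredient_odd i hb]
    simp only [koszulSign_zero_left, koszulSign_zero_right, one_smul, map_add, map_neg,
      LinearMap.neg_apply] at e ⊢
    rw [e]; ring
  · rw [add_zero] at hb
    simp only [contragredient_odd i hx, contragredient_even i hy, contragredient_odd i hb]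
    simp only [koszulSign_zero_left, koszulSign_zero_right, one_smul, map_add, map_neg,
      LinearMap.neg_apply] at e ⊢
    rw [e]; ring
  · rw [h2] at hb
    simp only [contragredient_odd i hx, contragredient_odd i hy, contragredient_even i hb]
    simp only [koszulSign_one_one, neg_smul, one_smul, map_add, map_neg,
      neg_neg, smul_eq_mul] at e ⊢
    rw [e]; linear_combination (φ (r (bracket (k := k) x y) v)) * hi

/-- Each step of the filtration is finite-dimensional because the unit line and the odd part are,
and the filtration stops after `card ι + 1` steps. -/
theorem finiteDimensional_evenQuot {ι : Type*} [Fintype ι] {θ : ι → L}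
    (hM : OddFree (evenQuotAct k L) (unitLine k L) θ) : FiniteDimensional k (EvenQuot k L) := by
  have h : ∀ n, (oddFil (evenQuotAct k L) (unitLine k L) n).FG := by
    intro n
    induction n with
    | zero => exact Submodule.fg_bot
    | succ n ih =>
      exact (Submodule.fg_span_singleton _).sup
        (Submodule.FG.map₂ _ (Module.Finite.iff_fg.1 inferInstance) ih)
  refine Module.finite_def.2 ?_
  convert h (Fintype.card ι + 1)
  refine (eq_top_iff.2 fun w _ => ?_).symm
  obtain ⟨n, hn⟩ := exists_mem_oddFil_evenQuot w
  exact hM.mem_oddFil_card_succ hn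

/-- The coefficient of the top product of odd elements in `U(L) / U(L) L₀` -/
theorem exists_top_functional {ι : Type*} [Fintype ι] {θ : ι → L}
    (hM : OddFree (evenQuotAct k L) (unitLine k L) θ) (h1 : (UQuot.mk _ 1 : EvenQuot k L) ≠ 0) :
    ∃ τ : Module.Dual k (EvenQuot k L),
      (∀ w, τ w = 0 ↔ w ∈ oddFil (evenQuotAct k L) (unitLine k L) (Fintype.card ι)) ∧
      τ (mon (evenQuotAct k L) θ Finset.univ (UQuot.mk _ 1)) = 1 := by
  set F := oddFil (evenQuotAct k L) (unitLine k L) (Fintype.card ι)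
  set t := mon (evenQuotAct k L) θ Finset.univ (UQuot.mk _ 1)
  have hmem : (UQuot.mk _ 1 : EvenQuot k L) ∈ unitLine k L := Submodule.mem_span_singleton_self _
  have ht : t ∉ F := fun h => h1 (hM.top _ hmem h)
  -- Every element is a multiple of `t` modulo `F`, so a functional that kills `F` and not `t` has
  -- kernel exactly `F`.
  obtain ⟨τ, hτ, hF⟩ := Submodule.exists_le_ker_of_notMem ht
  have hτ1 : (τ t)⁻¹ * τ t = 1 := inv_mul_cancel₀ hτ
  refine ⟨(τ t)⁻¹ • τ, fun w => ⟨fun hw => ?_, fun hw => ?_⟩, hτ1⟩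
  · obtain ⟨n, hn⟩ := exists_mem_oddFil_evenQuot w
    obtain ⟨z, hz, hd⟩ := hM.exists_top hn
    obtain ⟨c, rfl⟩ := Submodule.mem_span_singleton.1 hz
    rw [map_smul] at hd
    have h2 : τ (w - c • t) = 0 := hF hd
    have h3 : τ w = 0 := by
      rw [LinearMap.smul_apply, smul_eq_zero] at hw
      exact hw.resolve_left (inv_ne_zero hτ)
    rw [map_sub, h3, map_smul, zero_sub, neg_eq_zero, smul_eq_zero] at h2
    rw [h2.resolve_right hτ, zero_smul, sub_zero] at hd
    exact hd
  · rw [LinearMap.smul_apply, show τ w = 0 from hF hw, smul_zero]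

/-- The top coefficient `τ` behaves like a Frobenius form: the pairing of `w` and `m` by `(w τ)(m)`
on `U(L) / U(L) L₀` is nondegenerate. The augmentation is therefore represented by some `m`, and its
invariance turns into the invariance of `m`. The condition `hdiff` is the passage from group
invariants to Lie algebra invariants, which has no counterpart in pure algebra. -/
theorem exists_ghost [IsAlgClosed k] {H : Type*} {a : H → Hom k L L}
    (ha : ∀ h, Supergroup.ClosedSubgroup.IsTopExteriorTrivial (a h).odd)
    (hM : OddFree (evenQuotAct k L) (unitLine k L) (oddBasis k L))
    (h1 : (UQuot.mk _ 1 : EvenQuot k L) ≠ 0)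
    (hdiff : ∀ τ : Module.Dual k (EvenQuot k L),
      (∀ h w, τ (UQuot.mapLinear (a h) ((a h).map_part 0) w) = τ w) →
      ∀ y ∈ part (k := k) (L := L) 0, ∀ w, τ (evenQuotAct k L y w) = 0) :
    ∃ v : U k L, v ∉ leftIdeal (part (k := k) (L := L) 0) ∧
      (∀ x : L, ι k x * v ∈ leftIdeal (part (k := k) (L := L) 0)) ∧
      ∀ h, U.map (a h) v - v ∈ leftIdeal (part (k := k) (L := L) 0) := by
  obtain ⟨i, hi⟩ := IsAlgClosed.exists_pow_nat_eq (-1 : k) (n := 2) two_pos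
  rw [pow_two] at hi
  have hi0 : i ≠ 0 := by rintro rfl; simp at hi
  obtain ⟨τ, hτ, hτ1⟩ := exists_top_functional hM h1
  have hfin := finiteDimensional_evenQuot hM
  have hline : ∀ h, ∀ z ∈ unitLine k L, UQuot.mapLinear (a h) ((a h).map_part 0) z = z := by
    intro h z hz
    obtain ⟨c, rfl⟩ := Submodule.mem_span_singleton.1 hz
    rw [map_smul, UQuot.mapLinear_mk, map_one]
  -- The group fixes the unit line, hence by triviality of the top exterior power also the full
  -- product modulo shorter ones.
  have hAτ : ∀ h w, τ (UQuot.mapLinear (a h) ((a h).map_part 0) w) = τ w := by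
    intro h w
    have hAV : ∀ z ∈ unitLine k L, UQuot.mapLinear (a h) ((a h).map_part 0) z ∈ unitLine k L :=
      fun z hz => by rw [hline h z hz]; exact hz
    obtain ⟨n, hn⟩ := exists_mem_oddFil_evenQuot w
    obtain ⟨z, hz, hd⟩ := hM.exists_top hn
    have e1 := apply_mem_oddFil (UQuot.mapLinear_act (a h) _) hAV _ _ hd
    have e2 := apply_mon_sub_mem evenQuot_isRep unitLine_even (ha h)
      (UQuot.mapLinear_act (a h) ((a h).map_part 0)) hAV hz
    rw [hline h z hz] at e2
    rw [← hτ, map_sub, sub_eq_zero] at e2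
    rw [← hτ, map_sub, map_sub, sub_eq_zero] at e1
    rw [← hτ, map_sub, sub_eq_zero] at hd
    rw [e1, e2, hd]
  have hτ0 := hdiff τ hAτ
  -- Since `τ` is annihilated by `L₀`, the assignment `[w] ↦ w τ` into the contragredient
  -- representation is well defined.
  let P : EvenQuot k L →ₗ[k] Module.Dual k (EvenQuot k L) :=
    UQuot.lift (isRep_contragredient hi evenQuot_isRep) τ fun y hy =>
      LinearMap.ext fun w => by
        rw [contragredient_even i hy, hτ0 y hy, neg_zero, LinearMap.zero_apply]
  have hP1 : P (UQuot.mk _ 1) = τ := by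
    change UQuot.lift _ _ _ _ = τ
    rw [UQuot.lift_mk, map_one]; rfl
  have hPact : ∀ x w, P (evenQuotAct k L x w) = contragredient i (evenQuotAct k L) x (P w) :=
    UQuot.lift_act
  -- If every `w τ` vanishes at `m`, then `τ` vanishes on all products of odd elements applied to
  -- `m`, so `m` and its multiples have no top part.
  have hinj : Function.Injective P.flip := by
    rw [injective_iff_map_eq_zero]
    intro m hm
    have hm' : ∀ w, P w m = 0 := fun w => LinearMap.congr_fun hm w
    have hl : ∀ l : List L, (∀ y ∈ l, y ∈ part (k := k) 1) →
        ∀ w, P w (lprod (evenQuotAct k L) l m) = 0 := by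
      intro l
      induction l with
      | nil => exact fun _ => hm'
      | cons x l ih =>
        intro hl w
        have hx := hl x (by simp)
        have := ih (fun y hy => hl y (by simp [hy])) (evenQuotAct k L x w)
        rw [hPact, contragredient_odd i hx] at this
        rw [lprod_cons]
        exact (mul_eq_zero.1 this).resolve_left hi0
    obtain ⟨n, hn⟩ := exists_mem_oddFil_evenQuot m
    refine hM.eq_zero_of_lprod hn fun l hl' => (hτ _).1 ?_
    rw [← hP1]
    exact hl l hl' _
  have hsurj : Function.Surjective P.flip :=
    (LinearMap.injective_iff_surjective_of_finrank_eq_finrank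
      (Subspace.dual_finrank_eq (K := k) (V := EvenQuot k L)).symm).1 hinj
  have hzero : IsRep (0 : L →ₗ[k] Module.End k k) := fun _ _ _ _ _ _ _ => by simp
  -- The augmentation: the map to the trivial representation that sends the class of `1` to `1`.
  let ε : Module.Dual k (EvenQuot k L) := UQuot.lift hzero (1 : k) fun _ _ => rfl
  have hε1 : ε (UQuot.mk _ 1) = 1 := by
    change UQuot.lift _ _ _ _ = _
    rw [UQuot.lift_mk]; exact LinearMap.congr_fun (map_one hzero.lift) 1
  have hεact : ∀ x w, ε (evenQuotAct k L x w) = 0 := fun x w => UQuot.lift_act x w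
  obtain ⟨m, hm⟩ := hsurj ε
  have hm' : ∀ w, P w m = ε w := fun w => LinearMap.congr_fun hm w
  have hτm : τ m = 1 := by rw [← hP1, hm', hε1]
  -- Crossing the pairing costs a factor `-1` or `i`, and the augmentation kills every multiple by
  -- an element of `L`.
  have hinv0 : ∀ x, evenQuotAct k L x m = 0 := by
    intro x
    obtain ⟨y, hy, z, hz, rfl⟩ := exists_even_add_odd (k := k) x
    rw [map_add, LinearMap.add_apply]
    have e0 : evenQuotAct k L y m = 0 := hinj <| by
      rw [map_zero]
      refine LinearMap.ext fun w => ?_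
      have := hm' (evenQuotAct k L y w)
      rw [hPact, contragredient_even i hy, hεact, neg_eq_zero] at this
      exact this
    have e1 : evenQuotAct k L z m = 0 := hinj <| by
      rw [map_zero]
      refine LinearMap.ext fun w => ?_
      have := hm' (evenQuotAct k L z w)
      rw [hPact, contragredient_odd i hz, hεact] at this
      exact (mul_eq_zero.1 this).resolve_left hi0
    rw [e0, e1, add_zero]
  obtain ⟨v, rfl⟩ := UQuot.mk_surjective m
  refine ⟨v, fun h => ?_, fun x => ?_, fun h => ?_⟩
  · rw [UQuot.mk_eq_zero.2 h, map_zero] at hτm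
    exact zero_ne_one hτm
  · rw [← UQuot.mk_eq_zero, ← UQuot.act_mk]
    exact hinv0 x
  · rw [← UQuot.mk_eq_mk, ← UQuot.mapLinear_mk (a h) ((a h).map_part 0)]
    set m := (UQuot.mk _ v : EvenQuot k L)
    rw [← sub_eq_zero]
    obtain ⟨n, hn⟩ := exists_mem_oddFil_evenQuot
      (UQuot.mapLinear (a h) ((a h).map_part 0) m - m)
    -- It suffices that `τ` vanishes on all odd products applied to the difference of `m` and its
    -- translate. The empty product is covered by the invariance of `τ`. Otherwise the factor acting
    -- first is the image of an odd `x`, so on the translate it gives the translate of `x m = 0`,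
    -- and it kills `m` as well.
    refine hM.eq_zero_of_lprod hn fun l hl => (hτ _).1 ?_
    rcases List.eq_nil_or_concat l with rfl | ⟨l', y, rfl⟩
    · rw [lprod_nil, map_sub, hAτ, sub_self]
    · obtain ⟨x, hx⟩ := (ha h).surjective ⟨y, hl y (by simp)⟩
      have hx' : (a h).toLinearMap (x : L) = y := congrArg Subtype.val hx
      rw [List.concat_eq_append, lprod_append, lprod_cons, lprod_nil, map_sub, hinv0, ← hx',
        ← UQuot.mapLinear_act, hinv0]
      simp

end Ghost

end LieSuperalgebra

/-- A pairing with a finite-dimensional space is a finite sum of products of functionals given by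
elements of the two spaces. -/
theorem exists_pairing_eq_sum {k V W : Type*} [Field k] [AddCommGroup V] [Module k V]
    [FiniteDimensional k V] [AddCommGroup W] [Module k W] (p : V →ₗ[k] W →ₗ[k] k) :
    ∃ (n : ℕ) (x : Fin n → V) (b : Fin n → W), ∀ v w, p v w = ∑ i, p (x i) w * p v (b i) := by
  -- A basis of the image of `W` in the dual of `V` lifts to the `b i`. Its coordinate functionals
  -- extend to the dual of `V` and are thus evaluations at elements of `V`.
  let R := LinearMap.range p.flip
  let e := Module.finBasis k R
  choose b hb using fun i => (e i).2
  choose ψ hψ using fun i => Subspace.dualRestrict_surjective (W := R) (e.coord i)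
  refine ⟨_, fun i => (Module.evalEquiv k V).symm (ψ i), b, fun v w => ?_⟩
  have h := congrArg Subtype.val (e.sum_repr ⟨p.flip w, w, rfl⟩)
  have hc : ∀ i, e.repr ⟨p.flip w, w, rfl⟩ i = p ((Module.evalEquiv k V).symm (ψ i)) w := by
    intro i
    have h1 := LinearMap.congr_fun (hψ i) ⟨p.flip w, w, rfl⟩
    change ψ i (p.flip w) = e.repr _ i at h1
    rw [← h1]
    exact (Module.apply_evalEquiv_symm_apply (R := k) (M := V) (p.flip w) (ψ i)).symm
  have h2 := LinearMap.congr_fun h v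
  simp only [Submodule.coe_sum, Submodule.coe_smul, LinearMap.sum_apply, LinearMap.smul_apply,
    hc, smul_eq_mul] at h2
  change _ = p v w at h2
  rw [← h2]
  refine Finset.sum_congr rfl fun i _ => ?_
  rw [← hb i]; rfl

/-! ### Infinitesimal left translations as superderivations of the functions. -/

namespace Supergroup

variable {k : Type*} [Field k] [CharZero k] {G : Supergroup k}

open WithConv LieSuperalgebra

theorem dual_ext {W : Type*} [AddCommGroup W] [Module k W] {a b : W}
    (h : ∀ χ : Module.Dual k W, χ a = χ b) : a = b := by
  rw [← sub_eq_zero, ← Module.forall_dual_apply_eq_zero_iff k]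
  intro χ; rw [map_sub, h, sub_self]

theorem lslice_lslice (φ ψ : Module.Dual k G.Fun) (f : G.Fun) :
    lslice ψ (lslice φ f) = lslice (ψ ∘ₗ lslice φ) f := by
  refine dual_ext (k := k) fun χ => ?_
  have e : (toConv (ψ ∘ₗ lslice φ)) = toConv φ * toConv ψ :=
    ofConv_injective (LinearMap.ext fun f => lslice_conv φ ψ f)
  rw [lslice_conv (ψ ∘ₗ lslice φ) χ, e, mul_assoc, lslice_conv ψ χ]
  exact lslice_conv φ (toConv ψ * toConv χ).ofConv f

theorem lslice_parity (φ : Module.Dual k G.Fun) (f : G.Fun) :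
    lslice φ (G.parity f) = G.parity (lslice (φ ∘ₗ G.parity) f) := by
  refine dual_ext (k := k) fun χ => ?_
  rw [lslice_conv, show χ (G.parity (lslice (φ ∘ₗ G.parity) f)) =
    (χ ∘ₗ G.parity) (lslice (φ ∘ₗ G.parity) f) from rfl, lslice_conv, ← conv_comp_parity]
  rfl

theorem parity_parity (f : G.Fun) : G.parity (G.parity f) = f := by
  rw [parity_apply, parity_apply, map_sub, map_smul, oddProj_oddProj, two_smul, two_smul]
  abel

theorem mem_gr_zero {f : G.Fun} : f ∈ G.gr 0 ↔ G.parity f = f := by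
  refine ⟨G.parity_of_even, fun h => ?_⟩
  rw [parity_apply, sub_eq_self, smul_eq_zero] at h
  have := G.sub_oddProj_mem f
  rwa [h.resolve_left two_ne_zero, sub_zero] at this

theorem mem_gr_one {f : G.Fun} : f ∈ G.gr 1 ↔ G.parity f = -f := by
  refine ⟨G.parity_of_odd, fun h => ?_⟩
  rw [parity_apply, sub_eq_iff_eq_add, neg_add_eq_sub, eq_sub_iff_add_eq, ← two_smul k] at h
  have h2 := smul_right_injective _ (two_ne_zero' k) h
  rw [h2]; exact G.oddProj_mem f

theorem counit_parity' (f : G.Fun) : counit (R := k) (G.parity f) = counit (R := k) f :=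
  G.counit_parity f

theorem transl_of_even {x : G.lie} (hx : x ∈ G.liePart 0) (f : G.Fun) :
    transl (x : Module.Dual k G.Fun) f = lslice x f := by
  rw [transl_eq, mem_liePart_zero.1 hx, lslice_zero]; simp

theorem transl_of_odd {x : G.lie} (hx : x ∈ G.liePart 1) (f : G.Fun) :
    transl (x : Module.Dual k G.Fun) f = G.parity (lslice x f) := by
  rw [transl_eq, mem_liePart_one.1 hx, parity_apply]

theorem lslice_even_parity {x : G.lie} (hx : x ∈ G.liePart 0) (f : G.Fun) :
    lslice (x : Module.Dual k G.Fun) (G.parity f) = G.parity (lslice x f) := by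
  have h := mem_liePart_iff.1 hx
  rw [if_neg (by decide), one_smul] at h
  rw [lslice_parity, h]

theorem lslice_neg (φ : Module.Dual k G.Fun) (f : G.Fun) : lslice (-φ) f = -lslice φ f := by
  rw [lslice_repr, lslice_repr, ← Finset.sum_neg_distrib]
  simp

theorem lslice_odd_parity {x : G.lie} (hx : x ∈ G.liePart 1) (f : G.Fun) :
    lslice (x : Module.Dual k G.Fun) (G.parity f) = -G.parity (lslice x f) := by
  have h := mem_liePart_iff.1 hx
  rw [if_pos rfl, neg_one_smul] at h
  rw [lslice_parity, h, lslice_neg, map_neg]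

/-- Slicing turns the convolution product into composition in the opposite order, which decides
where the Koszul sign appears. -/
theorem lslice_bracket {i j : ZMod 2} {x y : G.lie} (hx : x ∈ G.liePart i) (hy : y ∈ G.liePart j)
    (f : G.Fun) : lslice (G.lieBracket x y : Module.Dual k G.Fun) f =
      koszulSign k i j • lslice (y : Module.Dual k G.Fun) (lslice x f) -
        lslice (x : Module.Dual k G.Fun) (lslice y f) := by
  refine dual_ext (k := k) fun χ => ?_
  have e : toConv (G.lieBracket x y : Module.Dual k G.Fun) = _ := bracket_conv_homogeneous hx hy
  have c : ∀ a b : Module.Dual k G.Fun, χ (lslice b (lslice a f)) =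
      (toConv a * toConv b * toConv χ).ofConv f := by
    intro a b
    rw [lslice_conv, mul_assoc, ← lslice_conv a (toConv b * toConv χ).ofConv]
  rw [map_sub, map_smul, c, c, lslice_conv, e, sub_mul, smul_mul_assoc]
  rfl

/-- For odd elements `transl` contains the parity operator, and the signs it produces turn
`lslice_bracket` into this form. Precomposition with `transl` reverses the order once more and gives
a left action on functionals. -/
theorem transl_transl {i j : ZMod 2} {x y : G.lie} (hx : x ∈ G.liePart i) (hy : y ∈ G.liePart j)
    (f : G.Fun) : transl (y : Module.Dual k G.Fun) (transl (x : Module.Dual k G.Fun) f) =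
      koszulSign k i j • transl (x : Module.Dual k G.Fun) (transl (y : Module.Dual k G.Fun) f) +
        transl (G.lieBracket x y : Module.Dual k G.Fun) f := by
  have hb := lieBracket_mem hx hy
  have h := lslice_bracket hx hy f
  have h2 : (1 + 1 : ZMod 2) = 0 := by decide
  rcases zmod2_cases i with rfl | rfl <;> rcases zmod2_cases j with rfl | rfl
  · rw [add_zero] at hb
    rw [transl_of_even hx, transl_of_even hx, transl_of_even hy, transl_of_even hy,
      transl_of_even hb, h]
    simp
  · rw [zero_add] at hb
    rw [transl_of_even hx, transl_of_even hx, transl_of_odd hy, transl_of_odd hy,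
      transl_of_odd hb, h, lslice_even_parity hx]
    simp
  · rw [add_zero] at hb
    rw [transl_of_odd hx, transl_of_odd hx, transl_of_even hy, transl_of_even hy,
      transl_of_odd hb, h, lslice_even_parity hy]
    simp
  · rw [h2] at hb
    rw [transl_of_odd hx, transl_of_odd hx, transl_of_odd hy, transl_of_odd hy,
      transl_of_even hb, h, lslice_odd_parity hy, lslice_odd_parity hx]
    simp [parity_parity]

theorem counit_transl (x : Module.Dual k G.Fun) (f : G.Fun) :
    counit (R := k) (transl x f) = x f := by
  rw [transl_eq, map_sub, map_smul, counit_oddProj, counit_lslice, smul_zero, sub_zero]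

theorem parity_mul_odd (g : G.Fun) {c : G.Fun} (hc : c ∈ G.gr 1) : G.parity g * c = c * g := by
  have h0 := G.supercomm (G.sub_oddProj_mem g) hc
  have h1 := G.supercomm (G.oddProj_mem g) hc
  rw [koszulSign_zero_left, one_smul, sub_mul, mul_sub, sub_eq_iff_eq_add] at h0
  rw [koszulSign_one_one, neg_one_smul] at h1
  rw [parity_apply, sub_mul, h0, smul_mul_assoc, h1, two_smul]
  abel

theorem mul_even_comm (g : G.Fun) {c : G.Fun} (hc : c ∈ G.gr 0) : g * c = c * g := by
  have h0 := G.supercomm (G.sub_oddProj_mem g) hc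
  have h1 := G.supercomm (G.oddProj_mem g) hc
  rw [koszulSign_zero_right, one_smul] at h0 h1
  rw [sub_mul, mul_sub, h1] at h0
  exact sub_left_injective h0

theorem transl_even_mul {x : G.lie} (hx : x ∈ G.liePart 0) (a b : G.Fun) :
    transl (x : Module.Dual k G.Fun) (a * b) =
      transl (x : Module.Dual k G.Fun) a * b + a * transl (x : Module.Dual k G.Fun) b := by
  rw [transl_of_even hx, transl_of_even hx, transl_of_even hx, lslice_lie x.2,
    mem_liePart_zero.1 hx, lslice_zero]
  simp

theorem transl_odd_mul {x : G.lie} (hx : x ∈ G.liePart 1) (a b : G.Fun) :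
    transl (x : Module.Dual k G.Fun) (a * b) =
      transl (x : Module.Dual k G.Fun) a * G.parity b + a * transl (x : Module.Dual k G.Fun) b := by
  rw [transl_of_odd hx, transl_of_odd hx, transl_of_odd hx, lslice_lie x.2, mem_liePart_one.1 hx,
    ← ClosedSubgroup.parity_mul]
  have : a * G.parity (lslice (x : Module.Dual k G.Fun) b) =
      G.parity (G.parity a * lslice (x : Module.Dual k G.Fun) b) := by
    rw [ClosedSubgroup.parity_mul, parity_parity]
  rw [this, ← map_add]
  congr 1
  rw [G.parity_apply a, sub_mul, smul_mul_assoc]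
  abel

/-- As `c` has the parity of `x`, the operator of translating by `x` and multiplying by `c` is even
and obeys the Leibniz rule without signs. This makes the Euler operator a derivation. -/
theorem transl_mul_mul {i : ZMod 2} {x : G.lie} (hx : x ∈ G.liePart i) {c : G.Fun}
    (hc : c ∈ G.gr i) (a g : G.Fun) : transl (x : Module.Dual k G.Fun) (a * g) * c =
      transl (x : Module.Dual k G.Fun) a * c * g + a * (transl (x : Module.Dual k G.Fun) g * c) := by
  rcases zmod2_cases i with rfl | rfl
  · rw [transl_even_mul hx, add_mul, mul_assoc, mul_assoc, mul_assoc, mul_even_comm g hc]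
  · rw [transl_odd_mul hx, add_mul, mul_assoc, mul_assoc, mul_assoc, parity_mul_odd g hc]

theorem transl_mul {i j : ZMod 2} {x : G.lie} (hx : x ∈ G.liePart i) {b : G.Fun}
    (hb : b ∈ G.gr j) (a : G.Fun) : transl (x : Module.Dual k G.Fun) (a * b) =
      koszulSign k i j • (transl (x : Module.Dual k G.Fun) a * b) +
        a * transl (x : Module.Dual k G.Fun) b := by
  rcases zmod2_cases i with rfl | rfl
  · rw [transl_even_mul hx, koszulSign_zero_left, one_smul]
  · rw [transl_odd_mul hx]
    rcases zmod2_cases j with rfl | rfl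
    · rw [G.parity_of_even hb, koszulSign_zero_right, one_smul]
    · rw [G.parity_of_odd hb, koszulSign_one_one, neg_one_smul, mul_neg]

/-! ### The Lie superalgebra is finite-dimensional -/

theorem lie_one (x : G.lie) : (x : Module.Dual k G.Fun) 1 = 0 := by
  have h := x.2 1 1
  rw [mul_one, G.counit_one, mul_one, one_mul] at h
  simpa using h

/-- By the Leibniz rule a point derivation is determined by its values on finitely many generators.
-/
instance : FiniteDimensional k G.lie := by
  obtain ⟨S, hS⟩ := G.finiteType.out
  let F : G.lie →ₗ[k] (S → k) :=
    { toFun := fun x s => (x : Module.Dual k G.Fun) s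
      map_add' := fun _ _ => rfl
      map_smul' := fun _ _ => rfl }
  refine FiniteDimensional.of_injective F ((injective_iff_map_eq_zero F).2 fun x hx => ?_)
  refine Subtype.ext (LinearMap.ext fun f => ?_)
  have hf : f ∈ Algebra.adjoin k (S : Set G.Fun) := by rw [hS]; trivial
  change (x : Module.Dual k G.Fun) f = 0
  induction hf using Algebra.adjoin_induction with
  | mem s hs => exact congrFun hx ⟨s, hs⟩
  | algebraMap c => rw [Algebra.algebraMap_eq_smul_one, map_smul, lie_one, smul_zero]
  | add a b _ _ ha hb => rw [map_add, ha, hb, add_zero]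
  | mul a b _ _ ha hb => rw [x.2, ha, hb, zero_mul, mul_zero, add_zero]

namespace ClosedSubgroup

variable (K : G.ClosedSubgroup)

theorem isRep_distAct : IsRep K.distAct := by
  intro i j x y hx hy ψ
  refine Subtype.ext (LinearMap.ext fun f => ?_)
  have e : K.quotTransl y (K.quotTransl x f) =
      koszulSign k i j • K.quotTransl x (K.quotTransl y f) + K.quotTransl (G.lieBracket x y) f :=
    Subtype.ext (transl_transl hx hy f)
  have := congrArg (ψ : Module.Dual k K.quotFun) e
  rw [map_add, map_smul] at this
  exact this

end ClosedSubgroup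

end Supergroup

/-! ### The ideal of `K` and the maximal ideal of `k[G/K]`. -/

namespace Supergroup

variable {k : Type*} [Field k] [CharZero k] {G : Supergroup k}

open WithConv LieSuperalgebra

theorem mul_odd_comm (g : G.Fun) {c : G.Fun} (hc : c ∈ G.gr 1) : g * c = c * G.parity g := by
  rw [← parity_mul_odd _ hc, parity_parity]

theorem mul_eq_parity (a b : G.Fun) :
    a * b = (b - G.oddProj b) * a + G.oddProj b * G.parity a := by
  rw [← mul_even_comm _ (G.sub_oddProj_mem b), ← mul_odd_comm _ (G.oddProj_mem b), ← mul_add,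
    sub_add_cancel]

theorem parity_one : G.parity 1 = 1 := G.parity_of_even (SetLike.one_mem_graded G.gr)

variable (G) in
/-- The maximal ideal of `k[G]` at the identity -/
def augIdeal : Ideal G.Fun := RingHom.ker G.counitHom

theorem mem_augIdeal {f : G.Fun} : f ∈ G.augIdeal ↔ counit (R := k) f = 0 := Iff.rfl

theorem mul_mem_augIdeal_right {f : G.Fun} (hf : f ∈ G.augIdeal) (g : G.Fun) :
    f * g ∈ G.augIdeal := by
  rw [mem_augIdeal] at hf ⊢
  rw [counit_mul', hf, zero_mul]

theorem sub_counit_mem (f : G.Fun) : f - algebraMap k G.Fun (counit (R := k) f) ∈ G.augIdeal := by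
  rw [mem_augIdeal, map_sub, Algebra.algebraMap_eq_smul_one, map_smul, G.counit_one]; simp

theorem oddProj_mem_augIdeal (f : G.Fun) : G.oddProj f ∈ G.augIdeal := G.counit_oddProj f

theorem mul_mem_augIdeal_mul {I : Ideal G.Fun} {u b : G.Fun} (hu : u ∈ I) (hu' : G.parity u ∈ I)
    (hb : b ∈ G.augIdeal) : u * b ∈ G.augIdeal * I := by
  rw [mul_eq_parity]
  exact Ideal.add_mem _ (Ideal.mul_mem_mul (Ideal.sub_mem _ hb (oddProj_mem_augIdeal b)) hu)
    (Ideal.mul_mem_mul (oddProj_mem_augIdeal b) hu')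

/-- A functional that vanishes at `1` and on the square of the maximal ideal is a point
derivation. -/
theorem mem_lie_of_augIdeal_sq {x : Module.Dual k G.Fun} (h1 : x 1 = 0)
    (h2 : ∀ f ∈ G.augIdeal * G.augIdeal, x f = 0) : x ∈ G.lie := by
  intro f g
  have h := h2 _ (Ideal.mul_mem_mul (sub_counit_mem f) (sub_counit_mem g))
  simp only [Algebra.algebraMap_eq_smul_one, sub_mul, mul_sub, smul_mul_assoc, one_mul,
    mul_smul_comm, mul_one, map_sub, map_smul, smul_eq_mul, h1] at h
  linear_combination h

namespace ClosedSubgroup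

variable (K : G.ClosedSubgroup)

theorem sub_counit_mem_maxIdeal (f : K.quotFun) :
    f - algebraMap k K.quotFun (counit (R := k) (f : G.Fun)) ∈ K.maxIdeal :=
  sub_counit_mem (f : G.Fun)

/-- Evaluating the first factor of the invariance equation at the identity shows that a function on
`G/K` is constant on `K`. -/
theorem maxIdeal_le_ideal {f : K.quotFun} (hf : f ∈ K.maxIdeal) : (f : G.Fun) ∈ K.ideal := by
  have h := congrArg (fun t => TensorProduct.lid k _ ((counit (R := k)).rTensor _ t))
    (K.mem_quotFun.1 f.2)
  have e : ∀ t : G.Fun ⊗[k] G.Fun,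
      TensorProduct.lid k _ ((counit (R := k)).rTensor _ (K.res.lTensor G.Fun t)) =
        K.res (TensorProduct.lid k _ ((counit (R := k)).rTensor _ t)) := by
    intro t
    induction t with
    | zero => simp
    | add x y hx hy => simp only [map_add, hx, hy]
    | tmul x y => simp
  simp only [e, Coalgebra.rTensor_counit_comul, LinearMap.rTensor_tmul, TensorProduct.lid_tmul,
    K.mem_maxIdeal.1 hf, zero_smul, one_smul] at h
  exact K.res_eq_zero.1 h

theorem counit_antipode (f : G.Fun) : counit (R := k) (G.antipode f) = counit (R := k) f := by
  have h := antipode_conv G.counitHom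
  rw [show toConv G.counitHom.toLinearMap = (1 : WithConv (Module.Dual k G.Fun)) from rfl,
    mul_one] at h
  exact LinearMap.congr_fun (congrArg ofConv h) f

/-- On points, the function `(g, h) ↦ f(g⁻¹ h)` is pulled back along `(g, κ) ↦ (g, g κ)` with `κ` in
`K`, which leaves `f(κ)`. -/
theorem torsorMap_antipode (f : G.Fun) :
    K.torsorMap (G.antipode.toLinearMap.rTensor G.Fun (comul f)) = 1 ⊗ₜ K.res f := by
  have e : K.torsorMap ∘ₗ G.antipode.toLinearMap.rTensor G.Fun =
      TensorProduct.map (LinearMap.mul' k G.Fun ∘ₗ G.antipode.toLinearMap.rTensor G.Fun) K.res ∘ₗ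
        (TensorProduct.assoc k G.Fun G.Fun G.Fun).symm.toLinearMap ∘ₗ comul.lTensor G.Fun := by
    refine TensorProduct.ext' fun a b => ?_
    simp only [torsorMap, LinearMap.comp_apply, LinearMap.rTensor_tmul, LinearMap.lTensor_tmul]
    induction comul (R := k) b with
    | zero => simp
    | add x y hx hy => simp only [TensorProduct.tmul_add, map_add, hx, hy]
    | tmul x y => simp
  have h := LinearMap.congr_fun e (comul f)
  rw [LinearMap.comp_apply] at h
  rw [h]
  simp only [LinearMap.comp_apply, LinearEquiv.coe_coe]
  rw [Coalgebra.coassoc_symm_apply]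
  conv_lhs => rw [← (ℛ k f).eq]
  simp only [map_sum, LinearMap.rTensor_tmul, TensorProduct.map_tmul, LinearMap.comp_apply,
    G.mul_antipode_left]
  simp only [Algebra.algebraMap_eq_smul_one, ← TensorProduct.smul_tmul', ← TensorProduct.tmul_smul,
    ← map_smul, ← TensorProduct.tmul_sum, ← map_sum]
  rw [Coalgebra.sum_counit_smul]

/-- The functions of the form `∑ r a` with `r` in the maximal ideal of `k[G/K]` and `a ∈ S`. -/
def mulSpan (S : Set G.Fun) : Submodule k G.Fun :=
  Submodule.span k {u | ∃ r ∈ K.maxIdeal, ∃ a ∈ S, u = (r : G.Fun) * a}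

variable {K}

/-- If `f` vanishes on `K`, then `(g, h) ↦ f(g⁻¹ h)` vanishes on the fibre product of `G` with
itself over `G/K`, so the torsor condition writes it through the differences `a r ⊗ b - a ⊗ r b`.
Setting `g = e` gives back `f` on one side and multiples of the `(r - r(e)) b` on the other. -/
theorem IsAffineQuotient.ideal_le_mulSpan (hX : K.IsAffineQuotient) {f : G.Fun}
    (hf : f ∈ K.ideal) : f ∈ K.mulSpan Set.univ := by
  have h := hX.torsor (G.antipode.toLinearMap.rTensor G.Fun (comul f)) (by
    rw [torsorMap_antipode, K.res_eq_zero.2 hf, TensorProduct.tmul_zero])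
  let F : G.Fun ⊗[k] G.Fun →ₗ[k] G.Fun :=
    (TensorProduct.lid k G.Fun).toLinearMap ∘ₗ (counit (R := k)).rTensor G.Fun
  have hF : F (G.antipode.toLinearMap.rTensor G.Fun (comul f)) = f := by
    simp only [F, LinearMap.comp_apply]
    rw [← LinearMap.rTensor_comp_apply]
    have : counit (R := k) ∘ₗ G.antipode.toLinearMap = counit (R := k) :=
      LinearMap.ext counit_antipode
    rw [this, Coalgebra.rTensor_counit_comul]
    simp
  have h2 : Submodule.span k {u : G.Fun ⊗[k] G.Fun | ∃ (a b : G.Fun) (r : K.quotFun),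
      u = (a * r) ⊗ₜ b - a ⊗ₜ (r * b)} ≤ (K.mulSpan Set.univ).comap F := by
    rw [Submodule.span_le]
    rintro _ ⟨a, b, r, rfl⟩
    have e : F ((a * r) ⊗ₜ b - a ⊗ₜ (r * b)) = -counit (R := k) a •
        (((r - algebraMap k K.quotFun (counit (R := k) (r : G.Fun)) : K.quotFun) : G.Fun) * b) := by
      simp [F, counit_mul', Algebra.algebraMap_eq_smul_one, sub_mul, smul_sub, smul_smul]
      abel
    rw [SetLike.mem_coe, Submodule.mem_comap, e]
    exact Submodule.smul_mem _ _
      (Submodule.subset_span ⟨_, K.sub_counit_mem_maxIdeal r, b, trivial, rfl⟩)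
  have := h2 h
  rwa [Submodule.mem_comap, hF] at this

/-- By `ideal_le_mulSpan` the ideal of `K` consists of sums of products `r a` with `r` in the
maximal ideal of `k[G/K]`, and the Leibniz rule kills these. -/
theorem IsAffineQuotient.mem_lie (hX : K.IsAffineQuotient) {x : G.lie}
    (hx : ∀ b ∈ K.maxIdeal, (x : Module.Dual k G.Fun) (b : G.Fun) = 0) :
    x ∈ K.lie.toSubmodule := by
  intro f hf
  have h := hX.ideal_le_mulSpan hf
  unfold mulSpan at h
  clear hf
  induction h using Submodule.span_induction with
  | mem u hu =>
    obtain ⟨r, hr, a, -, rfl⟩ := hu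
    rw [x.2, hx r hr, K.mem_maxIdeal.1 hr, zero_mul, zero_mul, add_zero]
  | zero => exact map_zero _
  | add a b _ _ ha hb => rw [map_add, ha, hb, add_zero]
  | smul c a _ ha => rw [map_smul, ha, smul_zero]

/-- Flatness descends the statement from `k[G]` to `k[G/K]`: the relation `b · 1 - ∑ r_i s_i = 0`
with `s_i(e) = 0` is resolved by the equational criterion into relations with coefficients in
`k[G/K]`. -/
theorem IsAffineQuotient.mem_sq_of_mulSpan (hX : K.IsAffineQuotient) {b : K.quotFun}
    (hb : b ∈ K.maxIdeal) (hb' : (b : G.Fun) ∈ K.mulSpan G.augIdeal) :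
    b ∈ K.maxIdeal * K.maxIdeal := by
  have hs : ∀ f ∈ K.mulSpan (G.augIdeal : Set G.Fun), ∃ (n : ℕ) (r : Fin n → K.quotFun)
      (s : Fin n → G.Fun), (∀ i, r i ∈ K.maxIdeal) ∧ (∀ i, s i ∈ G.augIdeal) ∧
        f = ∑ i, (r i : G.Fun) * s i := by
    intro f hf
    unfold mulSpan at hf
    induction hf using Submodule.span_induction with
    | mem u hu =>
      obtain ⟨r, hr, a, ha, rfl⟩ := hu
      exact ⟨1, fun _ => r, fun _ => a, fun _ => hr, fun _ => ha, by simp⟩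
    | zero => exact ⟨0, Fin.elim0, Fin.elim0, fun i => i.elim0, fun i => i.elim0, by simp⟩
    | add a b _ _ ha hb =>
      obtain ⟨n, r, s, hr, hs, rfl⟩ := ha
      obtain ⟨m, r', s', hr', hs', rfl⟩ := hb
      refine ⟨n + m, Fin.append r r', Fin.append s s', fun i => ?_, fun i => ?_, ?_⟩
      · refine Fin.addCases (fun i => ?_) (fun i => ?_) i <;> simp [hr, hr']
      · refine Fin.addCases (fun i => ?_) (fun i => ?_) i <;> simp [hs, hs']
      · simp [Fin.sum_univ_add]
    | smul c a _ ha =>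
      obtain ⟨n, r, s, hr, hs, rfl⟩ := ha
      refine ⟨n, r, fun i => c • s i, hr, fun i => ?_, by simp [Finset.smul_sum]⟩
      exact (G.augIdeal.restrictScalars k).smul_mem c (hs i)
  obtain ⟨n, r, s, hr, hs', he⟩ := hs _ hb'
  obtain ⟨m, c, t, h1, h2⟩ := hX.flat (n + 1) (Fin.cons b r) (Fin.cons 1 fun i => - s i) (by
    rw [Fin.sum_univ_succ]
    simp [he])
  -- Evaluating the `t j` at the identity collects the coefficients into one relation `b C₀ + ∑ r_i
  -- C_i = 0` in `k[G/K]` with `C₀(e) = 1` and the other `C_i(e) = 0`. Hence `b = b (1 - C₀) - ∑ r_i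
  -- C_i` lies in the square.
  let C : Fin (n + 1) → K.quotFun := fun i => ∑ j, counit (R := k) (t j) • c i j
  have hC : ∀ i, counit (R := k) (C i : G.Fun) =
      counit (R := k) ((Fin.cons 1 fun i => - s i : Fin (n + 1) → G.Fun) i) := by
    intro i
    rw [h1 i]
    simp [C, counit_mul', mul_comm]
  have hsum : ∑ i, (Fin.cons b r : Fin (n + 1) → K.quotFun) i * C i = 0 := by
    simp only [C, Finset.mul_sum, mul_smul_comm]
    rw [Finset.sum_comm]
    refine Finset.sum_eq_zero fun j _ => ?_
    rw [← Finset.smul_sum, h2 j, smul_zero]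
  rw [Fin.sum_univ_succ] at hsum
  simp only [Fin.cons_zero, Fin.cons_succ] at hsum
  have e : b = b * (1 - C 0) - ∑ i : Fin n, r i * C i.succ := by
    rw [mul_sub, mul_one, sub_sub, hsum, sub_zero]
  rw [e]
  refine Ideal.sub_mem _ (Ideal.mul_mem_mul hb ?_)
    (Ideal.sum_mem _ fun i _ => Ideal.mul_mem_mul (hr i) ?_)
  · rw [mem_maxIdeal]
    change counit (R := k) ((1 : G.Fun) - (C 0 : G.Fun)) = 0
    rw [map_sub, hC 0, Fin.cons_zero, sub_self]
  · rw [mem_maxIdeal, hC i.succ, Fin.cons_succ, map_neg, mem_augIdeal.1 (hs' i), neg_zero]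

/-- The factor vanishing at the identity has to be carried past `r`; its odd part replaces `r` by
its image under the parity operator. -/
theorem IsAffineQuotient.augIdeal_mul_ideal (hX : K.IsAffineQuotient) {f : G.Fun}
    (hf : f ∈ G.augIdeal * K.ideal) : f ∈ K.mulSpan G.augIdeal := by
  refine Submodule.smul_induction_on hf (fun a ha g hg => ?_)
    (fun a b ha hb => Submodule.add_mem _ ha hb)
  have h := hX.ideal_le_mulSpan hg
  unfold mulSpan at h
  rw [smul_eq_mul]
  clear hg
  induction h using Submodule.span_induction with
  | mem u hu =>
    obtain ⟨r, hr, c, -, rfl⟩ := hu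
    have e : a * ((r : G.Fun) * c) = (r : G.Fun) * ((a - G.oddProj a) * c) +
        (K.quotParity r : G.Fun) * (G.oddProj a * c) := by
      rw [coe_quotParity, ← mul_assoc, ← mul_assoc, ← mul_assoc,
        parity_mul_odd _ (G.oddProj_mem a), mul_even_comm _ (G.sub_oddProj_mem a), ← add_mul,
        ← add_mul, sub_add_cancel]
    rw [e]
    refine Submodule.add_mem _ (Submodule.subset_span ⟨r, hr, _, ?_, rfl⟩)
      (Submodule.subset_span ⟨K.quotParity r, ?_, _, ?_, rfl⟩)
    · exact mul_mem_augIdeal_right (Ideal.sub_mem _ ha (oddProj_mem_augIdeal a)) c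
    · exact (counit_parity' (r : G.Fun)).trans hr
    · exact mul_mem_augIdeal_right (oddProj_mem_augIdeal a) c
  | zero => rw [mul_zero]; exact Submodule.zero_mem _
  | add x y _ _ hx hy => rw [mul_add]; exact Submodule.add_mem _ hx hy
  | smul c x _ hx => rw [mul_smul_comm]; exact Submodule.smul_mem _ _ hx

end ClosedSubgroup

/-! ### Symmetric subgroups to first order at the identity. -/

namespace Involution

variable (θ : G.Involution)

theorem fixedIdeal_le_augIdeal : θ.fixedIdeal ≤ G.augIdeal := by
  refine Ideal.span_le.2 ?_
  rintro _ ⟨f, rfl⟩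
  rw [SetLike.mem_coe, mem_augIdeal, map_sub, θ.counit, sub_self]

/-- Modulo the product ideal, the coefficients of the generators `θ(g) - g` may be replaced by their
values at the identity, and `θ(g) - g` is linear in `g`. -/
theorem exists_sub_mem {f : G.Fun} (hf : f ∈ θ.fixedIdeal) :
    ∃ g, f - (θ.pullback g - g) ∈ G.augIdeal * θ.fixedIdeal := by
  have hf' := hf
  unfold fixedIdeal at hf'
  induction hf' using Submodule.span_induction with
  | mem u hu => obtain ⟨g, rfl⟩ := hu; exact ⟨g, by simp⟩
  | zero => exact ⟨0, by simp⟩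
  | add a b ha hb iha ihb =>
    obtain ⟨g, hg⟩ := iha ha
    obtain ⟨g', hg'⟩ := ihb hb
    refine ⟨g + g', ?_⟩
    convert Ideal.add_mem _ hg hg' using 1
    rw [map_add]; abel
  | smul c a ha iha =>
    obtain ⟨g, hg⟩ := iha ha
    refine ⟨Coalgebra.counit (R := k) c • g, ?_⟩
    have h1 := Ideal.mul_mem_mul (J := θ.fixedIdeal) (sub_counit_mem c) ha
    have h2 := ((G.augIdeal * θ.fixedIdeal).restrictScalars k).smul_mem (Coalgebra.counit (R := k) c) hg
    convert Ideal.add_mem _ h1 h2 using 1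
    rw [map_smul, smul_eq_mul, sub_mul, ← Algebra.smul_def, smul_sub, smul_sub]
    abel

/-- Smoothness of the fixed point group at the identity. Modulo the product ideal `f` is some `q =
θ(g) - g`, which again lies in the square of the augmentation ideal. The product rule puts `θ(q) -
q` into the product ideal, and `θ(q) - q = -2 q`. -/
theorem fixedIdeal_inf_sq {f : G.Fun} (hf : f ∈ θ.fixedIdeal)
    (hf' : f ∈ G.augIdeal * G.augIdeal) : f ∈ G.augIdeal * θ.fixedIdeal := by
  obtain ⟨g, hg⟩ := θ.exists_sub_mem hf
  have hsub : G.augIdeal * θ.fixedIdeal ≤ G.augIdeal * G.augIdeal :=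
    Ideal.mul_mono_right θ.fixedIdeal_le_augIdeal
  have hq := Ideal.sub_mem _ hf' (hsub hg)
  rw [sub_sub_cancel] at hq
  have key : ∀ q ∈ G.augIdeal * G.augIdeal, θ.pullback q - q ∈ G.augIdeal * θ.fixedIdeal := by
    intro q hq
    refine Submodule.smul_induction_on hq (fun a ha b hb => ?_) (fun a b ha hb => ?_)
    · have e : θ.pullback (a • b) - a • b =
          θ.pullback a * (θ.pullback b - b) + (θ.pullback a - a) * b := by
        rw [smul_eq_mul, map_mul]; noncomm_ring
      rw [e]
      refine Ideal.add_mem _ (Ideal.mul_mem_mul ((θ.counit a).trans ha)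
        (Ideal.subset_span ⟨b, rfl⟩)) (mul_mem_augIdeal_mul (Ideal.subset_span ⟨a, rfl⟩) ?_ hb)
      rw [map_sub, ← θ.parity]
      exact Ideal.subset_span ⟨_, rfl⟩
    · convert Ideal.add_mem _ ha hb using 1
      rw [map_add]; abel
  have h2 := key _ hq
  rw [map_sub, θ.involutive] at h2
  have h3 : (-2 : k) • (θ.pullback g - g) ∈ G.augIdeal * θ.fixedIdeal := by
    convert h2 using 1
    rw [neg_smul, two_smul]; abel
  have h4 := ((G.augIdeal * θ.fixedIdeal).restrictScalars k).smul_mem (-2 : k)⁻¹ h3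
  rw [smul_smul, inv_mul_cancel₀ (by simp), one_smul] at h4
  have := Ideal.add_mem _ hg h4
  rwa [sub_add_cancel] at this

/-- Near the identity the fixed point group agrees with its identity component: a function `s` with
`s(e) = 1` kills the idempotents cutting out the component. Taking `s` even lets it pass through
products. -/
theorem exists_mul_mem_fixedIdeal {f : G.Fun} (hf : f ∈ θ.fixedIdentityIdeal) :
    ∃ s ∈ G.gr 0, Coalgebra.counit (R := k) s = 1 ∧ s * f ∈ θ.fixedIdeal := by
  have hadd : ∀ a b, (∃ s ∈ G.gr 0, Coalgebra.counit (R := k) s = 1 ∧ s * a ∈ θ.fixedIdeal) →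
      (∃ s ∈ G.gr 0, Coalgebra.counit (R := k) s = 1 ∧ s * b ∈ θ.fixedIdeal) →
      ∃ s ∈ G.gr 0, Coalgebra.counit (R := k) s = 1 ∧ s * (a + b) ∈ θ.fixedIdeal := by
    rintro a b ⟨s, hs, h1, h2⟩ ⟨t, ht, h3, h4⟩
    have hst := SetLike.mul_mem_graded hs ht
    rw [add_zero] at hst
    refine ⟨s * t, hst, by rw [counit_mul', h1, h3, mul_one], ?_⟩
    rw [mul_add]
    refine Ideal.add_mem _ ?_ ?_
    · rw [mul_even_comm s ht, mul_assoc]; exact Ideal.mul_mem_left _ _ h2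
    · rw [mul_assoc]; exact Ideal.mul_mem_left _ _ h4
  obtain ⟨a, ha, b, hb, rfl⟩ := Submodule.mem_sup.1 hf
  refine hadd a b ⟨1, SetLike.one_mem_graded G.gr, G.counit_one, by rwa [one_mul]⟩ ?_
  clear ha hf
  induction hb using Submodule.span_induction with
  | mem e he =>
    have hc : G.parity e * e = e * G.parity e := by
      have h0 := mul_even_comm (G.oddProj e) (G.sub_oddProj_mem e)
      have h1 : G.parity e = (e - G.oddProj e) - G.oddProj e := by
        rw [parity_apply, two_smul]; abel
      have h2 : e = (e - G.oddProj e) + G.oddProj e := by abel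
      rw [h1]
      generalize G.oddProj e = v at *
      generalize e - v = u at *
      rw [h2]
      noncomm_ring [h0]
    -- The factor `1 - e` annihilates `e` modulo the fixed ideal but need not be even; its product
    -- with its parity image is.
    refine ⟨(1 - G.parity e) * (1 - e), ?_, ?_, ?_⟩
    · rw [mem_gr_zero, ClosedSubgroup.parity_mul, map_sub, map_sub, parity_parity, parity_one]
      rw [sub_mul, sub_mul, mul_sub, mul_sub, mul_sub, mul_sub, hc]
      simp only [one_mul, mul_one]; abel
    · rw [counit_mul', map_sub, map_sub, counit_parity', he.2, G.counit_one, sub_zero, mul_one]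
    · rw [mul_assoc, sub_mul 1 e e, one_mul]
      refine Ideal.mul_mem_left _ _ ?_
      rw [← neg_sub]
      exact Submodule.neg_mem _ he.1
  | zero => exact ⟨1, SetLike.one_mem_graded G.gr, G.counit_one, by simp⟩
  | add a b _ _ ha hb => exact hadd a b ha hb
  | smul c a _ ha =>
    obtain ⟨s, hs, h1, h2⟩ := ha
    refine ⟨s, hs, h1, ?_⟩
    rw [smul_eq_mul, ← mul_assoc, ← mul_even_comm c hs, mul_assoc]
    exact Ideal.mul_mem_left _ _ h2

variable {θ} {K : G.ClosedSubgroup}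

/-- Split `f` as `(1 - s) f + s f`, where `s f` falls under `fixedIdeal_inf_sq` and `1 - s` vanishes
at the identity. -/
theorem IsSymmetric.ideal_inf_sq (hK : θ.IsSymmetric K) {f : G.Fun} (hf : f ∈ K.ideal)
    (hf' : f ∈ G.augIdeal * G.augIdeal) : f ∈ G.augIdeal * K.ideal := by
  obtain ⟨s, -, h1, h2⟩ := θ.exists_mul_mem_fixedIdeal (hK.2 hf)
  have h3 := Ideal.mul_mono_right hK.1 (θ.fixedIdeal_inf_sq h2 (Ideal.mul_mem_left _ s hf'))
  have h4 : (1 - s) * f ∈ G.augIdeal * K.ideal := by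
    refine Ideal.mul_mem_mul ?_ hf
    rw [mem_augIdeal, map_sub, h1, G.counit_one, sub_self]
  have := Ideal.add_mem _ h4 h3
  rwa [← add_mul, sub_add_cancel, one_mul] at this

/-- Functions on `G/K` that vanish to second order on `G` do so on `G/K`. -/
theorem IsSymmetric.mem_maxIdeal_sq (hK : θ.IsSymmetric K) (hX : K.IsAffineQuotient)
    {b : K.quotFun} (hb : (b : G.Fun) ∈ G.augIdeal * G.augIdeal) :
    b ∈ K.maxIdeal * K.maxIdeal := by
  have h0 : b ∈ K.maxIdeal := by
    rw [K.mem_maxIdeal, ← mem_augIdeal]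
    exact Ideal.mul_le.2 (fun a _ b hb => Ideal.mul_mem_left _ a hb) hb
  exact hX.mem_sq_of_mulSpan h0
    (hX.augIdeal_mul_ideal (hK.ideal_inf_sq (K.maxIdeal_le_ideal h0) hb))

/-- Point derivations of `k[G/K]` extend to `k[G]`. -/
theorem IsSymmetric.exists_lie_extension (hK : θ.IsSymmetric K) (hX : K.IsAffineQuotient)
    (τ : Module.Dual k K.quotFun) (h1 : τ 1 = 0)
    (h2 : ∀ f ∈ K.maxIdeal * K.maxIdeal, τ f = 0) :
    ∃ x : G.lie, ∀ f : K.quotFun, (x : Module.Dual k G.Fun) f = τ f := by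
  let p : K.quotFun →ₗ[k] G.Fun ⧸ ((G.augIdeal * G.augIdeal).restrictScalars k) :=
    Submodule.mkQ _ ∘ₗ K.quotFun.toSubmodule.subtype
  have hτ : τ ∈ LinearMap.range p.dualMap := by
    rw [LinearMap.range_dualMap_eq_dualAnnihilator_ker, Submodule.mem_dualAnnihilator]
    intro f hf
    exact h2 f (hK.mem_maxIdeal_sq hX ((Submodule.Quotient.mk_eq_zero _).1 hf))
  obtain ⟨σ, rfl⟩ := hτ
  refine ⟨⟨σ ∘ₗ Submodule.mkQ _, mem_lie_of_augIdeal_sq h1 fun f hf => ?_⟩, fun f => rfl⟩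
  have : (Submodule.mkQ ((G.augIdeal * G.augIdeal).restrictScalars k)) f = 0 :=
    (Submodule.Quotient.mk_eq_zero _).2 hf
  rw [LinearMap.comp_apply, this, map_zero]

end Involution

end Supergroup

/-! ### The order filtration of the distributions and the Euler operator. -/

namespace Supergroup

variable {k : Type*} [Field k] [CharZero k] {G : Supergroup k}

open WithConv LieSuperalgebra

theorem lie_apply_of_mem {i j : ZMod 2} (hij : i ≠ j) {x : G.lie} (hx : x ∈ G.liePart i)
    {f : G.Fun} (hf : f ∈ G.gr j) : (x : Module.Dual k G.Fun) f = 0 := by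
  refine hx f ?_
  have h : ∀ i j : ZMod 2, i ≠ j → j = i + 1 := by decide
  rwa [← h i j hij]

namespace ClosedSubgroup

variable (K : G.ClosedSubgroup)

theorem mul_mem_maxIdeal_pow (i j : ℕ) {a b : K.quotFun} (ha : a ∈ K.maxIdeal ^ i)
    (hb : b ∈ K.maxIdeal ^ j) : a * b ∈ K.maxIdeal ^ (i + j) := by
  induction i generalizing a with
  | zero => rw [zero_add]; exact Ideal.mul_mem_left _ _ hb
  | succ i ih =>
    rw [maxIdeal_pow_succ] at ha
    rw [Nat.succ_add, maxIdeal_pow_succ]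
    refine Submodule.smul_induction_on ha (fun c hc d hd => ?_) (fun c d hc hd => ?_)
    · rw [smul_eq_mul, mul_assoc]; exact Ideal.mul_mem_mul hc (ih hd)
    · rw [add_mul]; exact Ideal.add_mem _ hc hd

theorem maxIdeal_pow_one : K.maxIdeal ^ 1 = K.maxIdeal := Submodule.pow_one _

theorem maxIdeal_pow_two : K.maxIdeal ^ 2 = K.maxIdeal * K.maxIdeal := by
  rw [maxIdeal_pow_succ, maxIdeal_pow_one]

theorem maxIdeal_pow_le {m n : ℕ} (h : m ≤ n) : K.maxIdeal ^ n ≤ K.maxIdeal ^ m :=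
  Ideal.pow_le_pow_right h

theorem mul_mem_maxIdeal_pow_left {n : ℕ} {a : K.quotFun} (ha : a ∈ K.maxIdeal ^ n)
    (b : K.quotFun) : a * b ∈ K.maxIdeal ^ n := by
  have := K.mul_mem_maxIdeal_pow n 0 (b := b) ha (by rw [maxIdeal_pow_zero]; trivial)
  rwa [add_zero] at this

/-- The functional `f ↦ φ(f b)` -/
def mulDist (b : K.quotFun) : Module.End k K.Dist where
  toFun φ := ⟨(φ : Module.Dual k K.quotFun) ∘ₗ LinearMap.mulRight k b, by
    obtain ⟨n, hn⟩ := φ.2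
    exact ⟨n, fun f hf => hn _ (K.mul_mem_maxIdeal_pow_left hf b)⟩⟩
  map_add' _ _ := rfl
  map_smul' _ _ := rfl

theorem mulDist_apply (b : K.quotFun) (φ : K.Dist) (f : K.quotFun) :
    (K.mulDist b φ : Module.Dual k K.quotFun) f = (φ : Module.Dual k K.quotFun) (f * b) := rfl

/-- The distributions of order less than `n` -/
def distFil (n : ℕ) : Submodule k K.Dist where
  carrier := {φ | ∀ f ∈ K.maxIdeal ^ n, (φ : Module.Dual k K.quotFun) f = 0}
  add_mem' hφ hψ f hf := by simp [hφ f hf, hψ f hf]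
  zero_mem' f _ := rfl
  smul_mem' c φ hφ f hf := by simp [hφ f hf]

variable {K}

theorem exists_mem_distFil (φ : K.Dist) : ∃ n, φ ∈ K.distFil n := φ.2

theorem distFil_mono {m n : ℕ} (h : m ≤ n) : K.distFil m ≤ K.distFil n :=
  fun _ hφ f hf => hφ f (K.maxIdeal_pow_le h hf)

theorem eq_zero_of_mem_distFil_zero {φ : K.Dist} (hφ : φ ∈ K.distFil 0) : φ = 0 :=
  Subtype.ext (LinearMap.ext fun f => hφ f (by rw [maxIdeal_pow_zero]; trivial))

theorem distAct_mem_distFil (x : G.lie) {n : ℕ} {φ : K.Dist} (hφ : φ ∈ K.distFil n) :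
    K.distAct x φ ∈ K.distFil (n + 1) := fun f hf => hφ _ (K.quotTransl_pow x.2 n f hf)

theorem mulDist_mem_distFil {b : K.quotFun} {n : ℕ} {φ : K.Dist} (hφ : φ ∈ K.distFil n) :
    K.mulDist b φ ∈ K.distFil n := fun _ hf => hφ _ (K.mul_mem_maxIdeal_pow_left hf b)

theorem mulDist_mem_distFil_of_mem {b : K.quotFun} (hb : b ∈ K.maxIdeal) {n : ℕ} {φ : K.Dist}
    (hφ : φ ∈ K.distFil (n + 1)) : K.mulDist b φ ∈ K.distFil n :=
  fun f hf => hφ _ (K.mul_mem_maxIdeal_pow n 1 hf (by rwa [maxIdeal_pow_one]))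

theorem mulDist_add (a b : K.quotFun) (φ : K.Dist) :
    K.mulDist (a + b) φ = K.mulDist a φ + K.mulDist b φ :=
  Subtype.ext (LinearMap.ext fun f => by
    change (φ : Module.Dual k K.quotFun) _ = (φ : Module.Dual k K.quotFun) _ +
      (φ : Module.Dual k K.quotFun) _
    rw [LinearMap.mulRight_apply, mul_add, map_add]; rfl)

theorem mulDist_algebraMap (c : k) (φ : K.Dist) :
    K.mulDist (algebraMap k K.quotFun c) φ = c • φ :=
  Subtype.ext (LinearMap.ext fun f => by
    rw [mulDist_apply, Algebra.algebraMap_eq_smul_one, mul_smul_comm, mul_one, map_smul]; rfl)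

theorem quotTransl_mul {i j : ZMod 2} {x : G.lie} (hx : x ∈ G.liePart i) {b : K.quotFun}
    (hb : (b : G.Fun) ∈ G.gr j) (a : K.quotFun) : K.quotTransl x (a * b) =
      koszulSign k i j • (K.quotTransl x a * b) + a * K.quotTransl x b :=
  Subtype.ext (transl_mul hx hb (a : G.Fun))

/-- The transpose of the Leibniz rule: a Weyl algebra relation between multiplications by functions
and infinitesimal translations. -/
theorem mulDist_distAct {i j : ZMod 2} {x : G.lie} (hx : x ∈ G.liePart i) {b : K.quotFun}
    (hb : (b : G.Fun) ∈ G.gr j) (φ : K.Dist) : K.mulDist b (K.distAct x φ) =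
      koszulSign k i j • K.distAct x (K.mulDist b φ) + K.mulDist (K.quotTransl x b) φ := by
  refine Subtype.ext (LinearMap.ext fun f => ?_)
  change (φ : Module.Dual k K.quotFun) (K.quotTransl x (f * b)) = _
  rw [quotTransl_mul hx hb, map_add, map_smul]; rfl

theorem quotTransl_sub_mem (x : G.lie) (b : K.quotFun) :
    K.quotTransl x b - algebraMap k K.quotFun ((x : Module.Dual k G.Fun) b) ∈ K.maxIdeal := by
  have h := K.sub_counit_mem_maxIdeal (K.quotTransl x b)
  rwa [coe_quotTransl, counit_transl] at h

/-- Modulo lower order, `b (x φ)` is `± x (b φ) + x(b) φ`. -/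
theorem mulDist_distAct_sub_mem {i j : ZMod 2} {x : G.lie} (hx : x ∈ G.liePart i) {b : K.quotFun}
    (hb : (b : G.Fun) ∈ G.gr j) {n : ℕ} {φ : K.Dist} (hφ : φ ∈ K.distFil (n + 1)) :
    K.mulDist b (K.distAct x φ) - (koszulSign k i j • K.distAct x (K.mulDist b φ) +
      (x : Module.Dual k G.Fun) b • φ) ∈ K.distFil n := by
  have h := mulDist_mem_distFil_of_mem (quotTransl_sub_mem x b) hφ
  have e := mulDist_add (K.quotTransl x b - algebraMap k K.quotFun ((x : Module.Dual k G.Fun) b))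
    (algebraMap k K.quotFun ((x : Module.Dual k G.Fun) b)) φ
  rw [sub_add_cancel, mulDist_algebraMap] at e
  rw [mulDist_distAct hx hb, e]
  convert h using 1
  abel

variable (K)

/-- The distribution `f ↦ f(eK)` -/
def delta : K.Dist := ⟨counit (R := k) ∘ₗ K.quotFun.toSubmodule.subtype, 1, fun f hf => by
  rw [maxIdeal_pow_one] at hf; exact hf⟩

theorem delta_apply (f : K.quotFun) :
    (K.delta : Module.Dual k K.quotFun) f = counit (R := k) (f : G.Fun) := rfl

theorem delta_ne_zero : K.delta ≠ 0 := by
  intro h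
  have := congrArg (fun φ : K.Dist => (φ : Module.Dual k K.quotFun) 1) h
  simp only [delta_apply] at this
  exact one_ne_zero (G.counit_one.symm.trans this)

theorem delta_mem_distFil : K.delta ∈ K.distFil 1 := fun f hf => by
  rw [maxIdeal_pow_one] at hf; exact hf

theorem mulDist_delta {b : K.quotFun} (hb : b ∈ K.maxIdeal) : K.mulDist b K.delta = 0 :=
  eq_zero_of_mem_distFil_zero (mulDist_mem_distFil_of_mem hb K.delta_mem_distFil)

theorem eq_smul_delta {φ : K.Dist} (hφ : φ ∈ K.distFil 1) :
    φ = (φ : Module.Dual k K.quotFun) 1 • K.delta := by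
  refine Subtype.ext (LinearMap.ext fun f => ?_)
  have h := hφ _ (by rw [maxIdeal_pow_one]; exact K.sub_counit_mem_maxIdeal f)
  rw [map_sub, sub_eq_zero, Algebra.algebraMap_eq_smul_one, map_smul, smul_eq_mul, mul_comm] at h
  exact h

theorem distAct_delta {x : G.lie} (hx : x ∈ K.lie.toSubmodule) : K.distAct x K.delta = 0 := by
  refine Subtype.ext (LinearMap.ext fun f => ?_)
  change counit (R := k) (transl (x : Module.Dual k G.Fun) (f : G.Fun)) = 0
  rw [counit_transl]
  have h := hx _ (K.maxIdeal_le_ideal (K.sub_counit_mem_maxIdeal f))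
  change (x : Module.Dual k G.Fun) ((f : G.Fun) - algebraMap k G.Fun _) = 0 at h
  rwa [map_sub, Algebra.algebraMap_eq_smul_one, map_smul, lie_one, smul_zero, sub_zero] at h

/-- Dual homogeneous families in `𝔤`, spanning `𝔤` modulo `𝔨`, and in the maximal ideal `𝔪` of
`k[G/K]`, spanning `𝔪` modulo its square. -/
structure IsDualBasis {κ : Type*} [Fintype κ] (p : κ → ZMod 2) (x : κ → G.lie)
    (b : κ → K.quotFun) : Prop where
  mem_liePart : ∀ i, x i ∈ G.liePart (p i)
  mem_gr : ∀ i, (b i : G.Fun) ∈ G.gr (p i)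
  mem_maxIdeal : ∀ i, b i ∈ K.maxIdeal
  sub_mem_sq : ∀ a ∈ K.maxIdeal, a - ∑ i, (x i : Module.Dual k G.Fun) a • b i ∈ K.maxIdeal ^ 2
  sub_mem_lie : ∀ y : G.lie, y - ∑ i, (y : Module.Dual k G.Fun) (b i) • x i ∈ K.lie.toSubmodule

variable {K}

/-- Pair the parts of `𝔤` with the homogeneous functions of the maximal ideal, parity by parity. The
identity `y(a) = ∑ x_i(a) y(b_i)` has two readings. The difference `y - ∑ y(b_i) x_i` kills the
maximal ideal and so lies in `𝔨`. The difference `a - ∑ x_i(a) b_i` is killed by all of `𝔤` and so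
lies in the square, because tangent vectors of `G/K` extend to `G`. -/
theorem _root_.Supergroup.Involution.IsSymmetric.exists_isDualBasis {θ : G.Involution}
    (hK : θ.IsSymmetric K) (hX : K.IsAffineQuotient) :
    ∃ (n : ℕ) (p : Fin n → ZMod 2) (x : Fin n → G.lie) (b : Fin n → K.quotFun),
      K.IsDualBasis p x b := by
  let M : ZMod 2 → Submodule k G.Fun := fun i =>
    (K.quotFun.toSubmodule ⊓ G.augIdeal.restrictScalars k) ⊓ G.gr i
  have hp : ∀ i, ∃ (n : ℕ) (x : Fin n → G.liePart i) (b : Fin n → M i),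
      ∀ (v : G.liePart i) (w : M i), ((v : G.lie) : Module.Dual k G.Fun) w =
        ∑ j, ((x j : G.lie) : Module.Dual k G.Fun) w * ((v : G.lie) : Module.Dual k G.Fun) (b j) :=
    fun i => exists_pairing_eq_sum
      (((M i).subtype.lcomp k k) ∘ₗ G.lie.subtype ∘ₗ (G.liePart i).subtype)
  obtain ⟨n0, x0, b0, h0⟩ := hp 0
  obtain ⟨n1, x1, b1, h1⟩ := hp 1
  let p : Fin (n0 + n1) → ZMod 2 := Fin.append (fun _ => 0) (fun _ => 1)
  let x : Fin (n0 + n1) → G.lie := Fin.append (fun i => x0 i) (fun i => x1 i)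
  let b : Fin (n0 + n1) → K.quotFun := Fin.append (fun i => ⟨b0 i, (b0 i).2.1.1⟩)
    (fun i => ⟨b1 i, (b1 i).2.1.1⟩)
  have hx : ∀ i, x i ∈ G.liePart (p i) := fun i =>
    Fin.addCases (fun i => by simp [x, p]) (fun i => by simp [x, p]) i
  have hb : ∀ i, (b i : G.Fun) ∈ G.gr (p i) := fun i =>
    Fin.addCases (fun i => by simpa [b, p] using (b0 i).2.2)
      (fun i => by simpa [b, p] using (b1 i).2.2) i
  have hbm : ∀ i, b i ∈ K.maxIdeal := fun i =>
    Fin.addCases (fun i => by simp only [b, Fin.append_left]; exact (b0 i).2.1.2)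
      (fun i => by simp only [b, Fin.append_right]; exact (b1 i).2.1.2) i
  have key : ∀ (y : G.lie) (a : K.quotFun), a ∈ K.maxIdeal → (y : Module.Dual k G.Fun) a =
      ∑ i, (x i : Module.Dual k G.Fun) a * (y : Module.Dual k G.Fun) (b i) := by
    intro y a ha
    have hsum : ∀ (y : G.lie) (a : K.quotFun),
        ∑ i, (x i : Module.Dual k G.Fun) a * (y : Module.Dual k G.Fun) (b i) =
        ∑ i, ((x0 i : G.lie) : Module.Dual k G.Fun) a * (y : Module.Dual k G.Fun) (b0 i) +
        ∑ i, ((x1 i : G.lie) : Module.Dual k G.Fun) a * (y : Module.Dual k G.Fun) (b1 i) := by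
      intro y a
      simp [Fin.sum_univ_add, x, b]
    have hom : ∀ (i j : ZMod 2) (y : G.lie) (a : K.quotFun), y ∈ G.liePart i → a ∈ K.maxIdeal →
        (a : G.Fun) ∈ G.gr j → (y : Module.Dual k G.Fun) a =
          ∑ i, (x i : Module.Dual k G.Fun) a * (y : Module.Dual k G.Fun) (b i) := by
      intro i j y a hy ha hj
      rw [hsum]
      by_cases hij : i = j
      · subst hij
        rcases zmod2_cases i with rfl | rfl
        · rw [Finset.sum_eq_zero (fun i _ => by
            rw [lie_apply_of_mem (by decide) (x1 i).2 hj, zero_mul]) (s := Finset.univ (α := Fin n1)),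
            add_zero]
          exact h0 ⟨y, hy⟩ ⟨a, ⟨a.2, ha⟩, hj⟩
        · rw [Finset.sum_eq_zero (fun i _ => by
            rw [lie_apply_of_mem (by decide) (x0 i).2 hj, zero_mul]) (s := Finset.univ (α := Fin n0)),
            zero_add]
          exact h1 ⟨y, hy⟩ ⟨a, ⟨a.2, ha⟩, hj⟩
      · rw [lie_apply_of_mem hij hy hj, ← hsum, eq_comm]
        refine Finset.sum_eq_zero fun l _ => ?_
        by_cases hl : p l = j
        · have hne : i ≠ p l := by rwa [hl]
          rw [lie_apply_of_mem hne hy (hb l), mul_zero]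
        · rw [lie_apply_of_mem hl (hx l) hj, zero_mul]
    have hom2 : ∀ (j : ZMod 2) (a : K.quotFun), a ∈ K.maxIdeal →
        (a : G.Fun) ∈ G.gr j → (y : Module.Dual k G.Fun) a =
          ∑ i, (x i : Module.Dual k G.Fun) a * (y : Module.Dual k G.Fun) (b i) := by
      intro j a ha hj
      obtain ⟨y0, hy0, y1, hy1, rfl⟩ := exists_even_add_odd (k := k) y
      have e0 := hom 0 j y0 a hy0 ha hj
      have e1 := hom 1 j y1 a hy1 ha hj
      simp only [Submodule.coe_add, LinearMap.add_apply, mul_add, Finset.sum_add_distrib, ← e0, ← e1]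
    have ha1 : G.oddProj a ∈ K.quotFun := K.oddProj_mem_quotFun a.2
    have e1 := hom2 1 ⟨G.oddProj a, ha1⟩ (oddProj_mem_augIdeal _) (G.oddProj_mem _)
    have e0 := hom2 0 (a - ⟨G.oddProj a, ha1⟩)
      (K.maxIdeal.sub_mem ha (oddProj_mem_augIdeal (a : G.Fun))) (G.sub_oddProj_mem _)
    have ea : a = (a - ⟨G.oddProj a, ha1⟩) + ⟨G.oddProj a, ha1⟩ := (sub_add_cancel _ _).symm
    rw [ea]
    simp only [Subalgebra.coe_add, map_add, add_mul, Finset.sum_add_distrib]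
    rw [e0, e1]
  refine ⟨n0 + n1, p, x, b, hx, hb, hbm, fun a ha => ?_, fun y => hX.mem_lie fun a ha => ?_⟩
  · set c := a - ∑ i, (x i : Module.Dual k G.Fun) a • b i with hc
    have hcm : c ∈ K.maxIdeal := K.maxIdeal.sub_mem ha (Submodule.sum_mem _ fun i _ =>
      (K.maxIdeal.restrictScalars k).smul_mem _ (hbm i))
    have hyc : ∀ y : G.lie, (y : Module.Dual k G.Fun) c = 0 := by
      intro y
      rw [hc]
      simp [key y a ha]
    rw [maxIdeal_pow_two]
    by_contra hn
    -- The constants are added to the square so that the separating functional also kills `1` and is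
    -- a point derivation.
    have hn' : c ∉ (K.maxIdeal * K.maxIdeal).restrictScalars k ⊔
        Submodule.span k {(1 : K.quotFun)} := by
      intro h
      obtain ⟨u, hu, v, hv, e⟩ := Submodule.mem_sup.1 h
      obtain ⟨t, rfl⟩ := Submodule.mem_span_singleton.1 hv
      have hu' : u ∈ K.maxIdeal := Ideal.mul_le.2 (fun a _ b hb => Ideal.mul_mem_left _ a hb) hu
      have h1 : t • (1 : K.quotFun) ∈ K.maxIdeal := by
        rw [← add_sub_cancel_left u (t • (1 : K.quotFun)), e]
        exact Ideal.sub_mem _ hcm hu'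
      have h2 : counit (R := k) ((t • (1 : K.quotFun) : K.quotFun) : G.Fun) = 0 := h1
      rw [Subalgebra.coe_smul, map_smul, Subalgebra.coe_one, G.counit_one, smul_eq_mul,
        mul_one] at h2
      rw [h2, zero_smul, add_zero] at e
      exact hn (e ▸ hu)
    obtain ⟨τ, hτ, hle⟩ := Submodule.exists_le_ker_of_notMem hn'
    obtain ⟨y, hy⟩ := hK.exists_lie_extension hX τ
      (hle (Submodule.mem_sup_right (Submodule.mem_span_singleton_self _)))
      (fun f hf => hle (Submodule.mem_sup_left hf))
    exact hτ ((hy c).symm.trans (hyc y))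
  · simp only [Submodule.coe_sub, Submodule.coe_sum, Submodule.coe_smul, LinearMap.sub_apply,
      LinearMap.sum_apply, LinearMap.smul_apply, smul_eq_mul]
    rw [key y a ha, sub_eq_zero]
    exact Finset.sum_congr rfl fun i _ => mul_comm _ _

namespace IsDualBasis

variable {κ : Type*} [Fintype κ] {p : κ → ZMod 2} {x : κ → G.lie} {b : κ → K.quotFun}
  (hb : K.IsDualBasis p x b)
include hb

theorem sum_quotTransl_mul (a g : K.quotFun) : ∑ i, K.quotTransl (x i) (a * g) * b i =
    (∑ i, K.quotTransl (x i) a * b i) * g + a * ∑ i, K.quotTransl (x i) g * b i := by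
  rw [Finset.sum_mul, Finset.mul_sum, ← Finset.sum_add_distrib]
  exact Finset.sum_congr rfl fun i _ =>
    Subtype.ext (transl_mul_mul (hb.mem_liePart i) (hb.mem_gr i) (a : G.Fun) g)

/-- The Euler operator `f ↦ ∑ (x_i f) b_i` multiplies functions of order `n` by `n`, modulo higher
order. -/
theorem euler (n : ℕ) : ∀ f ∈ K.maxIdeal ^ n,
    ∑ i, K.quotTransl (x i) f * b i - (n : k) • f ∈ K.maxIdeal ^ (n + 1) := by
  induction n with
  | zero =>
    intro f _
    rw [Nat.cast_zero, zero_smul, sub_zero, zero_add, maxIdeal_pow_one]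
    exact Ideal.sum_mem _ fun i _ => Ideal.mul_mem_left _ _ (hb.mem_maxIdeal i)
  | succ n ih =>
    intro f hf
    rw [maxIdeal_pow_succ] at hf
    refine Submodule.smul_induction_on hf (fun a ha g hg => ?_) (fun a c ha hc => ?_)
    · have h1 : ∑ i, K.quotTransl (x i) a * b i - a ∈ K.maxIdeal ^ 2 := by
        have h2 : ∑ i, (K.quotTransl (x i) a -
            algebraMap k K.quotFun ((x i : Module.Dual k G.Fun) a)) * b i ∈ K.maxIdeal ^ 2 := by
          rw [maxIdeal_pow_two]
          exact Ideal.sum_mem _ fun i _ =>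
            Ideal.mul_mem_mul (quotTransl_sub_mem _ _) (hb.mem_maxIdeal i)
        convert Ideal.sub_mem _ h2 (hb.sub_mem_sq a ha) using 1
        simp only [sub_mul, Finset.sum_sub_distrib, ← Algebra.smul_def]
        abel
      have e1 := K.mul_mem_maxIdeal_pow 2 n h1 hg
      have e2 := K.mul_mem_maxIdeal_pow 1 (n + 1) (by rwa [maxIdeal_pow_one]) (ih g hg)
      rw [add_comm 2 n] at e1
      rw [add_comm 1 (n + 1)] at e2
      convert Ideal.add_mem _ e1 e2 using 1
      rw [smul_eq_mul, hb.sum_quotTransl_mul, mul_sub, sub_mul, mul_smul_comm, Nat.cast_succ,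
        add_smul, one_smul]
      abel
    · convert Ideal.add_mem _ ha hc using 1
      simp only [map_add, add_mul, Finset.sum_add_distrib, smul_add]
      abel

/-- The transpose of `euler`. -/
theorem sum_distAct_mulDist_sub_mem {n : ℕ} {φ : K.Dist} (hφ : φ ∈ K.distFil (n + 1)) :
    ∑ i, K.distAct (x i) (K.mulDist (b i) φ) - (n : k) • φ ∈ K.distFil n := by
  intro f hf
  have h := hφ _ (hb.euler n f hf)
  rw [map_sub, map_sum, map_smul] at h
  have e : ((∑ i, K.distAct (x i) (K.mulDist (b i) φ) : K.Dist) : Module.Dual k K.quotFun) f =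
      ∑ i, (φ : Module.Dual k K.quotFun) (K.quotTransl (x i) f * b i) := by
    rw [Submodule.coe_sum, LinearMap.sum_apply]; rfl
  rw [Submodule.coe_sub, LinearMap.sub_apply, e]
  exact h

/-- Distributions are generated by the point distribution. -/
theorem distFil_succ_le {n : ℕ} {W : Submodule k K.Dist} (h0 : K.delta ∈ W)
    (h1 : K.distFil n ≤ W) (h2 : ∀ i, ∀ φ ∈ K.distFil n, K.distAct (x i) φ ∈ W) :
    K.distFil (n + 1) ≤ W := by
  intro φ hφ
  rcases Nat.eq_zero_or_pos n with rfl | hn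
  · rw [K.eq_smul_delta hφ]; exact W.smul_mem _ h0
  -- Multiplication by `b i` lowers the order, so the Euler sum lies in `W`; it differs from `n φ`
  -- by an element of `W`, and `n` is invertible. The case `n = 0`, where this fails, consists of
  -- multiples of the point distribution.
  · have h := h1 (hb.sum_distAct_mulDist_sub_mem hφ)
    have h3 : ∑ i, K.distAct (x i) (K.mulDist (b i) φ) ∈ W := Submodule.sum_mem _ fun i _ =>
      h2 i _ (mulDist_mem_distFil_of_mem (hb.mem_maxIdeal i) hφ)
    have h4 := W.sub_mem h3 h
    rw [sub_sub_cancel] at h4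
    exact (Submodule.smul_mem_iff _ (Nat.cast_ne_zero.2 hn.ne')).1 h4

end IsDualBasis

end ClosedSubgroup

end Supergroup

/-! ### Distributions as quotients of enveloping algebras. -/

namespace Supergroup

variable {k : Type*} [Field k] [CharZero k] {G : Supergroup k}

open WithConv LieSuperalgebra

namespace ClosedSubgroup

variable {K : G.ClosedSubgroup} {L : Type*} [AddCommGroup L] [Module k L] [LieSuperalgebra k L]
  {f : Hom k L G.lie} {s : Submodule k L} (hs : ∀ x, x ∈ s ↔ f.toLinearMap x ∈ K.lie.toSubmodule)

variable (K f) in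
/-- The action of `L` on distributions through a homomorphism to the Lie superalgebra of `G`. -/
abbrev distActComp : L →ₗ[k] Module.End k K.Dist := K.distAct ∘ₗ f.toLinearMap

theorem isRep_distActComp : IsRep (K.distActComp f) := K.isRep_distAct.comp f

/-- The map `[u] ↦ u δ` from `U(L) / U(L) s` to `Dist(G/K, eK)`. -/
def uquotToDist : UQuot s →ₗ[k] K.Dist :=
  UQuot.lift isRep_distActComp K.delta fun x hx => K.distAct_delta ((hs x).1 hx)

theorem uquotToDist_mk (u : U k L) :
    uquotToDist hs (UQuot.mk s u) = (isRep_distActComp (K := K) (f := f)).lift u K.delta := rfl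

theorem uquotToDist_one : uquotToDist hs (UQuot.mk s 1) = K.delta := by
  rw [uquotToDist_mk, map_one]; rfl

theorem uquotToDist_act (x : L) (w : UQuot s) :
    uquotToDist hs (UQuot.act s x w) = K.distAct (f.toLinearMap x) (uquotToDist hs w) :=
  UQuot.lift_act x w

variable (s) in
/-- The filtration of `U(L) / U(L) s` by degree -/
abbrev uquotFil (n : ℕ) : Submodule k (UQuot s) :=
  fil (UQuot.act s) ⊤ (Submodule.span k {UQuot.mk s 1}) n

theorem exists_mem_uquotFil (w : UQuot s) : ∃ n, w ∈ uquotFil s n := by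
  obtain ⟨u, rfl⟩ := UQuot.mk_surjective w
  rw [← UQuot.act_lift_one]
  exact exists_mem_fil_of_isRep _ (fun x n v hv => ⟨n + 1, act_mem_fil (S := ⊤) Submodule.mem_top hv⟩)
    ⟨1, by rw [fil_one]; exact Submodule.mem_span_singleton_self _⟩ u

theorem uquotToDist_mem_distFil {n : ℕ} {w : UQuot s} (hw : w ∈ uquotFil s n) :
    uquotToDist hs w ∈ K.distFil n := by
  induction n generalizing w with
  | zero => rw [(Submodule.mem_bot k).1 hw, map_zero]; exact Submodule.zero_mem _
  | succ n ih =>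
    refine fil_succ_le (W := (K.distFil (n + 1)).comap (uquotToDist hs)) ?_ (fun x _ v hv => ?_) hw
    · rw [Submodule.span_singleton_le_iff_mem, Submodule.mem_comap, uquotToDist_one]
      exact distFil_mono (Nat.le_add_left 1 n) K.delta_mem_distFil
    · rw [Submodule.mem_comap, uquotToDist_act]
      exact distAct_mem_distFil _ (ih hv)

include hs in
-- Elements of `s` kill the class of `1`. Commuting them through a product leaves only brackets,
-- which do not lengthen it.
theorem act_mem_uquotFil_of_mem {z : L} (hz : z ∈ s) {n : ℕ} {w : UQuot s}
    (hw : w ∈ uquotFil s n) : UQuot.act s z w ∈ uquotFil s n := by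
  have hhom : ∀ (i : ZMod 2), ∀ z ∈ part (k := k) i, z ∈ s → ∀ n, ∀ w ∈ uquotFil s n,
      UQuot.act s z w ∈ uquotFil s n := by
    intro i z hzi hz n
    induction n with
    | zero => intro w hw; rw [(Submodule.mem_bot k).1 hw, map_zero]; exact Submodule.zero_mem _
    | succ n ih =>
      refine fil_succ_le (W := (uquotFil s (n + 1)).comap (UQuot.act s z)) ?_ (fun x _ v hv => ?_)
      · rw [Submodule.span_singleton_le_iff_mem, Submodule.mem_comap, UQuot.act_one hz]
        exact Submodule.zero_mem _
      · have hom : ∀ j, ∀ x ∈ part (k := k) (L := L) j,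
            UQuot.act s z (UQuot.act s x v) ∈ uquotFil s (n + 1) := by
          intro j x hx
          rw [isRep_act s hzi hx]
          exact Submodule.add_mem _ (Submodule.smul_mem _ _ (act_mem_fil trivial (ih v hv)))
            (act_mem_fil trivial hv)
        obtain ⟨x0, h0, x1, h1, rfl⟩ := exists_even_add_odd (k := k) x
        rw [Submodule.mem_comap, map_add, LinearMap.add_apply, map_add]
        exact Submodule.add_mem _ (hom 0 x0 h0) (hom 1 x1 h1)
  -- The homogeneous parts of `z` again lie in `s`, since their images are the homogeneous parts of
  -- an element of the graded subspace `𝔨`.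
  obtain ⟨z0, h0, z1, h1, rfl⟩ := exists_even_add_odd (k := k) z
  have hz' := (hs _).1 hz
  rw [map_add] at hz'
  obtain ⟨y, hy, t, ht, hy0, ht1, e⟩ := K.lie.graded _ hz'
  have hd := (LieSuperalgebra.isCompl (k := k) (L := G.lie)).disjoint
  have e2 : f.toLinearMap z0 - y = t - f.toLinearMap z1 := by
    rw [sub_eq_sub_iff_add_eq_add, e, add_comm]
  have e3 : f.toLinearMap z0 - y = 0 := by
    refine Submodule.disjoint_def.1 hd _ (Submodule.sub_mem _ (f.map_part 0 _ h0) hy0) ?_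
    rw [e2]
    exact Submodule.sub_mem _ ht1 (f.map_part 1 _ h1)
  rw [e3, eq_comm, sub_eq_zero] at e2
  rw [sub_eq_zero] at e3
  rw [map_add, LinearMap.add_apply]
  refine Submodule.add_mem _ (hhom 0 z0 h0 ((hs _).2 ?_) n w hw)
    (hhom 1 z1 h1 ((hs _).2 ?_) n w hw)
  · rw [e3]; exact hy
  · rw [← e2]; exact ht

variable {κ : Type*} [Fintype κ] {p : κ → ZMod 2} {x : κ → G.lie} {b : κ → K.quotFun}
  (hb : K.IsDualBasis p x b) {x' : κ → L} (hx' : ∀ i, f.toLinearMap (x' i) = x i)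
  (hp : ∀ i, x' i ∈ part (k := k) (p i))
include hb hx' hp

/-- Functions do not act on `U(L) / U(L) s`, so the product of `b i` with the distribution of `w` is
lifted by hand, up to lower order, as `v i`. The last clause is the Euler relation upstairs. For `n
= 0` the truncated `n - 1` is `0`, and the second clause is an equality. -/
theorem IsDualBasis.exists_lift_mulDist (n : ℕ) {w : UQuot s} (hw : w ∈ uquotFil s (n + 1)) :
    ∃ v : κ → UQuot s, (∀ i, v i ∈ uquotFil s n) ∧
      (∀ i, uquotToDist hs (v i) - K.mulDist (b i) (uquotToDist hs w) ∈ K.distFil (n - 1)) ∧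
      ∑ i, UQuot.act s (x' i) (v i) - (n : k) • w ∈ uquotFil s n := by
  induction n generalizing w with
  | zero =>
    rw [zero_add, uquotFil, fil_one] at hw
    obtain ⟨c, rfl⟩ := Submodule.mem_span_singleton.1 hw
    refine ⟨0, fun i => Submodule.zero_mem _, fun i => ?_, by simp⟩
    rw [map_smul, map_smul, uquotToDist_one, K.mulDist_delta (hb.mem_maxIdeal i), smul_zero]
    simp
  | succ n ih =>
    let W : Submodule k (UQuot s) :=
      { carrier := {w | ∃ v : κ → UQuot s, (∀ i, v i ∈ uquotFil s (n + 1)) ∧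
          (∀ i, uquotToDist hs (v i) - K.mulDist (b i) (uquotToDist hs w) ∈
            K.distFil (n + 1 - 1)) ∧
          ∑ i, UQuot.act s (x' i) (v i) - ((n + 1 : ℕ) : k) • w ∈ uquotFil s (n + 1)}
        add_mem' := by
          rintro w w' ⟨v, h1, h2, h3⟩ ⟨v', h1', h2', h3'⟩
          refine ⟨v + v', fun i => Submodule.add_mem _ (h1 i) (h1' i), fun i => ?_, ?_⟩
          · convert Submodule.add_mem _ (h2 i) (h2' i) using 1
            simp only [Pi.add_apply, map_add]; abel
          · convert Submodule.add_mem _ h3 h3' using 1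
            simp only [Pi.add_apply, map_add, Finset.sum_add_distrib, smul_add]; abel
        zero_mem' := ⟨0, fun i => Submodule.zero_mem _, fun i => by simp, by simp⟩
        smul_mem' := by
          rintro c w ⟨v, h1, h2, h3⟩
          refine ⟨c • v, fun i => Submodule.smul_mem _ _ (h1 i), fun i => ?_, ?_⟩
          · convert Submodule.smul_mem _ c (h2 i) using 1
            simp only [Pi.smul_apply, map_smul, smul_sub]
          · convert Submodule.smul_mem _ c h3 using 1
            simp only [Pi.smul_apply, map_smul, smul_sub, Finset.smul_sum, smul_comm c] }
    refine fil_succ_le (W := W) ?_ (fun y _ w hw => ?_) hw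
    · rw [Submodule.span_singleton_le_iff_mem]
      refine ⟨0, fun i => Submodule.zero_mem _, fun i => ?_, ?_⟩
      · rw [uquotToDist_one, K.mulDist_delta (hb.mem_maxIdeal i)]
        simp
      · simp only [Pi.zero_apply, map_zero, Finset.sum_const_zero, zero_sub]
        exact Submodule.neg_mem _ (Submodule.smul_mem _ _
          (le_fil_succ n (Submodule.mem_span_singleton_self _)))
    · obtain ⟨v, h1, h2, h3⟩ := ih hw
      have hom : ∀ j, ∀ y ∈ part (k := k) (L := L) j, UQuot.act s y w ∈ W := by
        intro j y hy
        have hy' := f.map_part j y hy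
        change f.toLinearMap y ∈ G.liePart j at hy'
        -- The formal Leibniz rule: modulo lower order, `b_i (y w)` is `± y (b_i w) + y(b_i) w`.
        refine ⟨fun i => koszulSign k j (p i) • UQuot.act s y (v i) +
          (f.toLinearMap y : Module.Dual k G.Fun) (b i) • w, fun i => ?_, fun i => ?_, ?_⟩
        · exact Submodule.add_mem _ (Submodule.smul_mem _ _ (act_mem_fil trivial (h1 i)))
            (Submodule.smul_mem _ _ hw)
        · have e1 := mulDist_distAct_sub_mem hy' (hb.mem_gr i) (uquotToDist_mem_distFil hs hw)
          have e2 : K.distAct (f.toLinearMap y)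
              (uquotToDist hs (v i) - K.mulDist (b i) (uquotToDist hs w)) ∈ K.distFil n := by
            rcases Nat.eq_zero_or_pos n with rfl | hn
            · rw [eq_zero_of_mem_distFil_zero (h2 i), map_zero]; exact Submodule.zero_mem _
            · have := distAct_mem_distFil (f.toLinearMap y) (h2 i)
              rwa [Nat.sub_add_cancel hn] at this
          rw [Nat.add_sub_cancel]
          convert Submodule.sub_mem _ (Submodule.smul_mem _ (koszulSign k j (p i)) e2) e1 using 1
          rw [map_add, map_smul, map_smul, uquotToDist_act, uquotToDist_act, map_sub, smul_sub]
          abel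
        · have e1 : ∀ i, UQuot.act s (x' i) (koszulSign k j (p i) • UQuot.act s y (v i)) =
              UQuot.act s y (UQuot.act s (x' i) (v i)) -
                UQuot.act s (bracket (k := k) y (x' i)) (v i) := by
            intro i
            rw [isRep_act s hy (hp i), add_sub_cancel_right, map_smul]
          -- Modulo `s`, which does not raise the degree, `∑ y(b_i) x_i` is `y`. This contributes
          -- the extra `y w` that turns the factor `n + 1` into `n + 2`.
          have e2 : y - ∑ i, (f.toLinearMap y : Module.Dual k G.Fun) (b i) • x' i ∈ s := by
            rw [hs, map_sub, map_sum]
            simp only [map_smul, hx']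
            exact hb.sub_mem_lie _
          have e3 := act_mem_uquotFil_of_mem hs e2 hw
          have e4 := act_mem_fil (r := UQuot.act s) (S := ⊤) (x := y) trivial h3
          have e5 : ∑ i, UQuot.act s (bracket (k := k) y (x' i)) (v i) ∈ uquotFil s (n + 1) :=
            Submodule.sum_mem _ fun i _ => act_mem_fil trivial (h1 i)
          convert Submodule.sub_mem _ (Submodule.sub_mem _ e4 e3) e5 using 1
          simp only [map_add, e1, map_sub, map_sum, map_smul, LinearMap.sub_apply,
            LinearMap.sum_apply, LinearMap.smul_apply, Finset.sum_add_distrib,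
            Finset.sum_sub_distrib, Nat.cast_succ, add_smul, one_smul]
          abel
      obtain ⟨y0, h0, y1, h1, rfl⟩ := exists_even_add_odd (k := k) y
      rw [map_add, LinearMap.add_apply]
      exact Submodule.add_mem _ (hom 0 y0 h0) (hom 1 y1 h1)

/-- If the distribution of `w` has lower order than the degree of `w` predicts, so have those of the
lifts `v i`, which by induction drop a degree. The Euler relation makes a nonzero multiple of `w`
drop as well. This takes the place of a symbol computation with the Poincaré–Birkhoff–Witt theorem.
-/
theorem IsDualBasis.mem_uquotFil (n : ℕ) {w : UQuot s} (hw : w ∈ uquotFil s (n + 1))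
    (hw' : uquotToDist hs w ∈ K.distFil n) : w ∈ uquotFil s n := by
  induction n generalizing w with
  | zero =>
    rw [zero_add, uquotFil, fil_one] at hw
    obtain ⟨c, rfl⟩ := Submodule.mem_span_singleton.1 hw
    have h := eq_zero_of_mem_distFil_zero hw'
    rw [map_smul, uquotToDist_one, smul_eq_zero] at h
    rw [h.resolve_right K.delta_ne_zero, zero_smul]
    exact Submodule.zero_mem _
  | succ n ih =>
    obtain ⟨v, h1, h2, h3⟩ := hb.exists_lift_mulDist hs hx' hp (n + 1) hw
    have h4 : ∑ i, UQuot.act s (x' i) (v i) ∈ uquotFil s (n + 1) := by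
      refine Submodule.sum_mem _ fun i _ => act_mem_fil trivial (ih (h1 i) ?_)
      have := Submodule.add_mem _ (h2 i) (mulDist_mem_distFil_of_mem (hb.mem_maxIdeal i) hw')
      rwa [sub_add_cancel] at this
    have h5 := Submodule.sub_mem _ h4 h3
    rw [sub_sub_cancel] at h5
    exact (Submodule.smul_mem_iff _ (Nat.cast_ne_zero.2 n.succ_ne_zero)).1 h5

/-- Stated for a homomorphism from `L` so as to serve both for `𝔤` acting on `G/K` and for `𝔤₀`,
through its identification with the Lie algebra of `G₀`, acting on `G₀/K₀`. -/
theorem IsDualBasis.uquotToDist_bijective : Function.Bijective (uquotToDist hs) := by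
  constructor
  · rw [injective_iff_map_eq_zero]
    intro w hw
    obtain ⟨n, hn⟩ := exists_mem_uquotFil w
    induction n with
    | zero => exact (Submodule.mem_bot k).1 hn
    | succ n ih =>
      exact ih (hb.mem_uquotFil hs hx' hp n hn (by rw [hw]; exact Submodule.zero_mem _))
  · intro φ
    obtain ⟨n, hn⟩ := exists_mem_distFil φ
    induction n generalizing φ with
    | zero => exact ⟨0, by rw [eq_zero_of_mem_distFil_zero hn, map_zero]⟩
    | succ n ih =>
      refine hb.distFil_succ_le (W := LinearMap.range (uquotToDist hs)) ⟨_, uquotToDist_one hs⟩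
        (fun φ hφ => ih φ hφ) (fun i φ hφ => ?_) hn
      obtain ⟨w, rfl⟩ := ih φ hφ
      exact ⟨UQuot.act s (x' i) w, by rw [uquotToDist_act, hx']⟩

end ClosedSubgroup

end Supergroup

namespace Supergroup

variable {k : Type*} [Field k] [CharZero k] {G : Supergroup k}

open WithConv LieSuperalgebra

/-! ### The eigenspaces of the involution -/

namespace Involution

variable {θ : G.Involution} {K K' : G.ClosedSubgroup}

theorem fixedIdeal_apply {x : G.lie} (hx : ∀ f, (x : Module.Dual k G.Fun) (θ.pullback f) =
    (x : Module.Dual k G.Fun) f) : ∀ f ∈ θ.fixedIdeal, (x : Module.Dual k G.Fun) f = 0 := by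
  intro f hf
  unfold fixedIdeal at hf
  induction hf using Submodule.span_induction with
  | mem u hu => obtain ⟨g, rfl⟩ := hu; rw [map_sub, hx, sub_self]
  | zero => exact map_zero _
  | add a b _ _ ha hb => rw [map_add, ha, hb, add_zero]
  | smul c a ha' ha =>
    have : Coalgebra.counit (R := k) a = 0 := θ.fixedIdeal_le_augIdeal ha'
    rw [smul_eq_mul, x.2, ha, this, mul_zero, mul_zero, add_zero]

/-- The idempotents that cut out the identity component do not matter: for `e * e - e` in the fixed
ideal with `e` zero at the identity, the Leibniz rule gives `x(e * e) = 0`, so an invariant `x`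
kills `e`. -/
theorem IsSymmetric.mem_lie_iff (hK : θ.IsSymmetric K) {x : G.lie} : x ∈ K.lie.toSubmodule ↔
    ∀ f, (x : Module.Dual k G.Fun) (θ.pullback f) = (x : Module.Dual k G.Fun) f := by
  constructor
  · intro hx f
    rw [← sub_eq_zero, ← map_sub]
    exact hx _ (hK.1 (Ideal.subset_span ⟨f, rfl⟩))
  · intro hx f hf
    obtain ⟨a, ha, b, hb, rfl⟩ := Submodule.mem_sup.1 (hK.2 hf)
    rw [map_add, fixedIdeal_apply hx a ha, zero_add]
    suffices h : Coalgebra.counit (R := k) b = 0 ∧ (x : Module.Dual k G.Fun) b = 0 from h.2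
    clear hf
    induction hb using Submodule.span_induction with
    | mem e he =>
      have h := fixedIdeal_apply hx _ he.1
      rw [map_sub, x.2, he.2, mul_zero, zero_mul, zero_add, zero_sub, neg_eq_zero] at h
      exact ⟨he.2, h⟩
    | zero => exact ⟨map_zero _, map_zero _⟩
    | add a b _ _ ha hb => rw [map_add, map_add, ha.1, ha.2, hb.1, hb.2]; simp
    | smul c a _ ha =>
      rw [smul_eq_mul, counit_mul', x.2, ha.1, ha.2]; simp

theorem IsSymmetric.eq_zero_of_mem (hK : θ.IsSymmetric K) {x : G.lie}
    (hx : x ∈ K.lie.toSubmodule) (hx' : x ∈ θ.antiInvariants) : x = 0 := by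
  refine Subtype.ext (LinearMap.ext fun f => ?_)
  have h := hx' f
  rw [hK.mem_lie_iff.1 hx] at h
  exact self_eq_neg.1 h

variable (θ) in
/-- The involution on the Lie superalgebra -/
def onLie (x : G.lie) : G.lie := ⟨(x : Module.Dual k G.Fun) ∘ₗ θ.pullback.toLinearMap, fun f g => by
  simp only [LinearMap.comp_apply, AlgHom.toLinearMap_apply, map_mul, x.2 _ _, θ.counit]⟩

theorem onLie_apply (x : G.lie) (f : G.Fun) :
    (θ.onLie x : Module.Dual k G.Fun) f = (x : Module.Dual k G.Fun) (θ.pullback f) := rfl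

theorem pullback_mem_gr {i : ZMod 2} {f : G.Fun} (hf : f ∈ G.gr i) : θ.pullback f ∈ G.gr i := by
  have h := θ.parity f
  rcases zmod2_cases i with rfl | rfl
  · rw [mem_gr_zero] at hf ⊢
    rw [← h, hf]
  · rw [mem_gr_one] at hf ⊢
    rw [← h, hf, map_neg]

theorem IsSymmetric.exists_add (hK : θ.IsSymmetric K) {i : ZMod 2} {x : G.lie}
    (hx : x ∈ G.liePart i) : ∃ y ∈ K.lie.toSubmodule, ∃ z ∈ θ.antiInvariants,
      y ∈ G.liePart i ∧ z ∈ G.liePart i ∧ y + z = x := by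
  have hx' : θ.onLie x ∈ G.liePart i := fun f hf => hx _ (pullback_mem_gr hf)
  refine ⟨(2⁻¹ : k) • (x + θ.onLie x), ?_, (2⁻¹ : k) • (x - θ.onLie x), ?_,
    Submodule.smul_mem _ _ (Submodule.add_mem _ hx hx'),
    Submodule.smul_mem _ _ (Submodule.sub_mem _ hx hx'), ?_⟩
  · rw [hK.mem_lie_iff]
    intro f
    simp only [Submodule.coe_smul, Submodule.coe_add, LinearMap.smul_apply, LinearMap.add_apply,
      onLie_apply, θ.involutive]
    rw [add_comm]
  · intro f
    simp only [Submodule.coe_smul, Submodule.coe_sub, LinearMap.smul_apply, LinearMap.sub_apply,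
      onLie_apply, θ.involutive]
    rw [← smul_neg, neg_sub]
  · rw [← smul_add, add_add_sub_cancel, ← two_smul k, smul_smul, inv_mul_cancel₀ two_ne_zero,
      one_smul]

theorem IsDual.mem_lie_even (hK' : θ.IsDual K K') {x : G.lie} (hx : x ∈ G.liePart 0) :
    x ∈ K'.lie.toSubmodule ↔ x ∈ K.lie.toSubmodule := by
  have hd := (LieSuperalgebra.isCompl (k := k) (L := G.lie)).disjoint
  rw [hK'.2]
  constructor
  · intro h
    obtain ⟨y, hy, z, hz, rfl⟩ := Submodule.mem_sup.1 h
    have hz0 : z ∈ G.liePart 0 := (Submodule.add_mem_iff_right _ hy.2).1 hx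
    rw [Submodule.disjoint_def.1 hd z hz0 hz.2, add_zero]
    exact hy.1
  · intro h; exact Submodule.mem_sup_left ⟨h, hx⟩

theorem IsDual.mem_lie_odd (hK' : θ.IsDual K K') {x : G.lie} (hx : x ∈ G.liePart 1) :
    x ∈ K'.lie.toSubmodule ↔ x ∈ θ.antiInvariants := by
  have hd := (LieSuperalgebra.isCompl (k := k) (L := G.lie)).disjoint
  rw [hK'.2]
  constructor
  · intro h
    obtain ⟨y, hy, z, hz, rfl⟩ := Submodule.mem_sup.1 h
    have hy1 : y ∈ G.liePart 1 := (Submodule.add_mem_iff_left _ hz.2).1 hx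
    rw [Submodule.disjoint_def.1 hd y hy.2 hy1, zero_add]
    exact hz.1
  · intro h; exact Submodule.mem_sup_right ⟨h, hx⟩

/-! ### The even part -/

theorem pullback_mem_oddIdeal {f : G.Fun} (hf : f ∈ G.oddIdeal) :
    G.restrEven (θ.pullback f) = 0 :=
  algHom_oddIdeal (G.restrEven.comp θ.pullback) (fun f => by
    rw [AlgHom.comp_apply, AlgHom.comp_apply, θ.parity]; exact toEven_parity _) f hf

variable (θ) in
/-- The involution of `G₀`. -/
def even : G.even.Involution where
  pullback := Ideal.Quotient.liftₐ G.oddIdeal (G.restrEven.comp θ.pullback)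
    (fun _ hf => pullback_mem_oddIdeal hf)
  involutive x := by
    obtain ⟨f, rfl⟩ := restrEven_surjective x
    exact congrArg G.restrEven (θ.involutive f)
  parity x := by rw [even_parity, even_parity]
  comul x := by
    obtain ⟨f, rfl⟩ := restrEven_surjective x
    change Coalgebra.comul (R := k) (G.restrEven (θ.pullback f)) = _
    rw [comul_restrEven, comul_restrEven, θ.comul]
    induction Coalgebra.comul (R := k) f with
    | zero => simp
    | add x y hx hy => simp only [map_add, hx, hy]
    | tmul x y => rfl
  counit x := by
    obtain ⟨f, rfl⟩ := restrEven_surjective x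
    exact θ.counit f

theorem even_restrEven (f : G.Fun) : θ.even.pullback (G.restrEven f) = G.restrEven (θ.pullback f) :=
  rfl

theorem fixedIdeal_le_comap : θ.fixedIdeal ≤ θ.even.fixedIdeal.comap G.restrEven := by
  refine Ideal.span_le.2 ?_
  rintro _ ⟨f, rfl⟩
  refine Ideal.subset_span ⟨G.restrEven f, ?_⟩
  rw [even_restrEven]; exact map_sub _ _ _

theorem IsSymmetric.even (hK : θ.IsSymmetric K) : θ.even.IsSymmetric K.even := by
  constructor
  · refine Ideal.span_le.2 ?_
    rintro _ ⟨x, rfl⟩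
    obtain ⟨f, rfl⟩ := restrEven_surjective x
    rw [even_restrEven, ← map_sub]
    exact Ideal.mem_map_of_mem _ (hK.1 (Ideal.subset_span ⟨f, rfl⟩))
  · refine Ideal.map_le_iff_le_comap.2 (hK.2.trans (sup_le ?_ (Ideal.span_le.2 ?_)))
    · exact fixedIdeal_le_comap.trans (Ideal.comap_mono le_sup_left)
    · rintro e ⟨he, h0⟩
      refine Submodule.mem_sup_right (Ideal.subset_span ⟨?_, h0⟩)
      rw [← map_mul, ← map_sub]
      exact fixedIdeal_le_comap he

end Involution

theorem lslice_restrEven (φ : Module.Dual k G.even.Fun) (f : G.Fun) :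
    lslice φ (G.restrEven f) = G.restrEven (lslice (φ ∘ₗ G.restrEven.toLinearMap) f) := by
  simp only [lslice, LinearMap.comp_apply, comul_restrEven]
  induction comul (R := k) f with
  | zero => simp
  | add x y hx hy => simp only [map_add, hx, hy]
  | tmul x y => simp

theorem even_oddProj (f : G.even.Fun) : G.even.oddProj f = 0 := by
  have h := even_parity f
  rw [parity_apply, sub_eq_self, smul_eq_zero] at h
  exact h.resolve_left two_ne_zero

theorem even_gr_one {f : G.even.Fun} (hf : f ∈ G.even.gr 1) : f = 0 := by
  rw [← G.even.oddProj_of_odd hf, even_oddProj]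

theorem even_liePart_zero (x : G.even.lie) : x ∈ G.even.liePart 0 := by
  intro f hf
  rw [even_gr_one (f := f) (by simpa using hf), map_zero]

theorem even_liePart_one {x : G.even.lie} (hx : x ∈ G.even.liePart 1) : x = 0 :=
  Submodule.disjoint_def.1 (LieSuperalgebra.isCompl (k := k) (L := G.even.lie)).disjoint x
    (even_liePart_zero x) hx

theorem even_transl (φ : Module.Dual k G.even.Fun) (f : G.even.Fun) : transl φ f = lslice φ f := by
  rw [transl_eq, even_oddProj, smul_zero, sub_zero]

theorem lieRestr_comp (x : part (k := k) (L := G.lie) 0) :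
    (G.lieRestr x : Module.Dual k G.even.Fun) ∘ₗ G.restrEven.toLinearMap =
      ((x : G.lie) : Module.Dual k G.Fun) := rfl

theorem lieRestr_surjective : Function.Surjective G.lieRestr := by
  intro y
  refine ⟨⟨⟨(y : Module.Dual k G.even.Fun) ∘ₗ G.restrEven.toLinearMap, fun f g => ?_⟩,
    fun f hf => ?_⟩, ?_⟩
  · simp only [LinearMap.comp_apply, AlgHom.toLinearMap_apply, map_mul, y.2 _ _, counit_restrEven]
  · change (y : Module.Dual k G.even.Fun) (G.restrEven f) = 0
    rw [restrEven_eq_zero.2 (Ideal.subset_span (by simpa using hf)), map_zero]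
  · refine Subtype.ext (LinearMap.ext fun f => ?_)
    obtain ⟨f, rfl⟩ := restrEven_surjective f
    rfl

variable (G) in
/-- The identification of `𝔤₀` with the Lie algebra of `G₀`, as a homomorphism. -/
def lieRestrHom : Hom k (ClosedSubgroup.lieEven G).toSubmodule G.even.lie where
  toLinearMap := G.lieRestr
  map_part i x hx := by
    rcases zmod2_cases i with rfl | rfl
    · exact even_liePart_zero _
    · have h : (x : G.lie) = 0 :=
        Submodule.disjoint_def.1 (LieSuperalgebra.isCompl (k := k) (L := G.lie)).disjoint x x.2 hx
      have h' : x = 0 := Subtype.ext h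
      rw [h']
      exact (congrArg (· ∈ part (k := k) (L := G.even.lie) 1) (map_zero G.lieRestr)).mpr
        (Submodule.zero_mem _)
  map_bracket x y := by
    refine Subtype.ext (LinearMap.ext fun f => ?_)
    obtain ⟨f, rfl⟩ := restrEven_surjective f
    change bracketDual ((x : G.lie) : Module.Dual k G.Fun) ((y : G.lie) : Module.Dual k G.Fun) f =
      bracketDual (G.lieRestr x : Module.Dual k G.even.Fun) (G.lieRestr y) (G.restrEven f)
    have h0 : ((y : G.lie) : Module.Dual k G.Fun) ∘ₗ G.oddProj = 0 := mem_liePart_zero.1 y.2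
    have h1 : (G.lieRestr y : Module.Dual k G.even.Fun) ∘ₗ G.even.oddProj = 0 :=
      mem_liePart_zero.1 (even_liePart_zero _)
    rw [bracketDual_apply, bracketDual_apply, h0, h1, lslice_restrEven, lslice_restrEven,
      LinearMap.zero_apply, LinearMap.zero_apply]
    rfl

theorem lieRestrHom_surjective (i : ZMod 2) {x : G.even.lie} (hx : x ∈ G.even.liePart i) :
    ∃ y : (ClosedSubgroup.lieEven G).toSubmodule, y ∈ part (k := k) i ∧
      G.lieRestrHom.toLinearMap y = x := by
  rcases zmod2_cases i with rfl | rfl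
  · obtain ⟨y, rfl⟩ := lieRestr_surjective x
    exact ⟨y, y.2, rfl⟩
  · exact ⟨0, Submodule.zero_mem _, by rw [map_zero, even_liePart_one hx]⟩

/-! ### The pushforward of distributions from `G₀/K₀` to `G/K`. -/

namespace ClosedSubgroup

variable (K : G.ClosedSubgroup)

theorem mem_even_lie_iff (x : part (k := k) (L := G.lie) 0) :
    G.lieRestr x ∈ K.even.lie.toSubmodule ↔ (x : G.lie) ∈ K.lie.toSubmodule := by
  constructor
  · intro h f hf
    exact h _ (Ideal.mem_map_of_mem _ hf)
  · intro h f hf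
    obtain ⟨a, ha, rfl⟩ := (Ideal.mem_map_iff_of_surjective _ restrEven_surjective).1 hf
    exact h a ha

theorem mem_lieEvenSub_iff (x : (lieEven G).toSubmodule) :
    x ∈ K.lieEvenSub ↔ G.lieRestrHom.toLinearMap x ∈ K.even.lie.toSubmodule :=
  (K.mem_even_lie_iff x).symm

theorem coe_quotRestr (f : K.quotFun) : (K.quotRestr f : G.even.Fun) = G.restrEven f := rfl

theorem quotRestr_quotTransl (x : part (k := k) (L := G.lie) 0) (f : K.quotFun) :
    K.quotRestr (K.quotTransl (x : G.lie) f) = K.even.quotTransl (G.lieRestr x) (K.quotRestr f) := by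
  refine Subtype.ext ?_
  rw [coe_quotTransl, coe_quotRestr, coe_quotRestr, coe_quotTransl, even_transl, lslice_restrEven,
    lieRestr_comp, transl_of_even x.2]

theorem pushDist_distAct (x : part (k := k) (L := G.lie) 0) (ψ : K.even.Dist) :
    K.pushDist (K.even.distAct (G.lieRestr x) ψ) = K.distAct (x : G.lie) (K.pushDist ψ) := by
  refine Subtype.ext (LinearMap.ext fun f => ?_)
  exact congrArg (ψ : Module.Dual k K.even.quotFun) (K.quotRestr_quotTransl x f).symm

theorem pushDist_distTransl (h : K.points) (ψ : K.even.Dist) :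
    K.pushDist (K.even.distTransl (K.evenPoints h) ψ) = K.distTransl h (K.pushDist ψ) := by
  refine Subtype.ext (LinearMap.ext fun f => ?_)
  refine congrArg (ψ : Module.Dual k K.even.quotFun) (Subtype.ext ?_)
  change transl _ (K.quotRestr f : G.even.Fun) = (K.quotRestr (K.quotTransl _ f) : G.even.Fun)
  rw [coe_quotRestr, coe_quotRestr, coe_quotTransl, transl_point, transl_point,
    lslice_restrEven]
  rfl

theorem pushDist_delta : K.pushDist K.even.delta = K.delta := rfl

theorem pushDist_mem_distFil {n : ℕ} {ψ : K.even.Dist} (hψ : ψ ∈ K.even.distFil n) :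
    K.pushDist ψ ∈ K.distFil n := fun f hf => hψ _ (K.quotRestr_pow n f hf)

theorem mulDist_pushDist (b : K.quotFun) (ψ : K.even.Dist) :
    K.mulDist b (K.pushDist ψ) = K.pushDist (K.even.mulDist (K.quotRestr b) ψ) := by
  refine Subtype.ext (LinearMap.ext fun f => ?_)
  exact congrArg (ψ : Module.Dual k K.even.quotFun) (map_mul K.quotRestr f b)

/-- Odd functions restrict to zero on `G₀`. -/
theorem mulDist_pushDist_odd {b : K.quotFun} (hb : (b : G.Fun) ∈ G.gr 1) (ψ : K.even.Dist) :
    K.mulDist b (K.pushDist ψ) = 0 := by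
  have h : K.quotRestr b = 0 := Subtype.ext (restrEven_eq_zero.2 (Ideal.subset_span hb))
  rw [mulDist_pushDist, h]
  have : K.even.mulDist 0 ψ = 0 := Subtype.ext (LinearMap.ext fun f => by
    rw [mulDist_apply, mul_zero, map_zero]; rfl)
  rw [this, map_zero]

variable {K} {θ : G.Involution}

/-- Otherwise a nonzero functional `τ` kills the restrictions from `G/K` and the square of the
maximal ideal. It extends to an even tangent vector of `G` that kills `k[G/K]`, hence lies in `𝔨`,
and then kills the maximal ideal of `k[G₀/K₀]` too. As `τ 1 = 0`, this forces `τ = 0`. -/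
theorem range_quotRestr_sup_sq (hK : θ.IsSymmetric K) (hX : K.IsAffineQuotient)
    (hX₀ : K.even.IsAffineQuotient) (f : K.even.quotFun) :
    ∃ r : K.quotFun, f - K.quotRestr r ∈ K.even.maxIdeal * K.even.maxIdeal := by
  suffices h : LinearMap.range K.quotRestr.toLinearMap ⊔
      (K.even.maxIdeal * K.even.maxIdeal).restrictScalars k = ⊤ by
    have hf : f ∈ LinearMap.range K.quotRestr.toLinearMap ⊔
      (K.even.maxIdeal * K.even.maxIdeal).restrictScalars k := by rw [h]; trivial
    obtain ⟨_, ⟨r, rfl⟩, q, hq, rfl⟩ := Submodule.mem_sup.1 hf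
    exact ⟨r, by change K.quotRestr r + q - K.quotRestr r ∈ _; rwa [add_sub_cancel_left]⟩
  by_contra hne
  obtain ⟨τ, hτ, hle⟩ := Submodule.exists_le_ker_of_lt_top _ (lt_top_iff_ne_top.2 hne)
  have hr : ∀ r, τ (K.quotRestr r) = 0 := fun r => hle (Submodule.mem_sup_left ⟨r, rfl⟩)
  have h1 : τ 1 = 0 := by rw [← map_one K.quotRestr]; exact hr 1
  obtain ⟨y, hy⟩ := hK.even.exists_lie_extension hX₀ τ h1
    fun f hf => hle (Submodule.mem_sup_right hf)
  obtain ⟨x, rfl⟩ := lieRestr_surjective y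
  have hx : (x : G.lie) ∈ K.lie.toSubmodule := hX.mem_lie fun b _ => (hy (K.quotRestr b)).trans (hr b)
  rw [← mem_even_lie_iff] at hx
  refine hτ (LinearMap.ext fun f => ?_)
  have h2 := hx _ (K.even.maxIdeal_le_ideal (K.even.sub_counit_mem_maxIdeal f))
  rw [hy, map_sub, Algebra.algebraMap_eq_smul_one, map_smul, h1, smul_zero, sub_zero] at h2
  exact h2

/-- An approximation modulo the square suffices: multiplying approximations of the factors
approximates a product in the `n`-th power modulo the next power. -/
theorem range_quotRestr_sup_pow (hK : θ.IsSymmetric K) (hX : K.IsAffineQuotient)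
    (hX₀ : K.even.IsAffineQuotient) (n : ℕ) (f : K.even.quotFun) :
    ∃ r : K.quotFun, f - K.quotRestr r ∈ K.even.maxIdeal ^ n := by
  have h1 : ∀ n, ∀ f ∈ K.even.maxIdeal ^ n,
      ∃ r : K.quotFun, f - K.quotRestr r ∈ K.even.maxIdeal ^ (n + 1) := by
    have h2 : ∀ f, ∃ r : K.quotFun, f - K.quotRestr r ∈ K.even.maxIdeal ^ 2 := by
      rw [maxIdeal_pow_two]; exact range_quotRestr_sup_sq hK hX hX₀
    intro n
    induction n with
    | zero =>
      intro f _
      obtain ⟨r, hr⟩ := h2 f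
      exact ⟨r, K.even.maxIdeal_pow_le (by omega) hr⟩
    | succ n ih =>
      intro f hf
      rw [maxIdeal_pow_succ] at hf
      refine Submodule.smul_induction_on hf (fun a ha b hb => ?_) (fun a b ha hb => ?_)
      · obtain ⟨r, hr⟩ := h2 a
        obtain ⟨s, hs⟩ := ih b hb
        have hra : K.quotRestr r ∈ K.even.maxIdeal ^ 1 := by
          have h3 := K.even.maxIdeal_pow_le (show 1 ≤ 2 by omega) hr
          rw [maxIdeal_pow_one] at h3 ⊢
          have := Ideal.sub_mem _ ha h3
          rwa [sub_sub_cancel] at this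
        refine ⟨r * s, ?_⟩
        have e1 := K.even.mul_mem_maxIdeal_pow _ _ hr hb
        have e2 := K.even.mul_mem_maxIdeal_pow _ _ hra hs
        rw [add_comm 2 n] at e1
        rw [add_comm 1 (n + 1)] at e2
        convert Ideal.add_mem _ e1 e2 using 1
        rw [map_mul, smul_eq_mul]; noncomm_ring
      · obtain ⟨r, hr⟩ := ha
        obtain ⟨s, hs⟩ := hb
        refine ⟨r + s, ?_⟩
        convert Ideal.add_mem _ hr hs using 1
        rw [map_add]; abel
  induction n with
  | zero => exact ⟨0, by rw [maxIdeal_pow_zero]; trivial⟩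
  | succ n ih =>
    obtain ⟨r, hr⟩ := ih
    obtain ⟨s, hs⟩ := h1 n _ hr
    exact ⟨r + s, by rwa [map_add, ← sub_sub]⟩

/-- A distribution sees functions only modulo a power of the maximal ideal, and there every function
on `G₀/K₀` comes from `G/K`. -/
theorem pushDist_injective (hK : θ.IsSymmetric K) (hX : K.IsAffineQuotient)
    (hX₀ : K.even.IsAffineQuotient) : Function.Injective K.pushDist := by
  rw [injective_iff_map_eq_zero]
  intro ψ hψ
  refine Subtype.ext (LinearMap.ext fun f => ?_)
  obtain ⟨n, hn⟩ := exists_mem_distFil ψ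
  obtain ⟨r, hr⟩ := range_quotRestr_sup_pow hK hX hX₀ n f
  have h1 := hn _ hr
  have h2 : (ψ : Module.Dual k K.even.quotFun) (K.quotRestr r) = 0 :=
    LinearMap.congr_fun (congrArg Subtype.val hψ) r
  rwa [map_sub, h2, sub_zero] at h1

end ClosedSubgroup

end Supergroup

/-! ### The action of `𝔨` on the order filtration. -/

namespace Supergroup

variable {k : Type*} [Field k] [CharZero k] {G : Supergroup k}

open WithConv LieSuperalgebra

namespace ClosedSubgroup

variable {K : G.ClosedSubgroup}

/-- Elements of `𝔨` fix the base point, so they preserve the maximal ideal and, by the Leibniz rule,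
its powers, where a general element of `𝔤` loses one power. -/
theorem quotTransl_mem_pow_of_mem {y : G.lie} (hy : y ∈ K.lie.toSubmodule) (n : ℕ) :
    ∀ f ∈ K.maxIdeal ^ n, K.quotTransl y f ∈ K.maxIdeal ^ n := by
  have hm : ∀ y : G.lie, y ∈ K.lie.toSubmodule → ∀ f ∈ K.maxIdeal,
      K.quotTransl y f ∈ K.maxIdeal := by
    intro y hy f hf
    rw [mem_maxIdeal, coe_quotTransl, counit_transl]
    exact hy _ (K.maxIdeal_le_ideal hf)
  have key : ∀ (y : G.lie), y ∈ K.lie.toSubmodule → ∀ S : K.quotFun →ₗ[k] K.quotFun,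
      (∀ n, ∀ f ∈ K.maxIdeal ^ n, S f ∈ K.maxIdeal ^ n) →
      (∀ a b, K.quotTransl y (a * b) = K.quotTransl y a * S b + a * K.quotTransl y b) →
      ∀ n, ∀ f ∈ K.maxIdeal ^ n, K.quotTransl y f ∈ K.maxIdeal ^ n := by
    intro y hy S hS hD n
    induction n with
    | zero => intro f _; rw [maxIdeal_pow_zero]; trivial
    | succ n ih =>
      intro f hf
      rw [maxIdeal_pow_succ] at hf ⊢
      refine Submodule.smul_induction_on hf (fun a ha b hb => ?_) (fun a b ha hb => ?_)
      · rw [smul_eq_mul, hD]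
        exact Ideal.add_mem _ (Ideal.mul_mem_mul (hm y hy a ha) (hS n b hb))
          (Ideal.mul_mem_mul ha (ih b hb))
      · rw [map_add]; exact Ideal.add_mem _ ha hb
  obtain ⟨y0, h0, y1, h1, hy0, hy1, rfl⟩ := K.lie.graded y hy
  intro f hf
  have e : K.quotTransl (y0 + y1 : G.lie) f = K.quotTransl y0 f + K.quotTransl y1 f :=
    Subtype.ext (LinearMap.congr_fun (transl_add _ _) _)
  rw [e]
  refine Ideal.add_mem _ ?_ ?_
  · exact key y0 h0 LinearMap.id (fun _ _ h => h)
      (fun a b => Subtype.ext (transl_even_mul hy0 (a : G.Fun) b)) n f hf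
  · exact key y1 h1 K.quotParity K.quotParity_pow
      (fun a b => Subtype.ext (transl_odd_mul hy1 (a : G.Fun) b)) n f hf

theorem distAct_mem_distFil_of_mem {y : G.lie} (hy : y ∈ K.lie.toSubmodule) {n : ℕ} {φ : K.Dist}
    (hφ : φ ∈ K.distFil n) : K.distAct y φ ∈ K.distFil n :=
  fun f hf => hφ _ (quotTransl_mem_pow_of_mem hy n f hf)

/-! ### Freeness over odd elements -/

theorem exists_even_add_odd_fun (b : K.quotFun) : ∃ b0 b1 : K.quotFun, (b0 : G.Fun) ∈ G.gr 0 ∧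
    (b1 : G.Fun) ∈ G.gr 1 ∧ b0 + b1 = b :=
  ⟨b - ⟨G.oddProj b, K.oddProj_mem_quotFun b.2⟩, ⟨G.oddProj b, K.oddProj_mem_quotFun b.2⟩,
    G.sub_oddProj_mem _, G.oddProj_mem _, sub_add_cancel _ _⟩

theorem odd_mem_maxIdeal {b : K.quotFun} (hb : (b : G.Fun) ∈ G.gr 1) : b ∈ K.maxIdeal :=
  G.counit_odd hb

section oddFree

variable {L : Type*} [AddCommGroup L] [Module k L] [LieSuperalgebra k L] {f : Hom k L G.lie}

theorem mulDist_act_odd {x : L} (hx : x ∈ part (k := k) 1) {i : ZMod 2} {b : K.quotFun}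
    (hb : (b : G.Fun) ∈ G.gr i) (φ : K.Dist) : K.mulDist b (K.distActComp f x φ) =
      koszulSign k 1 i • K.distActComp f x (K.mulDist b φ) +
        K.mulDist (K.quotTransl (f.toLinearMap x : G.lie) b) φ :=
  mulDist_distAct (f.map_part 1 x hx) hb φ

section seed

variable {W : Submodule k K.Dist} (hW : ∀ b, ∀ w ∈ W, K.mulDist b w ∈ W)
include hW

theorem mulDist_mem_oddFil (n : ℕ) (b : K.quotFun) : ∀ w ∈ oddFil (K.distActComp f) W n,
    K.mulDist b w ∈ oddFil (K.distActComp f) W n := by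
  induction n generalizing b with
  | zero => intro w hw; rw [(Submodule.mem_bot k).1 hw, map_zero]; exact Submodule.zero_mem _
  | succ n ih =>
    refine fil_succ_le (W := (oddFil (K.distActComp f) W (n + 1)).comap (K.mulDist b))
      (fun w hw => ?_) fun x hx v hv => ?_
    · exact le_fil_succ n (hW b w hw)
    · have hom : ∀ (i : ZMod 2) (b : K.quotFun), (b : G.Fun) ∈ G.gr i →
          K.mulDist b (K.distActComp f x v) ∈ oddFil (K.distActComp f) W (n + 1) := by
        intro i b hb
        rw [mulDist_act_odd hx hb]
        exact Submodule.add_mem _ (Submodule.smul_mem _ _ (act_mem_fil hx (ih b v hv)))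
          (fil_le_succ n (ih _ v hv))
      obtain ⟨b0, b1, h0, h1, rfl⟩ := exists_even_add_odd_fun b
      rw [Submodule.mem_comap, mulDist_add]
      exact Submodule.add_mem _ (hom 0 b0 h0) (hom 1 b1 h1)

/-- An odd function acts like a contraction: it kills `W`, and each time it is commuted with an odd
factor the resulting term has lost that factor. -/
theorem mulDist_odd_mem_oddFil (h1 : ∀ b : K.quotFun, (b : G.Fun) ∈ G.gr 1 → ∀ w ∈ W,
    K.mulDist b w = 0) {b : K.quotFun} (hb : (b : G.Fun) ∈ G.gr 1) (n : ℕ) :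
    ∀ w ∈ oddFil (K.distActComp f) W (n + 1),
      K.mulDist b w ∈ oddFil (K.distActComp f) W n := by
  induction n with
  | zero =>
    intro w hw
    rw [zero_add, oddFil, fil_one] at hw
    rw [h1 b hb w hw]; exact Submodule.zero_mem _
  | succ n ih =>
    refine fil_succ_le (W := (oddFil (K.distActComp f) W (n + 1)).comap (K.mulDist b))
      (fun w hw => ?_) fun x hx v hv => ?_
    · rw [Submodule.mem_comap, h1 b hb w hw]; exact Submodule.zero_mem _
    · rw [Submodule.mem_comap, mulDist_act_odd hx hb]
      exact Submodule.add_mem _ (Submodule.smul_mem _ _ (act_mem_fil hx (ih v hv)))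
        (mulDist_mem_oddFil hW _ _ v hv)

end seed

variable (K) in
/-- The distributions of order less than `c` on `G₀/K₀`, pushed forward to `G/K` -/
def evenDistFil (c : ℕ) : Submodule k K.Dist := (K.even.distFil c).map K.pushDist

theorem evenDistFil_le (c : ℕ) : K.evenDistFil c ≤ LinearMap.range K.pushDist :=
  LinearMap.map_le_range

theorem mulDist_mem_range (b : K.quotFun) : ∀ w ∈ LinearMap.range K.pushDist,
    K.mulDist b w ∈ LinearMap.range K.pushDist := by
  rintro _ ⟨ψ, rfl⟩
  exact ⟨_, (K.mulDist_pushDist b ψ).symm⟩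

theorem mulDist_mem_evenDistFil {c : ℕ} (b : K.quotFun) : ∀ w ∈ K.evenDistFil c,
    K.mulDist b w ∈ K.evenDistFil c := by
  rintro _ ⟨ψ, hψ, rfl⟩
  exact ⟨_, mulDist_mem_distFil hψ, (K.mulDist_pushDist b ψ).symm⟩

theorem mulDist_odd_range {b : K.quotFun} (hb : (b : G.Fun) ∈ G.gr 1) :
    ∀ w ∈ LinearMap.range K.pushDist, K.mulDist b w = 0 := by
  rintro _ ⟨ψ, rfl⟩
  exact K.mulDist_pushDist_odd hb ψ

theorem quotRestr_mem {b : K.quotFun} (hb : b ∈ K.maxIdeal) : K.quotRestr b ∈ K.even.maxIdeal := by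
  have := K.quotRestr_pow 1 b (by rwa [maxIdeal_pow_one])
  rwa [maxIdeal_pow_one] at this

variable (K f) in
/-- Products of less than `n` odd elements applied to `G₀`-distributions of order less than `c`, up
to shorter products. -/
def evenOddFil (c n : ℕ) : Submodule k K.Dist :=
  oddFil (K.distActComp f) (K.evenDistFil c) n ⊔
    oddFil (K.distActComp f) (LinearMap.range K.pushDist) (n - 1)

theorem oddFil_mono {W W' : Submodule k K.Dist} (h : W ≤ W') (n : ℕ) :
    oddFil (K.distActComp f) W n ≤ oddFil (K.distActComp f) W' n := fun v hv =>
  fil_map_le (q := K.distActComp f) LinearMap.id (fun _ _ _ => rfl) (fun _ hv => h hv) n v hv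

theorem act_mem_evenOddFil {c n : ℕ} {x : L} (hx : x ∈ part (k := k) 1) {w : K.Dist}
    (hw : w ∈ K.evenOddFil f c n) : K.distActComp f x w ∈ K.evenOddFil f c (n + 1) := by
  obtain ⟨a, ha, b, hb, rfl⟩ := Submodule.mem_sup.1 hw
  rw [map_add]
  refine Submodule.add_mem _ (Submodule.mem_sup_left (act_mem_fil hx ha))
    (Submodule.mem_sup_right ?_)
  cases n with
  | zero => rw [(Submodule.mem_bot k).1 hb, map_zero]; exact Submodule.zero_mem _
  | succ n => exact act_mem_fil hx hb

/-- Once it reaches the distributions on `G₀/K₀`, `b` lowers their order. Where an odd element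
differentiates `b` on the way, a factor is lost, and the term goes into the second summand of
`evenOddFil`. -/
theorem mulDist_mem_evenOddFil {b : K.quotFun} (hb : b ∈ K.maxIdeal) (c n : ℕ) :
    ∀ w ∈ oddFil (K.distActComp f) (K.evenDistFil (c + 1)) n,
      K.mulDist b w ∈ K.evenOddFil f c n := by
  induction n generalizing b with
  | zero => intro w hw; rw [(Submodule.mem_bot k).1 hw, map_zero]; exact Submodule.zero_mem _
  | succ n ih =>
    refine fil_succ_le (W := (K.evenOddFil f c (n + 1)).comap (K.mulDist b))
      (fun w hw => ?_) fun x hx v hv => ?_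
    · obtain ⟨ψ, hψ, rfl⟩ := hw
      refine Submodule.mem_sup_left (le_fil_succ n ?_)
      rw [mulDist_pushDist]
      exact ⟨_, mulDist_mem_distFil_of_mem (quotRestr_mem hb) hψ, rfl⟩
    · have hom : ∀ (i : ZMod 2) (b : K.quotFun), (b : G.Fun) ∈ G.gr i → b ∈ K.maxIdeal →
          K.mulDist b (K.distActComp f x v) ∈ K.evenOddFil f c (n + 1) := by
        intro i b hb hm
        rw [mulDist_act_odd hx hb]
        refine Submodule.add_mem _ (Submodule.smul_mem _ _ (act_mem_evenOddFil hx (ih hm v hv)))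
          (Submodule.mem_sup_right ?_)
        exact mulDist_mem_oddFil mulDist_mem_range _ _ v (oddFil_mono (evenDistFil_le _) n hv)
      obtain ⟨b0, b1, h0, h1, rfl⟩ := exists_even_add_odd_fun b
      have hm1 := odd_mem_maxIdeal h1
      rw [Submodule.mem_comap, mulDist_add]
      exact Submodule.add_mem _ (hom 0 b0 h0 ((Submodule.add_mem_iff_left _ hm1).1 hb))
        (hom 1 b1 h1 hm1)

theorem mulDist_odd_mem_evenOddFil {b : K.quotFun} (hb : (b : G.Fun) ∈ G.gr 1) {c n : ℕ}
    {w : K.Dist} (hw : w ∈ K.evenOddFil f c (n + 1)) : K.mulDist b w ∈ K.evenOddFil f c n := by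
  obtain ⟨u, hu, v, hv, rfl⟩ := Submodule.mem_sup.1 hw
  rw [map_add]
  refine Submodule.add_mem _ (Submodule.mem_sup_left ?_) (Submodule.mem_sup_right ?_)
  · exact mulDist_odd_mem_oddFil mulDist_mem_evenDistFil
      (fun b hb w hw => mulDist_odd_range hb w (evenDistFil_le _ hw)) hb n u hu
  · cases n with
    | zero => rw [(Submodule.mem_bot k).1 hv, map_zero]; exact Submodule.zero_mem _
    | succ n =>
      exact mulDist_odd_mem_oddFil mulDist_mem_range (fun b hb => mulDist_odd_range hb) hb n v hv

/-- No factor of `l` pairs with `b` at the base point, so each derivative of `b` lies in the maximal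
ideal and lowers the order on `G₀/K₀`. -/
theorem mulDist_lprod_mem {b : K.quotFun} (hb : (b : G.Fun) ∈ G.gr 1) {l : List L}
    (hl : ∀ x ∈ l, x ∈ part (k := k) 1)
    (hl' : ∀ x ∈ l, (f.toLinearMap x : Module.Dual k G.Fun) b = 0) {c : ℕ} {z : K.Dist}
    (hz : z ∈ K.evenDistFil (c + 1)) :
    K.mulDist b (lprod (K.distActComp f) l z) ∈ K.evenOddFil f c l.length := by
  induction l with
  | nil =>
    rw [lprod_nil, mulDist_odd_range hb z (evenDistFil_le _ hz)]; exact Submodule.zero_mem _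
  | cons x l ih =>
    have hx := hl x (by simp)
    rw [lprod_cons, mulDist_act_odd hx hb]
    refine Submodule.add_mem _ (Submodule.smul_mem _ _ (act_mem_evenOddFil hx
      (ih (fun y hy => hl y (by simp [hy])) fun y hy => hl' y (by simp [hy])))) ?_
    refine mulDist_mem_evenOddFil ?_ c _ _
      (lprod_mem_fil_of_mem (fun y hy => hl y (by simp [hy])) hz)
    rw [mem_maxIdeal, coe_quotTransl, counit_transl]
    exact hl' x (by simp)

variable {κ : Type*} {t : κ → L} {ξ : κ → K.quotFun}

/-- Contraction with the dual function strips off the leading factor: `ξ_i t_i w = -t_i ξ_i w + (t_i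
ξ_i) w`, where `t_i ξ_i` is `1` modulo the maximal ideal. The other terms have the smaller order
bound `c` up to shorter products, since `i` does not occur again in `l`. -/
theorem mem_evenDistFil_of_lprod [DecidableEq κ] (ht : ∀ i, t i ∈ part (k := k) 1)
    (hξ : ∀ i, (ξ i : G.Fun) ∈ G.gr 1)
    (hd : ∀ i j, (f.toLinearMap (t i) : Module.Dual k G.Fun) (ξ j) = if i = j then 1 else 0)
    {c : ℕ} {z : K.Dist} (hz : z ∈ K.evenDistFil (c + 1)) {l : List κ} (hl : l.Nodup)
    (h : lprod (K.distActComp f) (l.map t) z ∈ K.evenOddFil f c (l.length + 1)) :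
    z ∈ K.evenDistFil c := by
  induction l with
  | nil =>
    obtain ⟨u, hu, v, hv, e⟩ := Submodule.mem_sup.1 h
    rw [List.length_nil, zero_add, oddFil, fil_one] at hu
    rw [(Submodule.mem_bot k).1 hv, add_zero] at e
    rw [List.map_nil, lprod_nil] at e
    exact e ▸ hu
  | cons i l ih =>
    rw [List.nodup_cons] at hl
    refine ih hl.2 ?_
    set w := lprod (K.distActComp f) (l.map t) z
    have h1 : K.mulDist (ξ i) w ∈ K.evenOddFil f c l.length := by
      have := mulDist_lprod_mem (f := f) (hξ i) (l := l.map t) (odd_of_mem_map ht) ?_ hz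
      · rwa [List.length_map] at this
      · intro x hx
        obtain ⟨j, hj, rfl⟩ := List.mem_map.1 hx
        rw [hd, if_neg]
        rintro rfl
        exact hl.1 hj
    have h2 := act_mem_evenOddFil (ht i) h1
    have h3 := mulDist_odd_mem_evenOddFil (hξ i) h
    have hw : w ∈ oddFil (K.distActComp f) (K.evenDistFil (c + 1)) (l.length + 1) := by
      have := lprod_mem_fil_of_mem (r := K.distActComp f) (l := l.map t) (odd_of_mem_map ht) hz
      rwa [List.length_map] at this
    have hm := quotTransl_sub_mem (f.toLinearMap (t i) : G.lie) (ξ i)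
    have h4 := mulDist_mem_evenOddFil (f := f) hm c _ w hw
    have e := mulDist_add (K.quotTransl (f.toLinearMap (t i) : G.lie) (ξ i) - algebraMap k K.quotFun
      ((f.toLinearMap (t i) : Module.Dual k G.Fun) (ξ i))) (algebraMap k K.quotFun
      ((f.toLinearMap (t i) : Module.Dual k G.Fun) (ξ i))) w
    rw [sub_add_cancel, mulDist_algebraMap, hd, if_pos rfl, one_smul] at e
    rw [List.map_cons, lprod_cons, mulDist_act_odd (ht i) (hξ i), koszulSign_one_one,
      neg_one_smul, e] at h3
    rw [hd, if_pos rfl] at h4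
    have h5 := Submodule.sub_mem _ (Submodule.add_mem _ h3 h2) h4
    have e5 : w = -K.distActComp f (t i) (K.mulDist (ξ i) w) +
        (K.mulDist (K.quotTransl (f.toLinearMap (t i) : G.lie) (ξ i) - algebraMap k K.quotFun 1) w +
          w) + K.distActComp f (t i) (K.mulDist (ξ i) w) -
        K.mulDist (K.quotTransl (f.toLinearMap (t i) : G.lie) (ξ i) - algebraMap k K.quotFun 1) w := by
      abel
    rw [List.length_cons] at h5
    rw [e5]
    exact h5

theorem range_even_mem (h0 : ∀ y ∈ part (k := k) (L := L) 0, f.toLinearMap y ∈ G.liePart 0) :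
    ∀ y ∈ part (k := k) (L := L) 0, ∀ z ∈ LinearMap.range K.pushDist,
      K.distActComp f y z ∈ LinearMap.range K.pushDist := by
  rintro y hy _ ⟨ψ, rfl⟩
  exact ⟨_, K.pushDist_distAct ⟨_, h0 y hy⟩ ψ⟩

/-- Descent on the order of `z` along `G₀/K₀`. A combination of shorter products lies in the second
summand of `evenOddFil` for every order bound, so `mem_evenDistFil_of_lprod` lowers the order of `z`
until `z = 0`. -/
theorem oddFree [Fintype κ] (ht : ∀ i, t i ∈ part (k := k) 1)
    (hs : part (k := k) 1 ≤ Submodule.span k (Set.range t))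
    (hξ : ∀ i, (ξ i : G.Fun) ∈ G.gr 1)
    (hd : ∀ i j, i ≠ j → (f.toLinearMap (t i) : Module.Dual k G.Fun) (ξ j) = 0)
    (hd' : ∀ i, (f.toLinearMap (t i) : Module.Dual k G.Fun) (ξ i) = 1) :
    OddFree (K.distActComp f) (LinearMap.range K.pushDist) t where
  isRep := isRep_distActComp
  even_mem := range_even_mem (f.map_part 0)
  odd := ht
  span := hs
  top z hz hm := by
    classical
    obtain ⟨ψ, rfl⟩ := hz
    obtain ⟨c, hc⟩ := exists_mem_distFil ψ
    have hz : K.pushDist ψ ∈ K.evenDistFil c := ⟨ψ, hc, rfl⟩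
    clear hc
    induction c with
    | zero =>
      obtain ⟨χ, hχ, e⟩ := hz
      rw [← e, eq_zero_of_mem_distFil_zero hχ, map_zero]
    | succ c ih =>
      refine ih (mem_evenDistFil_of_lprod (f := f) ht hξ (fun i j => ?_) hz
        (Finset.nodup_toList Finset.univ) (Submodule.mem_sup_right ?_))
      · split_ifs with h
        · rw [h, hd']
        · exact hd i j h
      · rwa [Finset.length_toList, Nat.add_sub_cancel, Finset.card_univ]

end oddFree

variable {θ : G.Involution} {K' : G.ClosedSubgroup}

/-- An odd element of `𝔨'` that kills the odd functions on `G/K` kills all of them, so it lies in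
`𝔨` as well as in `𝔭` and vanishes. A pairing that is nondegenerate on a finite-dimensional side has
dual vectors on the other. -/
theorem exists_dual_odd (hK : θ.IsSymmetric K) (hK' : θ.IsDual K K') (hX : K.IsAffineQuotient) :
    ∃ ξ : Fin (Module.finrank k (part (k := k) (L := K'.lie.toSubmodule) 1)) → K.quotFun,
      (∀ i, (ξ i : G.Fun) ∈ G.gr 1) ∧
      ∀ i j, ((oddBasis k K'.lie.toSubmodule i : G.lie) : Module.Dual k G.Fun) (ξ j) =
        if i = j then 1 else 0 := by
  let M : Submodule k G.Fun := K.quotFun.toSubmodule ⊓ G.gr 1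
  let B : part (k := k) (L := K'.lie.toSubmodule) 1 →ₗ[k] M →ₗ[k] k :=
    (M.subtype.lcomp k k) ∘ₗ G.lie.subtype ∘ₗ K'.lie.toSubmodule.subtype ∘ₗ
      (part (k := k) (L := K'.lie.toSubmodule) 1).subtype
  have hB : Function.Injective B := by
    rw [injective_iff_map_eq_zero]
    intro x hx
    have hx1 : ((x : K'.lie.toSubmodule) : G.lie) ∈ G.liePart 1 := x.2
    have h : ((x : K'.lie.toSubmodule) : G.lie) ∈ K.lie.toSubmodule := by
      refine hX.mem_lie fun b _ => ?_
      have e : (b : G.Fun) = (b - G.oddProj b) + G.oddProj b := (sub_add_cancel _ _).symm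
      rw [e, map_add, lie_apply_of_mem (by decide) hx1 (G.sub_oddProj_mem _), zero_add]
      exact LinearMap.congr_fun hx ⟨_, K.oddProj_mem_quotFun b.2, G.oddProj_mem _⟩
    exact Subtype.ext (Subtype.ext (hK.eq_zero_of_mem h ((hK'.mem_lie_odd hx1).1 x.1.2)))
  have hs := LinearMap.flip_surjective_iff₁.2 hB
  choose ξ hξ using fun i =>
    hs ((Module.finBasis k (part (k := k) (L := K'.lie.toSubmodule) 1)).coord i)
  refine ⟨fun i => ⟨ξ i, (ξ i).2.1⟩, fun i => (ξ i).2.2, fun i j => ?_⟩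
  have h := LinearMap.congr_fun (hξ j)
    (Module.finBasis k (part (k := k) (L := K'.lie.toSubmodule) 1) i)
  refine h.trans ?_
  rw [Module.Basis.coord_apply, Module.Basis.repr_self, Finsupp.single_apply]

theorem oddFree_dual (hK : θ.IsSymmetric K) (hK' : θ.IsDual K K') (hX : K.IsAffineQuotient) :
    OddFree (K.distActComp (Hom.incl K'.lie)) (LinearMap.range K.pushDist)
      (oddBasis k K'.lie.toSubmodule) := by
  obtain ⟨ξ, h1, h2⟩ := exists_dual_odd hK hK' hX
  exact oddFree oddBasis_mem span_oddBasis h1 (fun i j h => (h2 i j).trans (if_neg h))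
    (fun i => (h2 i i).trans (if_pos rfl))

/-! ### Generation by odd elements -/

variable (K θ) in
/-- The filtration of the distributions on `G/K` generated by the distributions on `G₀/K₀` and the
odd part of `𝔭`. -/
def mixedFil : ℕ → Submodule k K.Dist
  | 0 => ⊥
  | n + 1 => K.evenDistFil (n + 1) ⊔
      Submodule.map₂ K.distAct (θ.antiInvariants ⊓ G.liePart 1) (mixedFil n)

theorem evenDistFil_mono {m n : ℕ} (h : m ≤ n) : K.evenDistFil m ≤ K.evenDistFil n :=
  Submodule.map_mono (distFil_mono h)

theorem act_mem_mixedFil {n : ℕ} {x : G.lie} (hx : x ∈ θ.antiInvariants ⊓ G.liePart 1) {w : K.Dist}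
    (hw : w ∈ K.mixedFil θ n) : K.distAct x w ∈ K.mixedFil θ (n + 1) :=
  Submodule.mem_sup_right (Submodule.apply_mem_map₂ _ hx hw)

theorem mixedFil_le_succ (n : ℕ) : K.mixedFil θ n ≤ K.mixedFil θ (n + 1) := by
  induction n with
  | zero => exact bot_le
  | succ n ih => exact sup_le_sup (evenDistFil_mono (Nat.le_succ _)) (Submodule.map₂_le_map₂_right ih)

theorem mixedFil_le_distFil (n : ℕ) : K.mixedFil θ n ≤ K.distFil n := by
  induction n with
  | zero => exact bot_le
  | succ n ih =>
    refine sup_le ?_ (Submodule.map₂_le.2 fun x _ w hw => distAct_mem_distFil x (ih hw))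
    rintro _ ⟨ψ, hψ, rfl⟩
    exact K.pushDist_mem_distFil hψ

/-- The even element is commuted down to the distributions on `G₀/K₀`. The bracket terms need not
come from `𝔭`, but they have one factor less and are controlled by their order alone. -/
theorem even_act_mem_mixedFil {x : G.lie} (hx : x ∈ G.liePart 0) (n : ℕ) : ∀ w ∈ K.mixedFil θ n,
    K.distAct x w ∈ K.mixedFil θ (n + 1) ⊔ K.distFil n := by
  induction n with
  | zero => intro w hw; rw [(Submodule.mem_bot k).1 hw, map_zero]; exact Submodule.zero_mem _
  | succ n ih =>
    refine sup_le (c := (K.mixedFil θ (n + 1 + 1) ⊔ K.distFil (n + 1)).comap (K.distAct x)) ?_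
      (Submodule.map₂_le.2 fun y hy w hw => ?_)
    · rintro _ ⟨ψ, hψ, rfl⟩
      refine Submodule.mem_sup_left (Submodule.mem_sup_left ?_)
      rw [← K.pushDist_distAct ⟨x, hx⟩]
      exact ⟨_, distAct_mem_distFil _ hψ, rfl⟩
    · rw [Submodule.mem_comap, K.isRep_distAct hx hy.2, koszulSign_zero_left, one_smul]
      refine Submodule.add_mem _ ?_ (Submodule.mem_sup_right
        (distAct_mem_distFil _ (mixedFil_le_distFil n hw)))
      obtain ⟨u, hu, v, hv, e⟩ := Submodule.mem_sup.1 (ih w hw)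
      rw [← e, map_add]
      exact Submodule.add_mem _ (Submodule.mem_sup_left (act_mem_mixedFil hy hu))
        (Submodule.mem_sup_right (distAct_mem_distFil _ hv))

/-- By the Euler operator it is enough to apply the `x i` to lower order. Even ones are handled by
`even_act_mem_mixedFil`. An odd one splits into a part in `𝔨`, which does not raise the order, and a
part in `𝔭`, which the filtration admits. -/
theorem distFil_le_mixedFil (hK : θ.IsSymmetric K) (hX : K.IsAffineQuotient) (n : ℕ) :
    K.distFil n ≤ K.mixedFil θ n := by
  obtain ⟨N, p, x, b, hb⟩ := hK.exists_isDualBasis hX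
  induction n with
  | zero => intro φ hφ; rw [eq_zero_of_mem_distFil_zero hφ]; exact Submodule.zero_mem _
  | succ n ih =>
    have ih' := ih.trans (mixedFil_le_succ n)
    refine hb.distFil_succ_le ?_ ih' (fun i φ hφ => ?_)
    · exact Submodule.mem_sup_left ⟨_, distFil_mono (Nat.le_add_left 1 n) K.even.delta_mem_distFil,
        K.pushDist_delta⟩
    · have hi := hb.mem_liePart i
      rcases zmod2_cases (p i) with h | h <;> rw [h] at hi
      · exact sup_le le_rfl ih' (even_act_mem_mixedFil hi n φ (ih hφ))
      · obtain ⟨y, hy, z, hz, -, hz1, e⟩ := hK.exists_add hi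
        rw [← e, map_add, LinearMap.add_apply]
        exact Submodule.add_mem _ (ih' (distAct_mem_distFil_of_mem hy hφ))
          (act_mem_mixedFil ⟨hz, hz1⟩ (ih hφ))

theorem exists_mem_oddFil_dist (hK : θ.IsSymmetric K) (hK' : θ.IsDual K K')
    (hX : K.IsAffineQuotient) (φ : K.Dist) :
    ∃ n, φ ∈ oddFil (K.distActComp (Hom.incl K'.lie)) (LinearMap.range K.pushDist) n := by
  have h : ∀ n, K.mixedFil θ n ≤
      oddFil (K.distActComp (Hom.incl K'.lie)) (LinearMap.range K.pushDist) n := by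
    intro n
    induction n with
    | zero => exact bot_le
    | succ n ih =>
      refine sup_le ((evenDistFil_le _).trans (le_fil_succ n))
        (Submodule.map₂_le.2 fun x hx w hw => ?_)
      have hx' := (hK'.mem_lie_odd hx.2).2 hx.1
      exact act_mem_fil (r := K.distActComp (Hom.incl K'.lie)) (x := ⟨x, hx'⟩) hx.2 (ih hw)
  obtain ⟨n, hn⟩ := exists_mem_distFil φ
  exact ⟨n, h n (distFil_le_mixedFil hK hX n hn)⟩

end ClosedSubgroup

end Supergroup

/-- The Nullstellensatz, for a radical ideal of a finitely generated algebra. -/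
theorem Ideal.IsRadical.mem_of_forall_algHom {k A : Type*} [Field k] [IsAlgClosed k] [CommRing A]
    [Algebra k A] [Algebra.FiniteType k A] {I : Ideal A} (hI : I.IsRadical) {a : A}
    (h : ∀ φ : A →ₐ[k] k, (∀ b ∈ I, φ b = 0) → φ a = 0) : a ∈ I := by
  have : IsJacobsonRing A := isJacobsonRing_of_finiteType (A := k)
  rw [← IsJacobsonRing.out this hI, Ideal.jacobson, Submodule.mem_sInf]
  rintro M ⟨hIM, hM⟩
  let _ : Field (A ⧸ M) := Ideal.Quotient.field M
  have : Module.Finite k (A ⧸ M) := finite_of_finite_type_of_isJacobsonRing k (A ⧸ M)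
  have : Algebra.IsIntegral k (A ⧸ M) := inferInstance
  let e : k ≃ₐ[k] (A ⧸ M) := AlgEquiv.ofBijective (Algebra.ofId k (A ⧸ M))
    IsAlgClosed.algebraMap_bijective_of_isIntegral
  have h1 := h (e.symm.toAlgHom.comp (Ideal.Quotient.mkₐ k M)) fun b hb => by
    have : Ideal.Quotient.mkₐ k M b = 0 := Ideal.Quotient.eq_zero_iff_mem.2 (hIM hb)
    rw [AlgHom.comp_apply, this, map_zero]
  have h2 : e.symm (Ideal.Quotient.mkₐ k M a) = 0 := h1
  rw [EmbeddingLike.map_eq_zero_iff] at h2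
  exact Ideal.Quotient.eq_zero_iff_mem.1 h2

/-! ### Points of `K₀` and their infinitesimal action. -/

namespace Supergroup

variable {k : Type*} [Field k] [CharZero k] {G : Supergroup k}

open WithConv LieSuperalgebra

theorem lslice_conj (h : G.Fun →ₐ[k] k) (φ : Module.Dual k G.Fun) (f : G.Fun) :
    lslice h.toLinearMap (lslice (φ ∘ₗ conj h) f) = lslice φ (lslice h.toLinearMap f) := by
  refine dual_ext (k := k) fun χ => ?_
  rw [lslice_lslice, lslice_lslice, lslice_conv, lslice_conv]
  have e : ∀ φ ψ : Module.Dual k G.Fun, toConv (ψ ∘ₗ lslice φ) = toConv φ * toConv ψ := fun φ ψ =>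
    ofConv_injective (LinearMap.ext fun f => lslice_conv φ ψ f)
  rw [e, e, comp_conj, show toConv h.toLinearMap * (toConv φ * toConv (h.comp G.antipode).toLinearMap) *
    toConv h.toLinearMap = toConv h.toLinearMap * toConv φ by
      rw [mul_assoc, mul_assoc, antipode_conv, mul_one]]

theorem oddProj_eq (f : G.Fun) : G.oddProj f = (2⁻¹ : k) • (f - G.parity f) := by
  rw [parity_apply, sub_sub_cancel, smul_smul, inv_mul_cancel₀ two_ne_zero, one_smul]

theorem oddProj_lslice_point (h : G.Fun →ₐ[k] k) (f : G.Fun) :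
    G.oddProj (lslice h.toLinearMap f) = lslice h.toLinearMap (G.oddProj f) := by
  rw [oddProj_eq, oddProj_eq f, map_smul, map_sub, lslice_parity, point_parity]

theorem transl_ad (h : G.Fun →ₐ[k] k) (x : G.lie) (f : G.Fun) :
    lslice h.toLinearMap (transl ((G.ad h).toLinearMap x : Module.Dual k G.Fun) f) =
      transl (x : Module.Dual k G.Fun) (lslice h.toLinearMap f) := by
  have e : ((G.ad h).toLinearMap x : Module.Dual k G.Fun) =
    (x : Module.Dual k G.Fun) ∘ₗ conj h := rfl
  rw [transl_eq, transl_eq, e, comp_conj_oddProj, map_sub, map_smul, ← oddProj_lslice_point,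
    lslice_conj, lslice_conj]

namespace ClosedSubgroup

variable {K : G.ClosedSubgroup}

theorem distTransl_distAct (h : K.points) (x : G.lie) (ψ : K.Dist) :
    K.distTransl h (K.distAct x ψ) = K.distAct ((G.ad h).toLinearMap x) (K.distTransl h ψ) := by
  refine Subtype.ext (LinearMap.ext fun f => ?_)
  refine congrArg (ψ : Module.Dual k K.quotFun) (Subtype.ext ?_)
  change transl _ (transl _ (f : G.Fun)) = transl _ (transl _ (f : G.Fun))
  rw [transl_point, transl_point, transl_ad]

theorem distTransl_delta (h : K.points) : K.distTransl h K.delta = K.delta := by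
  refine Subtype.ext (LinearMap.ext fun f => ?_)
  change counit (R := k) (transl _ (f : G.Fun)) = counit (R := k) (f : G.Fun)
  rw [transl_point, counit_lslice]
  exact K.point_apply_quotFun h.2 f.2

variable [IsAlgClosed k]

/-- The Nullstellensatz in the commutative algebra `k[G₀]`, where the ideal of `K₀` is radical by
reducedness. -/
theorem mem_of_forall_points {f : G.Fun} (hf : ∀ h ∈ K.points, h f = 0) :
    f ∈ K.ideal ⊔ G.oddIdeal := by
  let _ : CommRing G.EvenFun := { (inferInstance : Ring G.EvenFun) with mul_comm := evenFun_mul_comm }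
  have : Algebra.FiniteType k G.EvenFun := G.even.finiteType
  have key : ∀ a : G.Fun, G.toEven a ∈ K.ideal.map G.toEven ↔ a ∈ K.ideal ⊔ G.oddIdeal := fun a =>
    K.mem_map_restrEven
  rw [← key]
  have hr : (K.ideal.map G.toEven).IsRadical := by
    rintro x ⟨n, hn⟩
    obtain ⟨a, rfl⟩ := toEven_surjective x
    rw [← map_pow] at hn
    exact (key a).2 (K.reduced a n ((key _).1 hn))
  refine hr.mem_of_forall_algHom (k := k) fun φ hφ => ?_
  exact hf (φ.comp G.toEven) fun b hb => hφ _ (Ideal.mem_map_of_mem _ hb)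

/-- Differentiating an orbit map of `K₀` that is constant on a function gives zero. -/
theorem apply_quotTransl_eq_zero {φ : Module.Dual k K.quotFun} {f : K.quotFun} {c : k}
    (hc : ∀ h : K.points, φ (K.quotTransl (h : G.Fun →ₐ[k] k).toLinearMap f) = c) {y : G.lie}
    (hy : y ∈ K.lie.toSubmodule) (hy0 : y ∈ G.liePart 0) : φ (K.quotTransl y f) = 0 := by
  -- Extended to all of `k[G]`, the functional makes the orbit map `h ↦ φ(h f)` a function on `G`,
  -- namely `rslice ψ f`.
  obtain ⟨ψ, hψ⟩ := LinearMap.exists_extend (p := K.quotFun.toSubmodule) φ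
  have hψ' : ∀ b : K.quotFun, ψ b = φ b := fun b => LinearMap.congr_fun hψ b
  have e : ∀ χ : Module.Dual k G.Fun, χ (rslice ψ f) = ψ (lslice χ f) := fun χ => by
    rw [rslice_conv, lslice_conv]
  -- The orbit map is constant at the points of `K₀`, hence constant modulo the ideal of `K₀`, which
  -- the even element `y` of `𝔨` annihilates.
  have h1 : rslice ψ f - algebraMap k G.Fun c ∈ K.ideal ⊔ G.oddIdeal := by
    refine mem_of_forall_points fun h hh => ?_
    rw [map_sub, AlgHom.commutes, ← hc ⟨h, hh⟩, ← hψ', coe_quotTransl, transl_point]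
    exact sub_eq_zero.2 (e h.toLinearMap)
  obtain ⟨a, ha, b, hb, hab⟩ := Submodule.mem_sup.1 h1
  have h2 : (y : Module.Dual k G.Fun) (rslice ψ f - algebraMap k G.Fun c) = 0 := by
    rw [← hab, map_add, hy a ha, lie_even_oddIdeal hy0 b hb, add_zero]
  rw [map_sub, Algebra.algebraMap_eq_smul_one, map_smul, lie_one, smul_zero, sub_zero, e] at h2
  rw [← hψ', coe_quotTransl, transl_of_even hy0, h2]

theorem distAct_eq_zero_of_invariant {φ : K.Dist} (hφ : ∀ h : K.points, K.distTransl h φ = φ)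
    {y : G.lie} (hy : y ∈ K.lie.toSubmodule) (hy0 : y ∈ G.liePart 0) : K.distAct y φ = 0 := by
  refine Subtype.ext (LinearMap.ext fun f => ?_)
  refine apply_quotTransl_eq_zero (φ := (φ : Module.Dual k K.quotFun)) (f := f)
    (c := (φ : Module.Dual k K.quotFun) f) (fun h => ?_) hy hy0
  exact LinearMap.congr_fun (congrArg Subtype.val (hφ h)) f

end ClosedSubgroup

end Supergroup

/-! ### The embedding of `U(L) / U(L) L₀` in an odd-free module. -/

namespace LieSuperalgebra

variable {k L : Type*} [Field k] [CharZero k] [AddCommGroup L] [Module k L] [LieSuperalgebra k L]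
  {X : Type*} [AddCommGroup X] [Module k X] {r : L →ₗ[k] Module.End k X} {V : Submodule k X}
  {κ : Type*} [Fintype κ] {θ : κ → L}

/-- Freeness in `X` shows that an element of the kernel has no top part. Its multiples by odd
elements are in the kernel too, so `eq_zero_of_lprod` applies. -/
theorem OddFree.uquotLift_injective (h : OddFree r V θ) {δ : X} (hδV : δ ∈ V) (hδ : δ ≠ 0)
    (h0 : ∀ y ∈ part (k := k) (L := L) 0, r y δ = 0) :
    Function.Injective (UQuot.lift h.isRep δ h0) := by
  have hM := h.evenQuot hδV hδ h0
  set F := UQuot.lift h.isRep δ h0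
  have hF1 : F (UQuot.mk _ 1) = δ := by rw [UQuot.lift_mk, map_one]; rfl
  have hN : ∀ w, F w = 0 → w ∈ oddFil (evenQuotAct k L) (unitLine k L) (Fintype.card κ) := by
    intro w hw
    obtain ⟨n, hn⟩ := exists_mem_oddFil_evenQuot w
    obtain ⟨z, hz, hd⟩ := hM.exists_top hn
    obtain ⟨c, rfl⟩ := Submodule.mem_span_singleton.1 hz
    have h1 := fil_map_le F (fun x _ => UQuot.lift_act x) (W := V)
      (fun v hv => by
        obtain ⟨c, rfl⟩ := Submodule.mem_span_singleton.1 hv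
        rw [map_smul, hF1]
        exact V.smul_mem _ hδV) _ _ hd
    rw [map_sub, hw, zero_sub, Submodule.neg_mem_iff, mon, lprod_comm _ UQuot.lift_act, map_smul,
      hF1] at h1
    have h2 := h.top _ (V.smul_mem c hδV) h1
    rw [(smul_eq_zero.1 h2).resolve_right hδ, zero_smul, map_zero, sub_zero] at hd
    exact hd
  rw [injective_iff_map_eq_zero]
  intro w hw
  refine hM.eq_zero_of_lprod (hN w hw) fun l _ => hN _ ?_
  rw [lprod_comm _ UQuot.lift_act, hw, map_zero]

end LieSuperalgebra

/-! ### The isomorphisms with induced modules. -/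

namespace Supergroup

variable {k : Type*} [Field k] [CharZero k] {G : Supergroup k}

open LieSuperalgebra

namespace ClosedSubgroup

variable {θ : G.Involution} {K K' : G.ClosedSubgroup}

theorem pushDist_evenDistAct (x : part (k := k) (L := K'.lie.toSubmodule) 0) (ψ : K.even.Dist) :
    K.pushDist (K.evenDistAct K' x ψ) =
      K.distActComp (Hom.incl K'.lie) (x : K'.lie.toSubmodule) (K.pushDist ψ) :=
  K.pushDist_distAct _ ψ

variable (K K') in
/-- The map `u ⊗ ψ ↦ u · i_* ψ` -/
def indToDist : Ind (K.evenDistAct K') →ₗ[k] K.Dist :=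
  Ind.lift (isRep_distActComp (f := Hom.incl K'.lie)) K.pushDist pushDist_evenDistAct

theorem indToDist_mk (u : U k K'.lie.toSubmodule) (ψ : K.even.Dist) :
    K.indToDist K' (Ind.mk _ u ψ) =
      (isRep_distActComp (K := K) (f := Hom.incl K'.lie)).lift u (K.pushDist ψ) := rfl

theorem indToDist_act (x : K'.lie.toSubmodule) (w : Ind (K.evenDistAct K')) :
    K.indToDist K' (Ind.act _ x w) = K.distAct (x : G.lie) (K.indToDist K' w) :=
  Ind.lift_act x w

theorem distTransl_lift {h : K.points} (hh : (h : G.Fun →ₐ[k] k) ∈ K'.points)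
    (u : U k K'.lie.toSubmodule) (φ : K.Dist) :
    K.distTransl h ((isRep_distActComp (K := K) (f := Hom.incl K'.lie)).lift u φ) =
      (isRep_distActComp (f := Hom.incl K'.lie)).lift (U.map (K'.ad ⟨h, hh⟩) u)
        (K.distTransl h φ) := by
  have hA : ∀ (x : K'.lie.toSubmodule) (φ : K.Dist),
      K.distTransl h (K.distActComp (Hom.incl K'.lie) x φ) =
        K.distActComp (Hom.incl K'.lie) ((K'.ad ⟨h, hh⟩).toLinearMap x) (K.distTransl h φ) :=
    fun x φ => K.distTransl_distAct h (x : G.lie) φ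
  exact IsRep.apply_lift _ hA u φ

section even

/-- The map `[w] ↦ w δ` from `U(𝔤₀) / U(𝔤₀) 𝔨₀` to `Dist(G₀/K₀, eK₀)`. -/
def evenUQuotToDist (K : G.ClosedSubgroup) :
    UQuot (k := k) K.lieEvenSub →ₗ[k] K.even.Dist :=
  uquotToDist (f := G.lieRestrHom) K.mem_lieEvenSub_iff

theorem evenUQuotToDist_act (x : (lieEven G).toSubmodule) (w : UQuot (k := k) K.lieEvenSub) :
    K.evenUQuotToDist (UQuot.act _ x w) = K.even.distAct (G.lieRestr x) (K.evenUQuotToDist w) :=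
  uquotToDist_act _ x w

theorem pushDist_lift (w : U k (lieEven G).toSubmodule) (ψ : K.even.Dist) :
    K.pushDist ((isRep_distActComp (K := K.even) (f := G.lieRestrHom)).lift w ψ) =
      K.isRep_distAct.lift (U.map (Hom.incl (lieEven G)) w) (K.pushDist ψ) := by
  have hA : ∀ (x : (lieEven G).toSubmodule) (ψ : K.even.Dist),
      K.pushDist (K.even.distActComp G.lieRestrHom x ψ) =
        K.distAct ((Hom.incl (lieEven G)).toLinearMap x) (K.pushDist ψ) :=
    fun x ψ => K.pushDist_distAct x ψ
  exact IsRep.map_lift _ _ hA w ψ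

theorem pushDist_evenUQuotToDist_mk (w : U k (lieEven G).toSubmodule) :
    K.pushDist (K.evenUQuotToDist (UQuot.mk _ w)) =
      K.isRep_distAct.lift (U.map (Hom.incl (lieEven G)) w) K.delta :=
  K.pushDist_lift w K.even.delta

theorem map_incl_map_adEven (h : G.Fun →ₐ[k] k) (w : U k (lieEven G).toSubmodule) :
    U.map (Hom.incl (lieEven G)) (U.map (adEven h) w) =
      U.map (G.ad h) (U.map (Hom.incl (lieEven G)) w) := by
  induction w using U.induction with
  | one => simp
  | mul x u hu =>
    rw [map_mul, map_mul, map_mul, map_mul, hu, U.map_ι, U.map_ι, U.map_ι, U.map_ι]; rfl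
  | add u v hu hv => simp only [map_add, hu, hv]
  | smul c u hu => simp only [map_smul, hu]

theorem pushDist_evenUQuotToDist_ad (h : K.points) (w : UQuot (k := k) K.lieEvenSub) :
    K.pushDist (K.evenUQuotToDist (K.adEvenUQuot h w)) =
      K.distTransl h (K.pushDist (K.evenUQuotToDist w)) := by
  obtain ⟨w, rfl⟩ := UQuot.mk_surjective w
  rw [show K.adEvenUQuot h (UQuot.mk _ w) = UQuot.mk _ (U.map (adEven h) w) from rfl,
    pushDist_evenUQuotToDist_mk, pushDist_evenUQuotToDist_mk, map_incl_map_adEven,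
    K.isRep_distAct.apply_lift (distTransl_distAct h), distTransl_delta]

end even

section full

variable (G) in
/-- The identity of the Lie superalgebra of `G` -/
def lieId : Hom k G.lie G.lie where
  toLinearMap := LinearMap.id
  map_part _ _ hx := hx
  map_bracket _ _ := rfl

/-- The map `[u] ↦ u δ` from `U(𝔤) / U(𝔤) 𝔨` to `Dist(G/K, eK)`. -/
def fullUQuotToDist (K : G.ClosedSubgroup) :
    UQuot (k := k) K.lie.toSubmodule →ₗ[k] K.Dist :=
  uquotToDist (f := lieId G) fun _ => Iff.rfl

theorem fullUQuotToDist_mk (u : U k G.lie) :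
    K.fullUQuotToDist (UQuot.mk _ u) = K.isRep_distAct.lift u K.delta := rfl

theorem fullUQuotToDist_act (x : G.lie) (w : UQuot (k := k) K.lie.toSubmodule) :
    K.fullUQuotToDist (UQuot.act _ x w) = K.distAct x (K.fullUQuotToDist w) :=
  uquotToDist_act _ x w

theorem fullUQuotToDist_ad (h : K.points) (w : UQuot (k := k) K.lie.toSubmodule) :
    K.fullUQuotToDist (K.adUQuot h w) = K.distTransl h (K.fullUQuotToDist w) := by
  obtain ⟨w, rfl⟩ := UQuot.mk_surjective w
  rw [show K.adUQuot h (UQuot.mk _ w) = UQuot.mk _ (U.map (G.ad h) w) from rfl,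
    fullUQuotToDist_mk, fullUQuotToDist_mk, K.isRep_distAct.apply_lift (distTransl_distAct h),
    distTransl_delta]

theorem fullUQuotToDist_bijective (hK : θ.IsSymmetric K) (hX : K.IsAffineQuotient) :
    Function.Bijective K.fullUQuotToDist := by
  obtain ⟨n, p, x, b, hb⟩ := hK.exists_isDualBasis hX
  exact hb.uquotToDist_bijective (f := lieId G) _ (x' := x) (fun _ => rfl) hb.mem_liePart

theorem evenUQuotToDist_bijective (hK : θ.IsSymmetric K) (hX₀ : K.even.IsAffineQuotient) :
    Function.Bijective K.evenUQuotToDist := by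
  obtain ⟨n, p, _, b, hb⟩ := hK.even.exists_isDualBasis hX₀
  choose y hy hyx using fun i => lieRestrHom_surjective (p i) (hb.mem_liePart i)
  exact hb.uquotToDist_bijective (f := G.lieRestrHom) _ (x' := y) hyx hy

end full

variable (K K') in
/-- The map `u ⊗ [w] ↦ u w δ` -/
def indUQuotToDist : Ind (K.evenUAct K') →ₗ[k] K.Dist :=
  Ind.lift (isRep_distActComp (f := Hom.incl K'.lie)) (K.pushDist ∘ₗ K.evenUQuotToDist)
    fun _ w => (congrArg K.pushDist (evenUQuotToDist_act _ w)).trans (K.pushDist_distAct _ _)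

theorem indUQuotToDist_mk (u : U k K'.lie.toSubmodule) (w : UQuot (k := k) K.lieEvenSub) :
    K.indUQuotToDist K' (Ind.mk _ u w) =
      (isRep_distActComp (K := K) (f := Hom.incl K'.lie)).lift u
        (K.pushDist (K.evenUQuotToDist w)) := rfl

section bijective

variable (hK : θ.IsSymmetric K) (hK' : θ.IsDual K K') (hX : K.IsAffineQuotient)
  (hX₀ : K.even.IsAffineQuotient)
include hK hK' hX hX₀

theorem indToDist_bijective : Function.Bijective (K.indToDist K') :=
  Ind.lift_bijective (pushDist_injective hK hX hX₀) (oddFree_dual hK hK' hX)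
    (exists_mem_oddFil_dist hK hK' hX)

/-- The isomorphism `[w] ↦ w δ` identifies `U(𝔤₀) / U(𝔤₀) 𝔨₀` with the distributions on `G₀/K₀`, so
the image in `Dist(G/K, eK)` is that of the pushforward and the same freeness and generation apply.
-/
theorem indUQuotToDist_bijective : Function.Bijective (K.indUQuotToDist K') := by
  have h := evenUQuotToDist_bijective hK hX₀
  have e : LinearMap.range (K.pushDist ∘ₗ K.evenUQuotToDist) = LinearMap.range K.pushDist :=
    LinearMap.range_comp_of_range_eq_top _ (LinearMap.range_eq_top.2 h.2)
  refine Ind.lift_bijective (θ := oddBasis k K'.lie.toSubmodule)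
    ((pushDist_injective hK hX hX₀).comp h.1) ?_ ?_ <;> rw [e]
  · exact oddFree_dual hK hK' hX
  · exact exists_mem_oddFil_dist hK hK' hX

/-- The isomorphism of `Ind (U(𝔤₀) / U(𝔤₀) 𝔨₀)` with `U(𝔤) / U(𝔤) 𝔨` -/
def indUQuotEquiv : Ind (K.evenUAct K') ≃ₗ[k] UQuot (k := k) K.lie.toSubmodule :=
  (LinearEquiv.ofBijective _ (indUQuotToDist_bijective hK hK' hX hX₀)).trans
    (LinearEquiv.ofBijective _ (fullUQuotToDist_bijective hK hX)).symm

theorem fullUQuotToDist_indUQuotEquiv (w : Ind (K.evenUAct K')) :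
    K.fullUQuotToDist (indUQuotEquiv hK hK' hX hX₀ w) = K.indUQuotToDist K' w :=
  LinearEquiv.apply_symm_apply (LinearEquiv.ofBijective _ (fullUQuotToDist_bijective hK hX)) _

/-- Both sides become `u w δ` in `Dist(G/K, eK)`, where they may be compared. -/
theorem indUQuotEquiv_mk (u : U k K'.lie.toSubmodule) (w : U k (lieEven G).toSubmodule) :
    indUQuotEquiv hK hK' hX hX₀ (Ind.mk _ u (UQuot.mk _ w)) =
      UQuot.mk _ (U.map (Hom.incl K'.lie) u * U.map (Hom.incl (lieEven G)) w) := by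
  refine (fullUQuotToDist_bijective hK hX).1 ?_
  rw [fullUQuotToDist_indUQuotEquiv, indUQuotToDist_mk, pushDist_evenUQuotToDist_mk,
    fullUQuotToDist_mk, map_mul, Module.End.mul_apply]
  exact LinearMap.congr_fun (IsRep.lift_map K.isRep_distAct (Hom.incl K'.lie) u).symm _

theorem indUQuotEquiv_act (x : K'.lie.toSubmodule) (w : Ind (K.evenUAct K')) :
    indUQuotEquiv hK hK' hX hX₀ (Ind.act _ x w) =
      UQuot.act _ (x : G.lie) (indUQuotEquiv hK hK' hX hX₀ w) := by
  refine (fullUQuotToDist_bijective hK hX).1 ?_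
  rw [fullUQuotToDist_act, fullUQuotToDist_indUQuotEquiv, fullUQuotToDist_indUQuotEquiv]
  exact Ind.lift_act x w

theorem indUQuotEquiv_ad {h : K.points} (hh : (h : G.Fun →ₐ[k] k) ∈ K'.points)
    (u : U k K'.lie.toSubmodule) (w : UQuot (k := k) K.lieEvenSub) :
    indUQuotEquiv hK hK' hX hX₀ (Ind.mk _ (U.map (K'.ad ⟨h, hh⟩) u) (K.adEvenUQuot h w)) =
      K.adUQuot h (indUQuotEquiv hK hK' hX hX₀ (Ind.mk _ u w)) := by
  refine (fullUQuotToDist_bijective hK hX).1 ?_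
  rw [fullUQuotToDist_ad, fullUQuotToDist_indUQuotEquiv, fullUQuotToDist_indUQuotEquiv,
    indUQuotToDist_mk, indUQuotToDist_mk, pushDist_evenUQuotToDist_ad, distTransl_lift hh]

end bijective

/-! ### Ghost distributions -/

theorem evenPoints_surjective : Function.Surjective K.evenPoints := by
  intro h
  refine ⟨⟨(h : G.even.Fun →ₐ[k] k).comp G.restrEven, fun f hf =>
    h.2 _ (Ideal.mem_map_of_mem _ hf)⟩, Subtype.ext (AlgHom.ext fun f => ?_)⟩
  obtain ⟨a, rfl⟩ := restrEven_surjective f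
  rfl

theorem mem_evenDistInvariants_iff (hK : θ.IsSymmetric K) (hX : K.IsAffineQuotient)
    (hX₀ : K.even.IsAffineQuotient) {ψ : K.even.Dist} : ψ ∈ K.evenDistInvariants ↔
      ∀ h : K.points, K.distTransl h (K.pushDist ψ) = K.pushDist ψ := by
  constructor
  · intro hψ h
    rw [← pushDist_distTransl, hψ]
  · intro hψ h
    obtain ⟨h, rfl⟩ := evenPoints_surjective h
    refine pushDist_injective hK hX hX₀ ?_
    rw [pushDist_distTransl, hψ]

theorem dual_even_act_delta (hK' : θ.IsDual K K') : ∀ y ∈ part (k := k) (L := K'.lie.toSubmodule) 0,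
    K.distActComp (Hom.incl K'.lie) y K.delta = 0 :=
  fun y hy => K.distAct_delta ((hK'.mem_lie_even hy).1 y.2)

variable [IsAlgClosed k]

/-- What `exists_ghost` asks beyond algebra is that functionals invariant under `K₀` are invariant
under `𝔨₀`. It is checked after embedding `U(𝔨') / U(𝔨') 𝔨₀` in the distributions by `[u] ↦ u δ`,
where an orbit map can be differentiated. -/
theorem dual_ghost_exists (hK : θ.IsSymmetric K) (hK' : θ.IsDual K K') (hX : K.IsAffineQuotient)
    (hT : K'.TopExteriorTrivial) : ∃ v, K'.IsGhost v := by
  have hf := oddFree_dual hK hK' hX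
  have hδ : K.delta ∈ LinearMap.range K.pushDist := ⟨_, K.pushDist_delta⟩
  have h0 := dual_even_act_delta hK'
  have hM := hf.evenQuot hδ K.delta_ne_zero h0
  let F : EvenQuot k K'.lie.toSubmodule →ₗ[k] K.Dist := UQuot.lift hf.isRep K.delta h0
  have hF1 : F (UQuot.mk _ 1) = K.delta := by
    change hf.isRep.lift 1 K.delta = _
    rw [map_one]; rfl
  have hFinj : Function.Injective F := hf.uquotLift_injective hδ K.delta_ne_zero h0
  have := finiteDimensional_evenQuot hM
  -- Functions separate distributions, so on a finite-dimensional space of distributions every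
  -- functional is evaluation at a function on `G/K`.
  have hsurj : Function.Surjective ((Submodule.subtype _ ∘ₗ F).flip) :=
    LinearMap.flip_surjective_iff₁.2 (Subtype.val_injective.comp hFinj)
  have hFad : ∀ (h : K'.points) (hh : (h : G.Fun →ₐ[k] k) ∈ K.points) w,
      F (UQuot.mapLinear (K'.ad h) ((K'.ad h).map_part 0) w) = K.distTransl ⟨h, hh⟩ (F w) := by
    intro h hh w
    obtain ⟨u, rfl⟩ := UQuot.mk_surjective w
    rw [UQuot.mapLinear_mk]
    change hf.isRep.lift _ K.delta = K.distTransl ⟨h, hh⟩ (hf.isRep.lift u K.delta)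
    refine Eq.symm ((distTransl_lift (K := K) (K' := K') (h := ⟨h, hh⟩) h.2 u K.delta).trans ?_)
    rw [distTransl_delta]
    rfl
  obtain ⟨v, h1, h2, h3⟩ := exists_ghost (a := K'.ad) hT hM
    (fun h => K.delta_ne_zero (by rw [← hF1, h, map_zero])) fun τ hτ y hy w => by
      obtain ⟨f, rfl⟩ := hsurj τ
      change (F (evenQuotAct k _ y w) : Module.Dual k K.quotFun) f = 0
      rw [show F (evenQuotAct k _ y w) = K.distAct (y : G.lie) (F w) from UQuot.lift_act y w]
      refine apply_quotTransl_eq_zero (φ := (F w : Module.Dual k K.quotFun)) (f := f)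
        (c := (F w : Module.Dual k K.quotFun) f) (fun h => ?_) ((hK'.mem_lie_even hy).1 y.2) hy
      have e := hτ ⟨h, points_of_even_eq hK'.1 h.2⟩ w
      change (F _ : Module.Dual k K.quotFun) f = (F w : Module.Dual k K.quotFun) f at e
      rw [hFad _ h.2] at e
      exact e
  exact ⟨v, h1, h2, h3⟩

/-- Multiplication by a ghost, from the invariant distributions on `G₀/K₀` to those on `G/K`. -/
theorem exists_ghost_equiv (hK : θ.IsSymmetric K) (hK' : θ.IsDual K K') (hX : K.IsAffineQuotient)
    (hX₀ : K.even.IsAffineQuotient) (hT : K'.TopExteriorTrivial) {v : U k K'.lie.toSubmodule}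
    (hv : K'.IsGhost v) : ∃ E : K.evenDistInvariants ≃ₗ[k] K.distInvariants K',
      ∀ z : K.evenDistInvariants,
        (E z : K.Dist) = K.indToDist K' (Ind.mk _ v (z : K.even.Dist)) := by
  have hf := oddFree_dual hK hK' hX
  have hM := hf.evenQuot ⟨_, K.pushDist_delta⟩ K.delta_ne_zero (dual_even_act_delta hK')
  have hp : ∀ h : K.points, (h : G.Fun →ₐ[k] k) ∈ K'.points := fun h =>
    points_of_even_eq hK'.1 h.2
  -- Applied with the image of the pushforward as `V` and the points of `K₀` as group. Invariance
  -- under these points implies invariance under `𝔨₀` by `distAct_eq_zero_of_invariant`.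
  obtain ⟨h1, h2, h3⟩ := ghost_mul_bijective (a := fun h : K.points => K'.ad ⟨h, hp h⟩)
    (fun h => hT ⟨h, hp h⟩) (A := K.distTransl) (fun h x φ => distTransl_distAct h (x : G.lie) φ)
    (by rintro h _ ⟨ψ, rfl⟩; exact ⟨_, K.pushDist_distTransl h ψ⟩) hf
    (exists_mem_oddFil_dist hK hK' hX) hM
    (fun z _ hz y hy => distAct_eq_zero_of_invariant hz ((hK'.mem_lie_even hy).1 y.2) hy)
    hv.ne_zero hv.lie_invariant (fun h => hv.group_invariant ⟨h, hp h⟩)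
  have hmem := fun z : K.evenDistInvariants => (mem_evenDistInvariants_iff hK hX hX₀).1 z.2
  let m : K.evenDistInvariants →ₗ[k] K.distInvariants K' :=
    LinearMap.codRestrict _ (hf.isRep.lift v ∘ₗ K.pushDist ∘ₗ Submodule.subtype _)
      fun z => h1 _ ⟨_, rfl⟩ (hmem z)
  refine ⟨LinearEquiv.ofBijective m ⟨?_, fun d => ?_⟩, fun z => rfl⟩
  · rw [injective_iff_map_eq_zero]
    intro z hz
    have := h2 _ ⟨_, rfl⟩ (hmem z) (congrArg Subtype.val hz)
    exact Subtype.ext (pushDist_injective hK hX hX₀ (this.trans (map_zero _).symm))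
  · obtain ⟨_, ⟨ψ, rfl⟩, hψ, e⟩ := h3 _ d.2.1 d.2.2
    exact ⟨⟨ψ, (mem_evenDistInvariants_iff hK hX hX₀).2 hψ⟩, Subtype.ext e⟩

end ClosedSubgroup

end Supergroup

end

/-- Being a map of `K'`-modules is spelled out as compatibility with `𝔨'` and with the points of
`K₀`, the latter on pure tensors. Compatibility with `𝔨'` together with the value on `1 ⊗ ψ`
determines `Φ` as `u ⊗ ψ ↦ u · i_* ψ`. The claim about invariants stands inside the first existence
statement because it concerns the same `Φ`. -/
theorem theorem1p1 {k : Type*} [Field k] [IsAlgClosed k] [CharZero k] (G : Supergroup k)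
    (θ : G.Involution) (K K' : G.ClosedSubgroup) (hK : θ.IsSymmetric K) (hK' : θ.IsDual K K')
    (hX : K.IsAffineQuotient) (hX₀ : K.even.IsAffineQuotient) :
    (∃ Φ : LieSuperalgebra.Ind (K.evenDistAct K') ≃ₗ[k] K.Dist,
      (∀ ψ : K.even.Dist, Φ (LieSuperalgebra.Ind.mk _ 1 ψ) = K.pushDist ψ) ∧
      (∀ (x : K'.lie.toSubmodule) (w : LieSuperalgebra.Ind (K.evenDistAct K')),
        Φ (LieSuperalgebra.Ind.act _ x w) = K.distAct (x : G.lie) (Φ w)) ∧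
      (∀ (h : K.points) (u : LieSuperalgebra.U k K'.lie.toSubmodule) (ψ : K.even.Dist),
        Φ (LieSuperalgebra.Ind.mk _
            (LieSuperalgebra.U.map
              (K'.ad ⟨h, Supergroup.ClosedSubgroup.points_of_even_eq hK'.1 h.2⟩) u)
            (K.even.distTransl (K.evenPoints h) ψ)) =
          K.distTransl h (Φ (LieSuperalgebra.Ind.mk _ u ψ))) ∧
      (K'.TopExteriorTrivial →
        (∃ v, K'.IsGhost v) ∧
        ∀ v, K'.IsGhost v →
          ∃ E : K.evenDistInvariants ≃ₗ[k] K.distInvariants K',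
            ∀ z : K.evenDistInvariants,
              (E z : K.Dist) = Φ (LieSuperalgebra.Ind.mk _ v (z : K.even.Dist)))) ∧
    (∃ Ψ : LieSuperalgebra.Ind (K.evenUAct K') ≃ₗ[k]
        LieSuperalgebra.UQuot (k := k) K.lie.toSubmodule,
      (∀ (u : LieSuperalgebra.U k K'.lie.toSubmodule)
        (w : LieSuperalgebra.U k (Supergroup.ClosedSubgroup.lieEven G).toSubmodule),
        Ψ (LieSuperalgebra.Ind.mk _ u (LieSuperalgebra.UQuot.mk _ w)) =
          LieSuperalgebra.UQuot.mk _
            (LieSuperalgebra.U.map (LieSuperalgebra.Hom.incl K'.lie) u *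
              LieSuperalgebra.U.map
                (LieSuperalgebra.Hom.incl (Supergroup.ClosedSubgroup.lieEven G)) w)) ∧
      (∀ (x : K'.lie.toSubmodule) (w : LieSuperalgebra.Ind (K.evenUAct K')),
        Ψ (LieSuperalgebra.Ind.act _ x w) = LieSuperalgebra.UQuot.act _ (x : G.lie) (Ψ w)) ∧
      (∀ (h : K.points) (u : LieSuperalgebra.U k K'.lie.toSubmodule)
        (w : LieSuperalgebra.UQuot (k := k) K.lieEvenSub),
        Ψ (LieSuperalgebra.Ind.mk _
            (LieSuperalgebra.U.map
              (K'.ad ⟨h, Supergroup.ClosedSubgroup.points_of_even_eq hK'.1 h.2⟩) u)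
            (K.adEvenUQuot h w)) =
          K.adUQuot h (Ψ (LieSuperalgebra.Ind.mk _ u w)))) := by
  open Supergroup.ClosedSubgroup in
  refine ⟨⟨LinearEquiv.ofBijective _ (indToDist_bijective hK hK' hX hX₀), fun ψ => ?_,
    indToDist_act, fun h u ψ => ?_, fun hT =>
    ⟨dual_ghost_exists hK hK' hX hT, fun v hv => exists_ghost_equiv hK hK' hX hX₀ hT hv⟩⟩,
    indUQuotEquiv hK hK' hX hX₀, indUQuotEquiv_mk hK hK' hX hX₀, indUQuotEquiv_act hK hK' hX hX₀,
    fun h u w => indUQuotEquiv_ad hK hK' hX hX₀ _ u w⟩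
  · change K.indToDist K' (LieSuperalgebra.Ind.mk _ 1 ψ) = _
    rw [indToDist_mk, map_one]; rfl
  · change K.indToDist K' (LieSuperalgebra.Ind.mk _ _ _) =
      K.distTransl h (K.indToDist K' (LieSuperalgebra.Ind.mk _ u ψ))
    rw [indToDist_mk, indToDist_mk, pushDist_distTransl, distTransl_lift]
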